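/- Consider an array of linear regressions indexed by $n\in\mathbb N$, with sample sizes $T=T_n\to\infty$ and numbers of regressors $K=K_n$ (all objects below depend on $n$, which is suppressed; each $n$ may have its own probability space). Fix constants $c>0$ and $C<\infty$ not depending on $n$. Let $$y_t=x_t'\beta+\varepsilon_t,\qquad x_t=\tilde x_t+\alpha\,\varepsilon_{t-1},\qquad t=1,\dots,T,$$ where $\tilde X=[\tilde x_1,\dots,\tilde x_T]'$ is a random $T\times K$ matrix, $X=[x_1,\dots,x_T]'$, $y=(y_1,\dots,y_T)'$, and $\alpha,\beta,r\in\mathbb R^K$ are non-random with $r\neq0$. Suppose that (i) $\tilde X$ has full column rank $K$ almost surely; (ii) conditionally on $\tilde X$, the errors $\varepsilon_0,\dots,\varepsilon_T$ are i.i.d., with $\mathbb E[\varepsilon_t\mid\tilde X]=0$, $c<\sigma^2:=\mathbb E[\varepsilon_t^2\mid\tilde X]<C$ and $\mathbb E[\varepsilon_t^4\mid\tilde X]<C$ almost surely; (iii) $\alpha'(\frac1T\tilde X'\tilde X)^{-1}\alpha=O_p(1)$ and $r'(\frac1T\tilde X'\tilde X)^{-1}r=O_p(1)$; (iv) $K/T<1-c$;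 (v) $\varepsilon_1$ is Gaussian conditionally on $\tilde X$. Let $D$ be the $T\times T$ lag matrix whose only non-zero entries are $D_{t,t-1}=1$ for $t=2,\dots,T$. Let $\Gamma$ be a $\tilde X$-measurable random $T\times T$ matrix with spectral norm $\|\Gamma\|<1-c$ and $\operatorname{tr}[D'(I-\Gamma)\tilde M_\Gamma]=0$ almost surely, where $\tilde M_\Gamma=I-\tilde X(\tilde X'(I-\Gamma)\tilde X)^{-1}\tilde X'(I-\Gamma)$. Write $M_\Gamma=I-X(X'(I-\Gamma)X)^{-1}X'(I-\Gamma)$ and $$\hat\beta^{IV}(\Gamma)=(X'(I-\Gamma)X)^{-1}X'(I-\Gamma)y,\qquad \hat\sigma^2(\Gamma)=\frac{y'(I-\Gamma)M_\Gamma y}{\operatorname{tr}[(I-\Gamma)\tilde M_\Gamma]},$$ $$B=D'(I-\Gamma)\tilde M_\Gamma,\qquad \psi=\frac{|\operatorname{tr}(B^2)|}{\operatorname{tr}(B'B)},\qquad V_T=(1+\psi)\,\hat\sigma^2(\Gamma)\,\big\|r'(X'(I-\Gamma)X)^{-1}X'(I-\Gamma)\big\|^2.$$ Then, as $n\to\infty$,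 there are $\tilde X$-measurable random variables $\varSigma_T>0$ such that $$\frac{r'\hat\beta^{IV}(\Gamma)-r'\beta}{\sqrt{\varSigma_T}}\Rightarrow N(0,1)\qquad\text{and}\qquad \mathbb P(\varSigma_T\le V_T)\to1.$$ Consequently inference based on $V_T$ is asymptotically valid, though possibly conservative: for every $z>0$ and $N\sim N(0,1)$, $$\liminf_{n\to\infty}\ \mathbb P\big(|r'\hat\beta^{IV}(\Gamma)-r'\beta|\le z\sqrt{V_T}\big)\ \ge\ \mathbb P(|N|\le z).$$ -/

import Mathlib

open Filter Topology MeasureTheory ProbabilityTheory Matrix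

noncomputable section

namespace FeedbackIV

/-! ### Matrices. Row `i : Fin T` of a `T × K` matrix is the observation of period `i + 1`. -/

/-- The Borel σ-algebra on real matrices: the product σ-algebra over the entries. -/
instance instMeasurableSpaceRealMatrix (m k : ℕ) :
    MeasurableSpace (Matrix (Fin m) (Fin k) ℝ) :=
  inferInstanceAs (MeasurableSpace (Fin m → Fin k → ℝ))

/-- The lag matrix `D`: its only non-zero entries are `D t (t - 1) = 1`. -/
def lagMatrix (T : ℕ) : Matrix (Fin T) (Fin T) ℝ :=
  Matrix.of fun i j => if (i : ℕ) = (j : ℕ) + 1 then 1 else 0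

/-- The spectral norm, i.e. the operator norm for the Euclidean norm. -/
def opNorm {T : ℕ} (A : Matrix (Fin T) (Fin T) ℝ) : ℝ :=
  ‖Matrix.toEuclideanCLM (𝕜 := ℝ) A‖

/-- The Euclidean norm of a vector. -/
def euclNorm {T : ℕ} (v : Fin T → ℝ) : ℝ := ‖WithLp.toLp 2 v‖

/-- `(X'(I - Γ)X)⁻¹ X'(I - Γ)`, with which the IV estimator is applied to the outcomes. -/
def ivWeights {T K : ℕ} (X : Matrix (Fin T) (Fin K) ℝ) (Γ : Matrix (Fin T) (Fin T) ℝ) :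
    Matrix (Fin K) (Fin T) ℝ :=
  (Xᵀ * (1 - Γ) * X)⁻¹ * (Xᵀ * (1 - Γ))

/-- The IV estimator `(X'(I - Γ)X)⁻¹ X'(I - Γ) y`. -/
def betaIV {T K : ℕ} (X : Matrix (Fin T) (Fin K) ℝ) (y : Fin T → ℝ)
    (Γ : Matrix (Fin T) (Fin T) ℝ) : Fin K → ℝ :=
  ivWeights X Γ *ᵥ y

/-- The oblique projection `I - X (X'(I - Γ)X)⁻¹ X'(I - Γ)`. -/
def obliqueProj {T K : ℕ} (X : Matrix (Fin T) (Fin K) ℝ) (Γ : Matrix (Fin T) (Fin T) ℝ) :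
    Matrix (Fin T) (Fin T) ℝ :=
  1 - X * ivWeights X Γ

/-- The matrix `D'(I - Γ)M`, where `M` is the oblique projection built from `Xs`. -/
def feedbackForm {T K : ℕ} (Xs : Matrix (Fin T) (Fin K) ℝ) (Γ : Matrix (Fin T) (Fin T) ℝ) :
    Matrix (Fin T) (Fin T) ℝ :=
  (lagMatrix T)ᵀ * (1 - Γ) * obliqueProj Xs Γ

/-- The correction `ψ = |tr(B²)| / tr(B'B)` with `B = D'(I - Γ)M`. -/
def psi {T K : ℕ} (Xs : Matrix (Fin T) (Fin K) ℝ) (Γ : Matrix (Fin T) (Fin T) ℝ) : ℝ :=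
  |(feedbackForm Xs Γ * feedbackForm Xs Γ).trace| /
    ((feedbackForm Xs Γ)ᵀ * feedbackForm Xs Γ).trace

/-- The variance estimator `y'(I - Γ) M_Γ y / tr[(I - Γ) M]`: the numerator uses the oblique
projection of the observed regressors `X`, the degrees of freedom in the denominator that of the
strictly exogenous part `Xs`. -/
def sigmaHatSq {T K : ℕ} (Xs X : Matrix (Fin T) (Fin K) ℝ) (y : Fin T → ℝ)
    (Γ : Matrix (Fin T) (Fin T) ℝ) : ℝ :=
  (y ⬝ᵥ (((1 - Γ) * obliqueProj X Γ) *ᵥ y)) / ((1 - Γ) * obliqueProj Xs Γ).trace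

/-- The conservative variance `(1 + ψ) σ̂²(Γ) ‖r'(X'(I - Γ)X)⁻¹X'(I - Γ)‖²`. -/
def varianceBound {T K : ℕ} (Xs X : Matrix (Fin T) (Fin K) ℝ) (y : Fin T → ℝ)
    (Γ : Matrix (Fin T) (Fin T) ℝ) (r : Fin K → ℝ) : ℝ :=
  (1 + psi Xs Γ) * sigmaHatSq Xs X y Γ * euclNorm (r ᵥ* ivWeights X Γ) ^ 2

/-! ### The data generating process. The errors are `e 0, …, e T`. -/

/-- The observed regressors `x_t = x̃_t + α ε_{t-1}`, `t = 1, …, T`. -/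
def regressors {T K : ℕ} (Xs : Matrix (Fin T) (Fin K) ℝ) (α : Fin K → ℝ)
    (e : Fin (T + 1) → ℝ) : Matrix (Fin T) (Fin K) ℝ :=
  Matrix.of fun i k => Xs i k + α k * e i.castSucc

/-- The outcomes `y_t = x_t'β + ε_t`, `t = 1, …, T`. -/
def outcomes {T K : ℕ} (Xs : Matrix (Fin T) (Fin K) ℝ) (α β : Fin K → ℝ)
    (e : Fin (T + 1) → ℝ) : Fin T → ℝ :=
  fun i => (regressors Xs α e *ᵥ β) i + e i.succ

/-! ### Probability -/

/-- `Y n = O_p(1)`, where `Y n` lives on its own probability space. -/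
def IsBoundedInProb {Ω : ℕ → Type*} [∀ n, MeasurableSpace (Ω n)] (P : ∀ n, Measure (Ω n))
    (Y : ∀ n, Ω n → ℝ) : Prop :=
  ∀ δ : ℝ, 0 < δ → ∃ M : ℝ, ∀ᶠ n in atTop, P n {ω | M < |Y n ω|} ≤ ENNReal.ofReal δ

/-- `ε 0, …, ε m` are independent and identically distributed conditionally on `X`: almost surely,
the regular conditional law of `(ε 0, …, ε m)` given `X` is the product of `m + 1` copies of the
conditional law of `ε 0` given `X`. -/
def CondIID {Ω 𝓧 : Type*} [MeasurableSpace Ω] [MeasurableSpace 𝓧] (P : Measure Ω)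
    [IsFiniteMeasure P] (X : Ω → 𝓧) {m : ℕ} (ε : Fin (m + 1) → Ω → ℝ) : Prop :=
  ∀ᵐ x ∂(P.map X),
    condDistrib (fun ω t => ε t ω) X P x = Measure.pi fun _ => condDistrib (ε 0) X P x

/-- `Y` is Gaussian conditionally on `X`. -/
def CondGaussian {Ω 𝓧 : Type*} [MeasurableSpace Ω] [MeasurableSpace 𝓧] (P : Measure Ω)
    [IsFiniteMeasure P] (X : Ω → 𝓧) (Y : Ω → ℝ) : Prop :=
  ∀ᵐ x ∂(P.map X), IsGaussian (condDistrib Y X P x)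

/-- The σ-algebra generated by `X`. -/
abbrev sigmaAlg {Ω 𝓧 : Type*} [MeasurableSpace 𝓧] (X : Ω → 𝓧) : MeasurableSpace Ω :=
  MeasurableSpace.comap X inferInstance

end FeedbackIV

end

open FeedbackIV

/-! Condition on `X̃`. One Gaussian error among i.i.d. ones makes all of them N(0, v), v = σ², and Γ
becomes a fixed matrix. Let u and z be the lagged and current errors, S = X̃'(I-Γ)X̃, W =
S⁻¹X̃'(I-Γ) and N = (I-Γ)M̃_Γ. As X = X̃ + uα' is a rank-one perturbation, the estimation error is
an explicit rational expression in a few scalars (`vecMul_ivWeights_add_vecMulVec`), whose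
denominator is a 2×2 determinant. By Chebyshev, u'Nu is within O(√T) of v tr N, and α'Wu and
u'(I-Γ)X̃S⁻¹α are O(T^(-1/2)), while α'S⁻¹α = O(1/T). Inserting these limits turns the estimation
error into the linear-quadratic form l'z + τ u'Nz, where τ = r'S⁻¹α / (1 + v tr N · α'S⁻¹α) and l' =
r'W - τ v tr N · α'W.

The crux is `abs_limitSlope_le`. There is a vector k with l' = k'X̃'(I-Γ) and τ = k'α, and α = X̃'a
with |a| = O(T^(-1/2)), so coercivity of I-Γ gives |τ| ≤ const · |l|/√T. Every approximation error
can therefore be measured relative to |l|, and the quadratic part has operator norm O(T^(-1/2))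
relative to the standard deviation. The trace condition on Γ centres the form, and its variance is Σ
= v|l|² + τ²v²(tr B² + tr N'N). Diagonalizing the form factors its characteristic function into
one-dimensional Gaussian integrals, whose logarithms add up to -t²/2 + O(T^(-1/2))
(`norm_charFun_linear_add_quadratic_sub_le`).

For the variance, up to a factor 1 - o(1), σ̂² is at least v and the squared length of the estimated
weights is at least |l|² + τ²v tr N'N. Moreover tr B² ≤ ψ tr B'B ≤ ψ tr N'N, because D is a
contraction. Hence V ≥ (1 - o(1))Σ (`le_varianceBound`). Multiplying Σ by deterministic factors that
tend to one slowly enough removes the o(1) and leaves the limit law unchanged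
(`conservative_inference`).

All bounds are non-asymptotic, with constants that depend only on c, C and a bound M for
α'(X̃'X̃/T)⁻¹α. They are thus uniform over the realizations of `X̃` that respect M, and integrating
over `X̃` costs only the probability of the others. -/

section

open scoped NNReal ENNReal

/-! ### Linear and quadratic forms in independent Gaussian variables. -/

section GaussianForms

variable {ι : Type*} [Fintype ι] [DecidableEq ι]

/-- Centred independent Gaussians of equal variance are invariant under rotations. -/
lemma pi_gaussianReal_map_mulVec (v : ℝ≥0) (U : Matrix ι ι ℝ) (hU : U * Uᵀ = 1) :
    (Measure.pi fun _ : ι => gaussianReal 0 v).map (fun x => U *ᵥ x) =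
      Measure.pi fun _ : ι => gaussianReal 0 v := by
  have hinj : (Measure.pi fun _ : ι => gaussianReal 0 v).map
        (fun x => WithLp.toLp 2 (U *ᵥ x)) =
      (Measure.pi fun _ : ι => gaussianReal 0 v).map (WithLp.toLp 2) := by
    apply Measure.ext_of_charFun (E := EuclideanSpace ℝ ι)
    ext t
    have h1 : charFun ((Measure.pi fun _ : ι => gaussianReal 0 v).map
        (fun x => WithLp.toLp 2 (U *ᵥ x))) t =
        charFun ((Measure.pi fun _ : ι => gaussianReal 0 v).map (WithLp.toLp 2))
          (WithLp.toLp 2 (Uᵀ *ᵥ t.ofLp)) := by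
      rw [charFun_apply, charFun_apply, integral_map (by fun_prop) (by fun_prop),
        integral_map (by fun_prop) (by fun_prop)]
      congr 1
      ext x
      congr 3
      simp only [EuclideanSpace.inner_eq_star_dotProduct, star_trivial]
      rw [Matrix.dotProduct_mulVec, Matrix.mulVec_transpose]
    rw [h1, charFun_pi, charFun_pi]
    simp_rw [charFun_gaussianReal, ← Complex.exp_sum]
    congr 1
    have h2 : ∑ i, (Uᵀ *ᵥ t.ofLp) i ^ 2 = ∑ i, t.ofLp i ^ 2 := by
      have : (Uᵀ *ᵥ t.ofLp) ⬝ᵥ (Uᵀ *ᵥ t.ofLp) = t.ofLp ⬝ᵥ t.ofLp := by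
        rw [Matrix.dotProduct_mulVec, Matrix.vecMul_transpose, Matrix.mulVec_mulVec, hU,
          Matrix.one_mulVec]
      simpa [dotProduct, sq] using this
    have h3 : ∀ s : ι → ℝ, ∑ i, ((s i : ℂ) * ((0 : ℝ) : ℂ) * Complex.I
        - ((v : ℝ) : ℂ) * (s i : ℂ) ^ 2 / 2) = ((-(v : ℝ) / 2 * ∑ i, s i ^ 2 : ℝ) : ℂ) := by
      intro s
      push_cast
      rw [Finset.mul_sum]
      refine Finset.sum_congr rfl fun i _ => ?_
      ring
    have h4 := h3 (Uᵀ *ᵥ t.ofLp)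
    have h5 := h3 t.ofLp
    rw [h2] at h4
    exact h4.trans h5.symm
  have := congrArg (Measure.map (WithLp.ofLp (p := 2))) hinj
  rw [Measure.map_map (by fun_prop) (by fun_prop),
    Measure.map_map (by fun_prop) (by fun_prop)] at this
  simpa [Function.comp_def] using this

omit [DecidableEq ι] in
lemma dotProduct_mulVec_transpose_self (Q : Matrix ι ι ℝ) (x : ι → ℝ) :
    x ⬝ᵥ Qᵀ *ᵥ x = x ⬝ᵥ Q *ᵥ x := by
  rw [Matrix.mulVec_transpose, dotProduct_comm, Matrix.dotProduct_mulVec]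

/-- A quadratic form is a weighted sum of squares in rotated coordinates. -/
lemma exists_rotation_quadraticForm (Q : Matrix ι ι ℝ) :
    ∃ (U : Matrix ι ι ℝ) (μ : ι → ℝ), U * Uᵀ = 1 ∧ Uᵀ * U = 1 ∧
      (∀ x, x ⬝ᵥ Q *ᵥ x = ∑ j, μ j * (U *ᵥ x) j ^ 2) ∧
      ∑ j, μ j = Q.trace ∧ ∑ j, μ j ^ 2 = ((Q * Q).trace + (Qᵀ * Q).trace) / 2 := by
  set S : Matrix ι ι ℝ := (1 / 2 : ℝ) • (Q + Qᵀ) with hS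
  have hH : S.IsHermitian := by
    rw [Matrix.IsHermitian, hS]
    ext i j
    simp; ring
  set U : Matrix ι ι ℝ := (hH.eigenvectorUnitary : Matrix ι ι ℝ) with hUdef
  have hUU : U * Uᵀ = 1 := by
    have := (Matrix.mem_unitaryGroup_iff).1 hH.eigenvectorUnitary.2
    simpa [Matrix.star_eq_conjTranspose, Matrix.conjTranspose_eq_transpose_of_trivial] using this
  have hUU' : Uᵀ * U = 1 := by
    have := (Matrix.mem_unitaryGroup_iff').1 hH.eigenvectorUnitary.2
    simpa [Matrix.star_eq_conjTranspose, Matrix.conjTranspose_eq_transpose_of_trivial] using this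
  have hspec : S = U * Matrix.diagonal hH.eigenvalues * Uᵀ := by
    have := hH.spectral_theorem
    rw [Unitary.conjStarAlgAut_apply] at this
    simpa [Matrix.star_eq_conjTranspose, Matrix.conjTranspose_eq_transpose_of_trivial,
      Function.comp_def] using this
  refine ⟨Uᵀ, hH.eigenvalues, by simpa using hUU', by simpa using hUU, fun x => ?_, ?_, ?_⟩
  · have h1 : x ⬝ᵥ Q *ᵥ x = x ⬝ᵥ S *ᵥ x := by
      rw [hS, Matrix.smul_mulVec, Matrix.add_mulVec, dotProduct_smul, dotProduct_add,
        dotProduct_mulVec_transpose_self]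
      simp; ring
    have h2 : S *ᵥ x = (U * Matrix.diagonal hH.eigenvalues * Uᵀ) *ᵥ x :=
      congrArg (fun M : Matrix ι ι ℝ => M *ᵥ x) hspec
    rw [h1, h2, Matrix.mul_assoc, ← Matrix.mulVec_mulVec, Matrix.dotProduct_mulVec,
      ← Matrix.mulVec_transpose, ← Matrix.mulVec_mulVec]
    simp only [dotProduct, Matrix.mulVec_diagonal]
    refine Finset.sum_congr rfl fun j _ => ?_
    ring
  · have := hH.trace_eq_sum_eigenvalues
    simp only [RCLike.ofReal_real_eq_id, id] at this
    rw [← this, hS]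
    simp [Matrix.trace_add, Matrix.trace_smul]; ring
  · have h1 : (S * S).trace = ∑ j, hH.eigenvalues j ^ 2 := by
      have h0 := congrArg (fun M : Matrix ι ι ℝ => (M * M).trace) hspec
      rw [h0, show U * diagonal hH.eigenvalues * Uᵀ * (U * diagonal hH.eigenvalues * Uᵀ) =
        U * (diagonal hH.eigenvalues * ((Uᵀ * U) * diagonal hH.eigenvalues) * Uᵀ) by
          simp only [Matrix.mul_assoc], hUU', Matrix.one_mul, Matrix.trace_mul_comm,
        Matrix.mul_assoc, hUU', Matrix.mul_one, Matrix.diagonal_mul_diagonal, Matrix.trace_diagonal]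
      simp [sq]
    rw [← h1, hS]
    simp only [Matrix.smul_mul, Matrix.mul_smul, Matrix.trace_smul, Matrix.add_mul, Matrix.mul_add,
      Matrix.trace_add, smul_eq_mul]
    have h2 : (Qᵀ * Qᵀ).trace = (Q * Q).trace := by
      rw [← Matrix.transpose_mul, Matrix.trace_transpose]
    have h3 : (Q * Qᵀ).trace = (Qᵀ * Q).trace := Matrix.trace_mul_comm _ _
    rw [h2, h3]; ring


lemma integrable_pow_gaussianReal (v : ℝ≥0) (k : ℕ) :
    Integrable (fun x : ℝ => x ^ k) (gaussianReal 0 v) := by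
  have h := (memLp_id_gaussianReal (μ := 0) (v := v) k).integrable_norm_pow'
  refine (integrable_norm_iff (by fun_prop)).1 ?_
  simpa using h

lemma integral_sq_gaussianReal (v : ℝ≥0) : ∫ x, x ^ 2 ∂gaussianReal 0 v = v := by
  have h := variance_fun_id_gaussianReal (μ := 0) (v := v)
  rw [variance_eq_integral (by fun_prop), integral_id_gaussianReal] at h
  simpa using h

lemma pow_four_le_exp_add_exp (y : ℝ) : y ^ 4 ≤ 24 * (Real.exp y + Real.exp (-y)) := by
  have key : ∀ z : ℝ, 0 ≤ z → z ^ 4 ≤ 24 * Real.exp z := by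
    intro z hz
    have := Real.pow_div_factorial_le_exp z hz 4
    norm_num [Nat.factorial] at this
    linarith
  rcases le_total 0 y with h | h
  · have := key y h
    have := Real.exp_pos (-y)
    linarith
  · have h2 := key (-y) (by linarith)
    have := Real.exp_pos y
    have : (-y) ^ 4 = y ^ 4 := by ring
    linarith

/-- The exponential bound at scale 1/√v reduces the moment to the moment generating function, whose
value there is e^(1/2) ≤ 2. Only the order v² matters later, not the sharp constant. -/
lemma integral_pow_four_gaussianReal_le (v : ℝ≥0) (hv : v ≠ 0) :
    ∫ x, x ^ 4 ∂gaussianReal 0 v ≤ 96 * (v : ℝ) ^ 2 := by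
  have hvpos : (0 : ℝ) < v := by positivity
  set s : ℝ := (√(v : ℝ))⁻¹ with hs
  have hs2 : (v : ℝ) * s ^ 2 = 1 := by
    rw [hs, inv_pow, Real.sq_sqrt hvpos.le]; field_simp
  have hs4 : (v : ℝ) ^ 2 * s ^ 4 = 1 := by
    calc (v : ℝ) ^ 2 * s ^ 4 = ((v : ℝ) * s ^ 2) ^ 2 := by ring
      _ = 1 := by rw [hs2]; norm_num
  have hpt : ∀ x : ℝ, x ^ 4 ≤ (v : ℝ) ^ 2 * (24 * (Real.exp (s * x) + Real.exp (-s * x))) := by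
    intro x
    have h := pow_four_le_exp_add_exp (s * x)
    calc x ^ 4 = (v : ℝ) ^ 2 * (s * x) ^ 4 := by
            rw [mul_pow, ← mul_assoc, hs4, one_mul]
      _ ≤ _ := by
            rw [neg_mul]
            gcongr
  have hmgf : ∀ t : ℝ, ∫ x, Real.exp (t * x) ∂gaussianReal 0 v = Real.exp (v * t ^ 2 / 2) := by
    intro t
    have := congrFun (mgf_id_gaussianReal (μ := 0) (v := v)) t
    simpa [mgf] using this
  have hi : ∀ t : ℝ, Integrable (fun x => Real.exp (t * x)) (gaussianReal 0 v) :=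
    fun t => integrable_exp_mul_gaussianReal t
  calc ∫ x, x ^ 4 ∂gaussianReal 0 v
      ≤ ∫ x, (v : ℝ) ^ 2 * (24 * (Real.exp (s * x) + Real.exp (-s * x))) ∂gaussianReal 0 v :=
        integral_mono (integrable_pow_gaussianReal v 4)
          ((((hi s).add (hi (-s))).const_mul 24).const_mul _) hpt
    _ = (v : ℝ) ^ 2 * (24 * (Real.exp (1 / 2) + Real.exp (1 / 2))) := by
        rw [integral_const_mul, integral_const_mul, integral_add (hi s) (hi (-s)), hmgf, hmgf]
        rw [neg_sq, hs2]
    _ ≤ (v : ℝ) ^ 2 * (24 * (2 + 2)) := by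
        have : Real.exp (1 / 2) ≤ 2 := by
          have h1 : Real.exp (1 / 2) ^ 2 = Real.exp 1 := by
            rw [← Real.exp_nat_mul]; norm_num
          have h2 := Real.exp_one_lt_d9
          nlinarith [Real.exp_pos (1 / 2 : ℝ)]
        gcongr
    _ = _ := by ring

omit [DecidableEq ι] in
lemma pi_gaussianReal_linear_moments (v : ℝ≥0) (a : ι → ℝ) :
    MemLp (fun x : ι → ℝ => a ⬝ᵥ x) 2 (Measure.pi fun _ : ι => gaussianReal 0 v) ∧
    ∫ x, a ⬝ᵥ x ∂(Measure.pi fun _ : ι => gaussianReal 0 v) = 0 ∧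
    Var[fun x => a ⬝ᵥ x; Measure.pi fun _ : ι => gaussianReal 0 v] = v * (a ⬝ᵥ a) := by
  have hmem : ∀ i, MemLp (fun y : ℝ => a i * y) 2 (gaussianReal 0 v) := fun i =>
    (memLp_id_gaussianReal' 2 (by simp)).const_mul _
  have hmem' : ∀ i, MemLp (fun x : ι → ℝ => a i * x i) 2
      (Measure.pi fun _ : ι => gaussianReal 0 v) := fun i =>
    (hmem i).comp_measurePreserving (measurePreserving_eval _ i)
  have heq : (fun x : ι → ℝ => a ⬝ᵥ x) = ∑ i, fun x : ι → ℝ => a i * x i := by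
    ext x; simp [dotProduct]
  refine ⟨?_, ?_, ?_⟩
  · rw [heq]; exact memLp_finsetSum' _ fun i _ => hmem' i
  · simp only [dotProduct]
    rw [integral_finsetSum _ fun i _ => (hmem' i).integrable (by norm_num)]
    refine Finset.sum_eq_zero fun i _ => ?_
    rw [integral_comp_eval (μ := fun _ : ι => gaussianReal 0 v) (i := i)
      (f := fun y => a i * y) (by fun_prop), integral_const_mul, integral_id_gaussianReal, mul_zero]
  · rw [heq, variance_sum_pi (X := fun i y => a i * y) hmem]
    rw [dotProduct, Finset.mul_sum]
    refine Finset.sum_congr rfl fun i _ => ?_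
    rw [variance_const_mul (a i) (fun y => y), variance_fun_id_gaussianReal]
    ring

omit [DecidableEq ι] in
lemma pi_gaussianReal_weighted_sq_moments (v : ℝ≥0) (hv : v ≠ 0) (μ : ι → ℝ) :
    MemLp (fun x : ι → ℝ => ∑ j, μ j * x j ^ 2) 2 (Measure.pi fun _ : ι => gaussianReal 0 v) ∧
    ∫ x, ∑ j, μ j * x j ^ 2 ∂(Measure.pi fun _ : ι => gaussianReal 0 v) = v * ∑ j, μ j ∧
    Var[fun x => ∑ j, μ j * x j ^ 2; Measure.pi fun _ : ι => gaussianReal 0 v] ≤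
      96 * v ^ 2 * ∑ j, μ j ^ 2 := by
  have hsq : MemLp (fun y : ℝ => y ^ 2) 2 (gaussianReal 0 v) := by
    rw [memLp_two_iff_integrable_sq (by fun_prop)]
    simpa [← pow_mul] using integrable_pow_gaussianReal v 4
  have hmem : ∀ i, MemLp (fun y : ℝ => μ i * y ^ 2) 2 (gaussianReal 0 v) := fun i =>
    hsq.const_mul _
  have hmem' : ∀ i, MemLp (fun x : ι → ℝ => μ i * x i ^ 2) 2
      (Measure.pi fun _ : ι => gaussianReal 0 v) := fun i =>
    (hmem i).comp_measurePreserving (measurePreserving_eval _ i)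
  have heq : (fun x : ι → ℝ => ∑ j, μ j * x j ^ 2) = ∑ i, fun x : ι → ℝ => μ i * x i ^ 2 := by
    ext x; simp
  refine ⟨?_, ?_, ?_⟩
  · rw [heq]; exact memLp_finsetSum' _ fun i _ => hmem' i
  · rw [integral_finsetSum _ fun i _ => (hmem' i).integrable (by norm_num), Finset.mul_sum]
    refine Finset.sum_congr rfl fun i _ => ?_
    rw [integral_comp_eval (μ := fun _ : ι => gaussianReal 0 v) (i := i)
      (f := fun y => μ i * y ^ 2) (by fun_prop), integral_const_mul, integral_sq_gaussianReal,
      mul_comm]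
  · rw [heq, variance_sum_pi (X := fun i y => μ i * y ^ 2) hmem, Finset.mul_sum]
    refine Finset.sum_le_sum fun i _ => ?_
    rw [variance_const_mul]
    have h1 : Var[fun y : ℝ => y ^ 2; gaussianReal 0 v] ≤ 96 * (v : ℝ) ^ 2 := by
      refine (variance_le_expectation_sq (by fun_prop)).trans ?_
      refine le_trans (le_of_eq ?_) (integral_pow_four_gaussianReal_le v hv)
      congr 1; ext y; simp only [Pi.pow_apply]; ring
    nlinarith [sq_nonneg (μ i)]

omit [DecidableEq ι] in
-- Expand the squared Frobenius norm of Q - Q', which is nonnegative.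
lemma trace_mul_self_le_trace_transpose_mul (Q : Matrix ι ι ℝ) :
    (Q * Q).trace ≤ (Qᵀ * Q).trace := by
  have h : 0 ≤ ((Q - Qᵀ)ᵀ * (Q - Qᵀ)).trace := by
    simp only [Matrix.trace, Matrix.diag, Matrix.mul_apply, Matrix.transpose_apply]
    exact Finset.sum_nonneg fun i _ => Finset.sum_nonneg fun j _ => mul_self_nonneg _
  rw [Matrix.transpose_sub, Matrix.transpose_transpose, Matrix.sub_mul, Matrix.mul_sub,
    Matrix.mul_sub, Matrix.trace_sub, Matrix.trace_sub, Matrix.trace_sub] at h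
  have h2 : (Qᵀ * Qᵀ).trace = (Q * Q).trace := by
    rw [← Matrix.transpose_mul, Matrix.trace_transpose]
  have h3 : (Q * Qᵀ).trace = (Qᵀ * Q).trace := Matrix.trace_mul_comm _ _
  linarith

/-- Rotation invariance turns the form into a weighted sum of independent squares, whose weights are
the eigenvalues of the symmetric part of Q. -/
lemma pi_gaussianReal_quadratic_moments (v : ℝ≥0) (hv : v ≠ 0) (Q : Matrix ι ι ℝ) :
    MemLp (fun x : ι → ℝ => x ⬝ᵥ Q *ᵥ x) 2 (Measure.pi fun _ : ι => gaussianReal 0 v) ∧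
    ∫ x, x ⬝ᵥ Q *ᵥ x ∂(Measure.pi fun _ : ι => gaussianReal 0 v) = v * Q.trace ∧
    Var[fun x => x ⬝ᵥ Q *ᵥ x; Measure.pi fun _ : ι => gaussianReal 0 v] ≤
      96 * v ^ 2 * (Qᵀ * Q).trace := by
  obtain ⟨U, μ, hU, hU', hq, htr, hsq⟩ := exists_rotation_quadraticForm Q
  have hmp : MeasurePreserving (fun x : ι → ℝ => U *ᵥ x)
      (Measure.pi fun _ : ι => gaussianReal 0 v) (Measure.pi fun _ : ι => gaussianReal 0 v) :=
    ⟨by fun_prop, pi_gaussianReal_map_mulVec v U hU⟩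
  obtain ⟨h1, h2, h3⟩ := pi_gaussianReal_weighted_sq_moments v hv μ
  have hm : Measurable fun x : ι → ℝ => ∑ j, μ j * x j ^ 2 :=
    Finset.measurable_sum _ fun j _ => by fun_prop
  have heq : (fun x : ι → ℝ => x ⬝ᵥ Q *ᵥ x) =
      (fun x : ι → ℝ => ∑ j, μ j * x j ^ 2) ∘ fun x => U *ᵥ x := by
    ext x; simp [hq]
  refine ⟨?_, ?_, ?_⟩
  · rw [heq]; exact h1.comp_measurePreserving hmp
  · rw [← htr, ← h2, heq]
    conv_rhs => rw [← hmp.map_eq]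
    rw [integral_map hmp.measurable.aemeasurable hm.aestronglyMeasurable]
    rfl
  · rw [heq, ← variance_map hm.aemeasurable hmp.measurable.aemeasurable, hmp.map_eq]
    refine h3.trans ?_
    rw [hsq]
    have := trace_mul_self_le_trace_transpose_mul Q
    gcongr
    linarith

lemma measure_lt_abs_sub_integral_le {Ω : Type*} [MeasurableSpace Ω] (ν : Measure Ω)
    [IsProbabilityMeasure ν] (f : Ω → ℝ) (hf : MemLp f 2 ν) (κ R : ℝ) (hκ : 0 < κ) (hR : 0 < R)
    (hvar : Var[f; ν] ≤ κ ^ 2) :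
    ν {x | R * κ < |f x - ∫ y, f y ∂ν|} ≤ ENNReal.ofReal (1 / R ^ 2) := by
  calc ν {x | R * κ < |f x - ∫ y, f y ∂ν|} ≤ ν {x | R * κ ≤ |f x - ∫ y, f y ∂ν|} :=
        measure_mono fun x hx => le_of_lt (Set.mem_ofPred_eq ▸ hx)
    _ ≤ ENNReal.ofReal (Var[f; ν] / (R * κ) ^ 2) :=
        meas_ge_le_variance_div_sq hf (mul_pos hR hκ)
    _ ≤ _ := by
        apply ENNReal.ofReal_le_ofReal
        rw [mul_pow, div_le_div_iff₀ (by positivity) (by positivity)]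
        nlinarith [sq_nonneg R]

omit [DecidableEq ι] in
/-- Chebyshev's inequality for linear forms in Gaussian vectors. -/
lemma pi_gaussianReal_linear_tail (v : ℝ≥0) (a : ι → ℝ) (κ R : ℝ) (hκ : 0 < κ) (hR : 0 < R)
    (h : v * (a ⬝ᵥ a) ≤ κ ^ 2) :
    (Measure.pi fun _ : ι => gaussianReal 0 v) {x | R * κ < |a ⬝ᵥ x|} ≤
      ENNReal.ofReal (1 / R ^ 2) := by
  obtain ⟨h1, h2, h3⟩ := pi_gaussianReal_linear_moments v a
  have := measure_lt_abs_sub_integral_le _ _ h1 κ R hκ hR (h3.trans_le h)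
  simpa [h2] using this

/-- Chebyshev's inequality for quadratic forms in Gaussian vectors. -/
lemma pi_gaussianReal_quadratic_tail (v : ℝ≥0) (hv : v ≠ 0) (Q : Matrix ι ι ℝ) (κ R : ℝ)
    (hκ : 0 < κ) (hR : 0 < R) (h : 96 * v ^ 2 * (Qᵀ * Q).trace ≤ κ ^ 2) :
    (Measure.pi fun _ : ι => gaussianReal 0 v) {x | R * κ < |x ⬝ᵥ Q *ᵥ x - v * Q.trace|} ≤
      ENNReal.ofReal (1 / R ^ 2) := by
  obtain ⟨h1, h2, h3⟩ := pi_gaussianReal_quadratic_moments v hv Q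
  have := measure_lt_abs_sub_integral_le _ _ h1 κ R hκ hR (h3.trans h)
  simpa [h2] using this

/-- A complex Gaussian integral. Since 1 - w has real part 1, it stays off the branch cut, so the
square root can be written with the principal logarithm. -/
lemma integral_cexp_quadratic_gaussianReal (v : ℝ≥0) (hv : v ≠ 0) (t l μ : ℝ) (w : ℂ)
    (hw : w = 2 * t * μ * v * Complex.I) :
    ∫ x : ℝ, Complex.exp (t * (l * x + μ * x ^ 2) * Complex.I) ∂gaussianReal 0 v =
      Complex.exp (-(Complex.log (1 - w)) / 2 - t ^ 2 * l ^ 2 * v / 2 * (1 - w)⁻¹) := by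
  have hvpos : (0 : ℝ) < v := by positivity
  have hvc : ((v : ℝ) : ℂ) ≠ 0 := by exact_mod_cast hvpos.ne'
  have hwre : w.re = 0 := by rw [hw]; simp
  have h1w : (1 - w).re = 1 := by simp [hwre]
  have h1w0 : 1 - w ≠ 0 := by
    intro h; rw [h] at h1w; simp at h1w
  set b : ℂ := -(1 - w) / (2 * v) with hb
  have hbre : b.re < 0 := by
    have : b = ((-1 / (2 * v) : ℝ) : ℂ) * (1 - w) := by rw [hb]; push_cast; ring
    rw [this, Complex.re_ofReal_mul, h1w, mul_one]
    apply div_neg_of_neg_of_pos <;> [norm_num; positivity]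
  rw [integral_gaussianReal_eq_integral_smul hv]
  have hint : ∀ x : ℝ, gaussianPDFReal 0 v x •
      Complex.exp (t * (l * x + μ * x ^ 2) * Complex.I) =
      ((√(2 * Real.pi * v))⁻¹ : ℝ) * Complex.exp (b * x ^ 2 + (t * l * Complex.I) * x + 0) := by
    intro x
    rw [gaussianPDFReal, Complex.real_smul]
    push_cast
    rw [mul_assoc, ← Complex.exp_add]
    congr 2
    rw [hb, hw]
    field_simp
    ring
  simp_rw [hint]
  rw [integral_const_mul, integral_cexp_quadratic hbre]
  have hpos : (0 : ℝ) < 2 * Real.pi * v := by positivity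
  have hdiv : (Real.pi : ℂ) / -b = ((2 * Real.pi * v : ℝ) : ℂ) * (1 - w)⁻¹ := by
    rw [hb]; push_cast; field_simp
  have harg : (1 - w).arg ≠ Real.pi := by
    intro h
    have := (Complex.arg_eq_pi_iff).1 h
    linarith [this.1]
  have hne : ((2 * Real.pi * v : ℝ) : ℂ) * (1 - w)⁻¹ ≠ 0 :=
    mul_ne_zero (by exact_mod_cast hpos.ne') (inv_ne_zero h1w0)
  rw [hdiv, Complex.cpow_def_of_ne_zero hne, Complex.log_ofReal_mul hpos (inv_ne_zero h1w0),
    Complex.log_inv _ harg, add_mul, Complex.exp_add]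
  have hsqrt : Complex.exp ((Real.log (2 * Real.pi * v) : ℂ) * (1 / 2)) =
      ((√(2 * Real.pi * v) : ℝ) : ℂ) := by
    rw [Real.sqrt_eq_rpow, Real.rpow_def_of_pos hpos]
    push_cast; rfl
  have hne0 : ((√(2 * Real.pi * v) : ℝ) : ℂ) ≠ 0 := by exact_mod_cast (Real.sqrt_pos.2 hpos).ne'
  rw [hsqrt, Complex.ofReal_inv]
  generalize ((√(2 * Real.pi * v) : ℝ) : ℂ) = q at hne0 ⊢
  rw [mul_assoc q, inv_mul_cancel_left₀ hne0, ← Complex.exp_add]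
  congr 1
  rw [hb]
  field_simp
  rw [Complex.I_sq]
  ring

/-- Taylor's formula for the logarithm to second order, together with (1-w)⁻¹ = 1 + w(1-w)⁻¹. The
right side keeps a factor ‖w‖ outside, so that a sum over coordinates is at most the largest ‖w‖
times the total variance. -/
lemma norm_neg_log_one_sub_sub_le {w : ℂ} (hw : ‖w‖ ≤ 1 / 2) (s : ℝ) (hs : 0 ≤ s) :
    ‖-(Complex.log (1 - w)) / 2 - s / 2 * (1 - w)⁻¹ - (w / 2 + w ^ 2 / 4 - s / 2)‖ ≤
      ‖w‖ * (‖w‖ ^ 2 / 2 + s) := by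
  have h1 := Complex.norm_log_sub_logTaylor_le 2 (z := -w) (by rw [norm_neg]; linarith)
  have h2 : Complex.logTaylor 3 (-w) = -w - w ^ 2 / 2 := by
    simp [Complex.logTaylor_succ, Complex.logTaylor_zero]; ring
  rw [h2, ← sub_eq_add_neg, norm_neg] at h1
  have hinv : (1 - ‖w‖)⁻¹ ≤ 2 := by
    rw [inv_le_comm₀ (by linarith) (by norm_num)]; linarith
  have h1w : (1 : ℝ) / 2 ≤ ‖1 - w‖ := by
    have := norm_sub_norm_le (1 : ℂ) w
    rw [norm_one] at this; linarith
  have h1w0 : 1 - w ≠ 0 := by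
    intro h; rw [h] at h1w; norm_num at h1w
  have hexp : -(Complex.log (1 - w)) / 2 - s / 2 * (1 - w)⁻¹ - (w / 2 + w ^ 2 / 4 - s / 2) =
      -(1 / 2) * (Complex.log (1 - w) - (-w - w ^ 2 / 2)) - s / 2 * (w * (1 - w)⁻¹) := by
    field_simp; ring
  rw [hexp]
  refine (norm_sub_le _ _).trans ?_
  have h3 : ‖-(1 / 2) * (Complex.log (1 - w) - (-w - w ^ 2 / 2))‖ ≤ ‖w‖ ^ 3 / 2 := by
    rw [norm_mul]
    have : ‖(-(1 / 2) : ℂ)‖ = 1 / 2 := by norm_num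
    rw [this]
    have h4 : ‖w‖ ^ (2 + 1) * (1 - ‖w‖)⁻¹ / ((2 : ℕ) + 1) ≤ ‖w‖ ^ 3 * 2 / 2 := by
      norm_num
      have : ‖w‖ ^ 3 * (1 - ‖w‖)⁻¹ ≤ ‖w‖ ^ 3 * 2 := by gcongr
      have : 0 ≤ ‖w‖ ^ 3 := by positivity
      linarith
    linarith
  have h5 : ‖(s / 2 : ℂ) * (w * (1 - w)⁻¹)‖ ≤ s * ‖w‖ := by
    rw [norm_mul, norm_mul, norm_inv]
    have h6 : ‖(s / 2 : ℂ)‖ = s / 2 := by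
      rw [show (s / 2 : ℂ) = ((s / 2 : ℝ) : ℂ) by push_cast; rfl, Complex.norm_real,
        Real.norm_of_nonneg (by linarith)]
    rw [h6]
    have h7 : ‖1 - w‖⁻¹ ≤ 2 := by
      rw [inv_le_comm₀ (by linarith) (by norm_num)]; linarith
    calc s / 2 * (‖w‖ * ‖1 - w‖⁻¹) ≤ s / 2 * (‖w‖ * 2) := by gcongr
      _ = s * ‖w‖ := by ring
  nlinarith

/-- The characteristic function of a standardized linear-quadratic form in Gaussian variables is
close to that of a standard Gaussian if the quadratic form is small in operator norm. -/
lemma norm_charFun_linear_add_quadratic_sub_le (v : ℝ≥0) (hv : v ≠ 0) (a : ι → ℝ)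
    (Q : Matrix ι ι ℝ) (htr : Q.trace = 0) (θ t : ℝ)
    (hθ : ∀ x, |x ⬝ᵥ Q *ᵥ x| ≤ θ * (x ⬝ᵥ x))
    (hnorm : v * (a ⬝ᵥ a) + v ^ 2 * ((Q * Q).trace + (Qᵀ * Q).trace) = 1)
    (hsmall₁ : 2 * |t| * θ * v ≤ 1 / 2) (hsmall₂ : 2 * |t| ^ 3 * θ * v ≤ 1) :
    ‖(∫ x, Complex.exp (t * (a ⬝ᵥ x + x ⬝ᵥ Q *ᵥ x : ℝ) * Complex.I)
        ∂(Measure.pi fun _ : ι => gaussianReal 0 v)) - Complex.exp (-t ^ 2 / 2)‖ ≤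
      4 * |t| ^ 3 * θ * v := by
  obtain ⟨U, μ, hU, hU', hq, htr', hsq⟩ := exists_rotation_quadraticForm Q
  rw [htr] at htr'
  -- At the unit vector that the rotation sends to the j-th basis vector, the form equals its j-th
  -- eigenvalue.
  have hμ : ∀ j, |μ j| ≤ θ := by
    intro j
    have h1 : U *ᵥ (Uᵀ *ᵥ Pi.single j 1) = Pi.single j (1 : ℝ) := by
      rw [Matrix.mulVec_mulVec, hU, Matrix.one_mulVec]
    have h2 := hθ (Uᵀ *ᵥ Pi.single j 1)
    have h3 : (Uᵀ *ᵥ Pi.single j 1) ⬝ᵥ (Uᵀ *ᵥ Pi.single j (1 : ℝ)) = 1 := by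
      rw [Matrix.dotProduct_mulVec, Matrix.vecMul_transpose, h1]; simp
    rw [hq, h1, h3] at h2
    simpa [Pi.single_apply] using h2
  set l : ι → ℝ := U *ᵥ a with hl
  have hmp : (Measure.pi fun _ : ι => gaussianReal 0 v).map (fun x => U *ᵥ x) =
      Measure.pi fun _ : ι => gaussianReal 0 v := pi_gaussianReal_map_mulVec v U hU
  have hla : l ⬝ᵥ l = a ⬝ᵥ a := by
    rw [hl, Matrix.dotProduct_mulVec, Matrix.vecMul_mulVec, hU', Matrix.vecMul_one]
  have hlin : ∀ x, a ⬝ᵥ x = l ⬝ᵥ U *ᵥ x := by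
    intro x
    rw [hl, Matrix.dotProduct_mulVec, Matrix.vecMul_mulVec, hU', Matrix.vecMul_one]
  set w : ι → ℂ := fun j => 2 * t * μ j * v * Complex.I with hw
  have hint : ∫ x, Complex.exp (t * (a ⬝ᵥ x + x ⬝ᵥ Q *ᵥ x : ℝ) * Complex.I)
        ∂(Measure.pi fun _ : ι => gaussianReal 0 v) =
      ∏ j, Complex.exp (-(Complex.log (1 - w j)) / 2 -
        t ^ 2 * l j ^ 2 * v / 2 * (1 - w j)⁻¹) := by
    have h1 : ∀ x : ι → ℝ, Complex.exp (t * (a ⬝ᵥ x + x ⬝ᵥ Q *ᵥ x : ℝ) * Complex.I) =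
        (fun z : ι → ℝ => ∏ j, Complex.exp (t * (l j * z j + μ j * z j ^ 2) * Complex.I))
          (U *ᵥ x) := by
      intro x
      simp only
      rw [← Complex.exp_sum, hlin, hq, dotProduct, ← Finset.sum_add_distrib]
      push_cast
      rw [Finset.mul_sum, Finset.sum_mul]
    simp_rw [h1]
    have hmeas : Measurable fun z : ι → ℝ =>
        ∏ j, Complex.exp (t * (l j * z j + μ j * z j ^ 2) * Complex.I) :=
      Finset.measurable_prod _ fun j _ => by fun_prop
    rw [← integral_map (μ := Measure.pi fun _ : ι => gaussianReal 0 v)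
      (φ := fun x => U *ᵥ x) (by fun_prop) hmeas.aestronglyMeasurable, hmp,
      integral_fintype_prod_eq_prod
        (f := fun j (z : ℝ) => Complex.exp (t * (l j * z + μ j * z ^ 2) * Complex.I))]
    exact Finset.prod_congr rfl fun j _ => integral_cexp_quadratic_gaussianReal v hv t (l j) (μ j)
      (w j) rfl
  have hwn : ∀ j, ‖w j‖ = 2 * |t| * |μ j| * v := by
    intro j; simp [hw]
  have hwle : ∀ j, ‖w j‖ ≤ 2 * |t| * θ * v := by
    intro j
    rw [hwn]
    have := hμ j
    gcongr
  rw [hint, ← Complex.exp_sum]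
  set e : ι → ℂ := fun j => -(Complex.log (1 - w j)) / 2 -
        t ^ 2 * l j ^ 2 * v / 2 * (1 - w j)⁻¹ with he
  -- The first-order terms cancel because the trace is zero, and the second-order terms combine to
  -- -t²/2 by the normalization of the variance.
  have hmain : ∑ j, (w j / 2 + w j ^ 2 / 4 - ((t ^ 2 * l j ^ 2 * v : ℝ) : ℂ) / 2) = -(t : ℂ) ^ 2 / 2 := by
    have h1 : ∑ j, w j = 0 := by
      simp only [hw]
      rw [← Finset.sum_mul, ← Finset.sum_mul, ← Finset.mul_sum, ← Complex.ofReal_sum, htr']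
      simp
    have h2 : ∑ j, w j ^ 2 = ((-4 * t ^ 2 * v ^ 2 * ∑ j, μ j ^ 2 : ℝ) : ℂ) := by
      push_cast
      rw [Finset.mul_sum]
      refine Finset.sum_congr rfl fun j _ => ?_
      simp only [hw, mul_pow, Complex.I_sq]; ring
    have h3 : ∑ j, ((t ^ 2 * l j ^ 2 * v : ℝ) : ℂ) = ((t ^ 2 * v * (a ⬝ᵥ a) : ℝ) : ℂ) := by
      rw [← hla, ← Complex.ofReal_sum, dotProduct, Finset.mul_sum]
      congr 1
      refine Finset.sum_congr rfl fun j _ => by ring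
    rw [Finset.sum_sub_distrib, Finset.sum_add_distrib, ← Finset.sum_div, ← Finset.sum_div,
      ← Finset.sum_div, h1, h2, h3]
    have h5 : (-4 * t ^ 2 * v ^ 2 * ∑ j, μ j ^ 2) / 4 - (t ^ 2 * v * (a ⬝ᵥ a)) / 2 =
        -t ^ 2 / 2 := by
      rw [hsq]; linear_combination (-t ^ 2 / 2) * hnorm
    have h6 := congrArg (fun r : ℝ => (r : ℂ)) h5
    push_cast at h6 ⊢
    rw [zero_div, zero_add, h6]
  -- Each remainder is at most the uniform bound on ‖w j‖ times t² times the contribution of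
  -- coordinate j to the variance, and these contributions add up to one.
  have herr : ‖∑ j, e j - (-(t : ℂ) ^ 2 / 2)‖ ≤ 2 * |t| ^ 3 * θ * v := by
    rw [← hmain, ← Finset.sum_sub_distrib]
    have hj : ∀ j, ‖e j - (w j / 2 + w j ^ 2 / 4 - ((t ^ 2 * l j ^ 2 * v : ℝ) : ℂ) / 2)‖ ≤
        2 * |t| * θ * v * (2 * t ^ 2 * v ^ 2 * μ j ^ 2 + t ^ 2 * v * l j ^ 2) := by
      intro j
      have h1 := norm_neg_log_one_sub_sub_le ((hwle j).trans hsmall₁) (t ^ 2 * l j ^ 2 * v)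
        (by positivity)
      have h2 : e j = -(Complex.log (1 - w j)) / 2 -
        ((t ^ 2 * l j ^ 2 * v : ℝ) : ℂ) / 2 * (1 - w j)⁻¹ := by
        simp only [he]; push_cast; rfl
      rw [h2]
      refine h1.trans ?_
      have h3 : ‖w j‖ ^ 2 / 2 + t ^ 2 * l j ^ 2 * v =
          2 * t ^ 2 * v ^ 2 * μ j ^ 2 + t ^ 2 * v * l j ^ 2 := by
        rw [hwn, mul_pow, mul_pow, mul_pow, sq_abs, sq_abs]; ring
      rw [h3]
      exact mul_le_mul_of_nonneg_right (hwle j) (by positivity)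
    refine (norm_sum_le _ _).trans ((Finset.sum_le_sum fun j _ => hj j).trans (le_of_eq ?_))
    rw [← Finset.mul_sum, Finset.sum_add_distrib, ← Finset.mul_sum, ← Finset.mul_sum, hsq]
    have h7 : ∑ j, l j ^ 2 = a ⬝ᵥ a := by
      rw [← hla, dotProduct]; exact Finset.sum_congr rfl fun j _ => by ring
    rw [h7]
    have h8 : |t| ^ 3 = |t| * t ^ 2 := by rw [← sq_abs]; ring
    rw [h8]
    linear_combination (2 * |t| * θ * v * t ^ 2) * hnorm
  have hfac : Complex.exp (∑ j, e j) - Complex.exp (-(t : ℂ) ^ 2 / 2) =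
      Complex.exp (-(t : ℂ) ^ 2 / 2) * (Complex.exp (∑ j, e j - (-(t : ℂ) ^ 2 / 2)) - 1) := by
    rw [mul_sub, ← Complex.exp_add, mul_one]; congr 2; ring
  have hle1 : ‖Complex.exp (-(t : ℂ) ^ 2 / 2)‖ ≤ 1 := by
    rw [show (-(t : ℂ) ^ 2 / 2) = ((-t ^ 2 / 2 : ℝ) : ℂ) by push_cast; rfl,
      Complex.norm_exp_ofReal]
    rw [Real.exp_le_one_iff]
    nlinarith [sq_nonneg t]
  rw [hfac, norm_mul]
  have h2 := Complex.norm_exp_sub_one_le (herr.trans hsmall₂)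
  have h3 := mul_le_mul hle1 h2 (norm_nonneg _) zero_le_one
  linarith

end GaussianForms

/-! ### Euclidean norm, operator norm and trace bounds. -/

section EuclideanNorm

variable {T : ℕ}

lemma euclNorm_nonneg (x : Fin T → ℝ) : 0 ≤ euclNorm x := norm_nonneg _

lemma euclNorm_sq (x : Fin T → ℝ) : euclNorm x ^ 2 = x ⬝ᵥ x := by
  rw [euclNorm, ← real_inner_self_eq_norm_sq, EuclideanSpace.inner_eq_star_dotProduct]
  simp

lemma abs_dotProduct_le_euclNorm_mul (x y : Fin T → ℝ) :
    |x ⬝ᵥ y| ≤ euclNorm x * euclNorm y := by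
  have h := abs_real_inner_le_norm (WithLp.toLp 2 x) (WithLp.toLp 2 y)
  rw [EuclideanSpace.inner_eq_star_dotProduct] at h
  simpa [euclNorm, dotProduct_comm] using h

lemma euclNorm_add_le (x y : Fin T → ℝ) : euclNorm (x + y) ≤ euclNorm x + euclNorm y := by
  rw [euclNorm, WithLp.toLp_add]; exact norm_add_le _ _

lemma euclNorm_sub_le (x y : Fin T → ℝ) : euclNorm (x - y) ≤ euclNorm x + euclNorm y := by
  rw [euclNorm, WithLp.toLp_sub]; exact norm_sub_le _ _

lemma euclNorm_smul (a : ℝ) (x : Fin T → ℝ) : euclNorm (a • x) = |a| * euclNorm x := by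
  rw [euclNorm, WithLp.toLp_smul, norm_smul, Real.norm_eq_abs]; rfl

lemma euclNorm_eq_zero {x : Fin T → ℝ} : euclNorm x = 0 ↔ x = 0 := by
  rw [euclNorm, norm_eq_zero, WithLp.toLp_eq_zero]

lemma opNorm_nonneg (A : Matrix (Fin T) (Fin T) ℝ) : 0 ≤ opNorm A := norm_nonneg _

lemma euclNorm_mulVec_le (A : Matrix (Fin T) (Fin T) ℝ) (x : Fin T → ℝ) :
    euclNorm (A *ᵥ x) ≤ opNorm A * euclNorm x := by
  have h := (Matrix.toEuclideanCLM (𝕜 := ℝ) A).le_opNorm (WithLp.toLp 2 x)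
  rwa [Matrix.toEuclideanCLM_toLp] at h

lemma opNorm_le_of_forall {A : Matrix (Fin T) (Fin T) ℝ} {k : ℝ} (hk : 0 ≤ k)
    (h : ∀ x, euclNorm (A *ᵥ x) ≤ k * euclNorm x) : opNorm A ≤ k := by
  refine ContinuousLinearMap.opNorm_le_bound _ hk fun x => ?_
  have := h x.ofLp
  rw [euclNorm, ← Matrix.toEuclideanCLM_toLp] at this
  simpa [euclNorm] using this

lemma opNorm_transpose (A : Matrix (Fin T) (Fin T) ℝ) : opNorm Aᵀ = opNorm A := by
  have h : Aᵀ = star A := by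
    rw [Matrix.star_eq_conjTranspose, Matrix.conjTranspose_eq_transpose_of_trivial]
  rw [opNorm, h, map_star, opNorm, ContinuousLinearMap.star_eq_adjoint]
  exact (ContinuousLinearMap.adjoint (𝕜 := ℝ)).norm_map _

lemma opNorm_mul_le (A B : Matrix (Fin T) (Fin T) ℝ) : opNorm (A * B) ≤ opNorm A * opNorm B := by
  rw [opNorm, map_mul]; exact norm_mul_le _ _

lemma trace_transpose_mul_self_eq (A : Matrix (Fin T) (Fin T) ℝ) :
    (Aᵀ * A).trace = ∑ i, euclNorm (A *ᵥ Pi.single i 1) ^ 2 := by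
  simp only [Matrix.trace, Matrix.diag, euclNorm_sq]
  refine Finset.sum_congr rfl fun i _ => ?_
  simp [Matrix.mul_apply, dotProduct]

lemma trace_transpose_mul_self_nonneg (A : Matrix (Fin T) (Fin T) ℝ) : 0 ≤ (Aᵀ * A).trace := by
  rw [trace_transpose_mul_self_eq]; positivity

lemma euclNorm_single_one (i : Fin T) : euclNorm (Pi.single i (1 : ℝ)) = 1 := by
  have h : euclNorm (Pi.single i (1 : ℝ)) ^ 2 = 1 := by rw [euclNorm_sq]; simp
  nlinarith [euclNorm_nonneg (Pi.single i (1 : ℝ))]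

lemma trace_transpose_mul_self_le (A : Matrix (Fin T) (Fin T) ℝ) :
    (Aᵀ * A).trace ≤ opNorm A ^ 2 * T := by
  rw [trace_transpose_mul_self_eq]
  have h : ∀ i ∈ (Finset.univ : Finset (Fin T)),
      euclNorm (A *ᵥ Pi.single i (1 : ℝ)) ^ 2 ≤ opNorm A ^ 2 := by
    intro i _
    have := euclNorm_mulVec_le A (Pi.single i (1 : ℝ))
    rw [euclNorm_single_one, mul_one] at this
    exact pow_le_pow_left₀ (euclNorm_nonneg _) this 2
  refine (Finset.sum_le_sum h).trans ?_
  simp [mul_comm]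

lemma abs_trace_le (A : Matrix (Fin T) (Fin T) ℝ) : |A.trace| ≤ opNorm A * T := by
  have h : ∀ i ∈ (Finset.univ : Finset (Fin T)), |A i i| ≤ opNorm A := by
    intro i _
    have h1 : A i i = Pi.single i (1 : ℝ) ⬝ᵥ A *ᵥ Pi.single i 1 := by simp
    rw [h1]
    refine (abs_dotProduct_le_euclNorm_mul _ _).trans ?_
    have := euclNorm_mulVec_le A (Pi.single i (1 : ℝ))
    rw [euclNorm_single_one, mul_one] at this
    rw [euclNorm_single_one, one_mul]; exact this
  refine (Finset.abs_sum_le_sum_abs _ _).trans ((Finset.sum_le_sum h).trans ?_)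
  simp [mul_comm]

end EuclideanNorm

/-! ### Oblique projections: bounds that follow from coercivity of I - Γ. -/

section Oblique

variable {T K : ℕ} {Γ : Matrix (Fin T) (Fin T) ℝ} {c : ℝ}

lemma one_sub_coercive (hΓ : opNorm Γ < 1 - c) (y : Fin T → ℝ) :
    c * euclNorm y ^ 2 ≤ y ⬝ᵥ (1 - Γ) *ᵥ y := by
  have h1 := abs_dotProduct_le_euclNorm_mul y (Γ *ᵥ y)
  have h2 := euclNorm_mulVec_le Γ y
  have h3 : y ⬝ᵥ Γ *ᵥ y ≤ (1 - c) * euclNorm y ^ 2 := by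
    calc y ⬝ᵥ Γ *ᵥ y ≤ euclNorm y * euclNorm (Γ *ᵥ y) := (le_abs_self _).trans h1
      _ ≤ euclNorm y * ((1 - c) * euclNorm y) := by
        have := euclNorm_nonneg y
        gcongr
        exact h2.trans (by gcongr)
      _ = _ := by ring
  rw [Matrix.sub_mulVec, Matrix.one_mulVec, dotProduct_sub, ← euclNorm_sq]
  linarith

lemma euclNorm_one_sub_mulVec_le (hc : 0 < c) (hΓ : opNorm Γ < 1 - c) (y : Fin T → ℝ) :
    euclNorm ((1 - Γ) *ᵥ y) ≤ 2 * euclNorm y := by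
  rw [Matrix.sub_mulVec, Matrix.one_mulVec]
  refine (euclNorm_sub_le _ _).trans ?_
  have h2 := euclNorm_mulVec_le Γ y
  have := euclNorm_nonneg y
  nlinarith

lemma le_euclNorm_one_sub_mulVec (hΓ : opNorm Γ < 1 - c) (y : Fin T → ℝ) :
    c * euclNorm y ≤ euclNorm ((1 - Γ) *ᵥ y) := by
  have h1 := one_sub_coercive hΓ y
  have h2 := (le_abs_self _).trans (abs_dotProduct_le_euclNorm_mul y ((1 - Γ) *ᵥ y))
  rcases (euclNorm_nonneg y).eq_or_lt with h | h
  · rw [← h]; simp [euclNorm_nonneg]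
  · have : euclNorm y * (c * euclNorm y) ≤ euclNorm y * euclNorm ((1 - Γ) *ᵥ y) := by nlinarith
    exact le_of_mul_le_mul_left this h

lemma opNorm_transpose_lt (hΓ : opNorm Γ < 1 - c) : opNorm Γᵀ < 1 - c := by
  rwa [opNorm_transpose]

variable {X : Matrix (Fin T) (Fin K) ℝ}

/-- A Lax–Milgram estimate: pair the normal equations with k and use coercivity at Xk. The
conditioning of X does not enter, which keeps all later constants uniform over designs. -/
lemma euclNorm_mulVec_le_of_normal_eq (hc : 0 < c) (hΓ : opNorm Γ < 1 - c) {k : Fin K → ℝ}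
    {z : Fin T → ℝ} (h : (Xᵀ * (1 - Γ) * X) *ᵥ k = Xᵀ *ᵥ z) :
    euclNorm (X *ᵥ k) ≤ euclNorm z / c := by
  have h1 : (X *ᵥ k) ⬝ᵥ (1 - Γ) *ᵥ (X *ᵥ k) = (X *ᵥ k) ⬝ᵥ z := by
    have h2 : k ⬝ᵥ (Xᵀ * (1 - Γ) * X) *ᵥ k = k ⬝ᵥ Xᵀ *ᵥ z := by rw [h]
    rw [Matrix.mul_assoc, ← Matrix.mulVec_mulVec, ← Matrix.mulVec_mulVec, Matrix.dotProduct_mulVec,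
      Matrix.vecMul_transpose, Matrix.dotProduct_mulVec k, Matrix.vecMul_transpose] at h2
    exact h2
  have h3 := one_sub_coercive hΓ (X *ᵥ k)
  have h4 := (le_abs_self _).trans (abs_dotProduct_le_euclNorm_mul (X *ᵥ k) z)
  rw [le_div_iff₀ hc]
  rcases (euclNorm_nonneg (X *ᵥ k)).eq_or_lt with h0 | h0
  · rw [← h0, zero_mul]; exact euclNorm_nonneg _
  · have : euclNorm (X *ᵥ k) * (euclNorm (X *ᵥ k) * c) ≤ euclNorm (X *ᵥ k) * euclNorm z := by
      nlinarith
    exact le_of_mul_le_mul_left this h0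

lemma mulVec_injective_of_rank (hX : X.rank = K) {k : Fin K → ℝ} (h : X *ᵥ k = 0) : k = 0 := by
  have hli : LinearIndependent ℝ X.col := by
    rw [linearIndependent_iff_card_eq_finrank_span, Fintype.card_fin,
      Set.finrank, ← Matrix.rank_eq_finrank_span_cols, hX]
  exact (Matrix.mulVec_injective_iff.2 hli) (by rw [h, Matrix.mulVec_zero])

lemma isUnit_det_normal (hc : 0 < c) (hΓ : opNorm Γ < 1 - c) (hX : X.rank = K) :
    IsUnit (Xᵀ * (1 - Γ) * X).det := by
  rw [← Matrix.isUnit_iff_isUnit_det, ← Matrix.mulVec_injective_iff_isUnit]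
  refine (injective_iff_map_eq_zero (Matrix.mulVecLin (Xᵀ * (1 - Γ) * X))).2 fun k hk => ?_
  have h := euclNorm_mulVec_le_of_normal_eq (X := X) (z := 0) (k := k) hc hΓ
    (by rw [Matrix.mulVec_zero]; exact hk)
  have h0 : euclNorm (0 : Fin T → ℝ) = 0 := euclNorm_eq_zero.2 rfl
  rw [h0, zero_div] at h
  exact mulVec_injective_of_rank hX (euclNorm_eq_zero.1 (le_antisymm h (euclNorm_nonneg _)))

lemma ivWeights_mul_self (h : IsUnit (Xᵀ * (1 - Γ) * X).det) : ivWeights X Γ * X = 1 := by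
  rw [ivWeights, Matrix.mul_assoc, Matrix.nonsing_inv_mul _ h]

lemma normal_mul_ivWeights (h : IsUnit (Xᵀ * (1 - Γ) * X).det) :
    (Xᵀ * (1 - Γ) * X) * ivWeights X Γ = Xᵀ * (1 - Γ) := by
  rw [ivWeights, Matrix.mul_nonsing_inv_cancel_left _ _ h]

lemma normal_transpose : (Xᵀ * (1 - Γ) * X)ᵀ = Xᵀ * (1 - Γᵀ) * X := by
  simp [Matrix.transpose_mul, Matrix.mul_assoc]

lemma obliqueProj_mul_self (h : IsUnit (Xᵀ * (1 - Γ) * X).det) : obliqueProj X Γ * X = 0 := by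
  rw [obliqueProj, Matrix.sub_mul, Matrix.mul_assoc, ivWeights_mul_self h]; simp

lemma transpose_mul_obliqueProj (h : IsUnit (Xᵀ * (1 - Γ) * X).det) :
    Xᵀ * ((1 - Γ) * obliqueProj X Γ) = 0 := by
  rw [obliqueProj, Matrix.mul_sub, Matrix.mul_sub, Matrix.mul_one, ← Matrix.mul_assoc (1 - Γ),
    ← Matrix.mul_assoc, ← Matrix.mul_assoc, normal_mul_ivWeights h, sub_self]

/-- The term (1-Γ)z contributes 2 and the fitted part 2·(2/c); as c < 1, the sum is at most 6/c. -/
lemma opNorm_residualForm_le (hc : 0 < c) (hΓ : opNorm Γ < 1 - c) (hX : X.rank = K) :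
    opNorm ((1 - Γ) * obliqueProj X Γ) ≤ 6 / c := by
  have hc1 : c < 1 := by have := opNorm_nonneg Γ; linarith
  have hdet := isUnit_det_normal hc hΓ hX
  refine opNorm_le_of_forall (by positivity) fun z => ?_
  have h1 : ((1 - Γ) * obliqueProj X Γ) *ᵥ z =
      (1 - Γ) *ᵥ z - (1 - Γ) *ᵥ (X *ᵥ (ivWeights X Γ *ᵥ z)) := by
    simp [obliqueProj, Matrix.mul_sub, Matrix.sub_mulVec, Matrix.mulVec_mulVec]
  have h2 : (Xᵀ * (1 - Γ) * X) *ᵥ (ivWeights X Γ *ᵥ z) = Xᵀ *ᵥ ((1 - Γ) *ᵥ z) := by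
    rw [Matrix.mulVec_mulVec, normal_mul_ivWeights hdet, Matrix.mulVec_mulVec]
  have h3 := euclNorm_mulVec_le_of_normal_eq hc hΓ h2
  have h4 := euclNorm_one_sub_mulVec_le hc hΓ z
  have h5 := euclNorm_one_sub_mulVec_le hc hΓ (X *ᵥ (ivWeights X Γ *ᵥ z))
  have h6 : euclNorm ((1 - Γ) *ᵥ z) / c ≤ 2 * euclNorm z / c := by gcongr
  have h7 : 2 * euclNorm z ≤ 2 * euclNorm z / c := by
    rw [le_div_iff₀ hc]; nlinarith [euclNorm_nonneg z]
  rw [h1]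
  refine (euclNorm_sub_le _ _).trans ?_
  have h8 : 6 / c * euclNorm z = 3 * (2 * euclNorm z / c) := by ring
  rw [h8]
  linarith

/-- With M the oblique projection, X'(I-Γ)M = 0 gives (I-Γ)M = M'(I-Γ)M. By coercivity its trace is
at least c tr M'M ≥ c tr M² = c(T-K), M being idempotent, and T - K > cT. -/
lemma le_trace_residualForm (hc : 0 < c) (hΓ : opNorm Γ < 1 - c) (hX : X.rank = K)
    (hK : (K : ℝ) < (1 - c) * T) : c ^ 2 * T ≤ ((1 - Γ) * obliqueProj X Γ).trace := by
  have hdet := isUnit_det_normal hc hΓ hX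
  set M := obliqueProj X Γ with hM
  have h1 : Mᵀ * ((1 - Γ) * M) = (1 - Γ) * M := by
    have h0 := transpose_mul_obliqueProj hdet
    rw [← hM] at h0
    have : Mᵀ = 1 - (ivWeights X Γ)ᵀ * Xᵀ := by
      rw [hM, obliqueProj, Matrix.transpose_sub, Matrix.transpose_mul, Matrix.transpose_one]
    rw [this, Matrix.sub_mul, Matrix.mul_assoc _ Xᵀ, h0]; simp
  have h2 : c * (Mᵀ * M).trace ≤ ((1 - Γ) * M).trace := by
    rw [← h1, trace_transpose_mul_self_eq, Finset.mul_sum, Matrix.trace]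
    refine Finset.sum_le_sum fun i _ => ?_
    refine (one_sub_coercive hΓ _).trans (le_of_eq ?_)
    rw [Matrix.mulVec_mulVec, ← Matrix.vecMul_transpose, ← Matrix.dotProduct_mulVec,
      Matrix.mulVec_mulVec]
    simp
  have h3 : (M * M).trace = T - K := by
    have h4 : M * M = M := by
      have : ivWeights X Γ * obliqueProj X Γ = 0 := by
        rw [ivWeights, Matrix.mul_assoc _ (Xᵀ * (1 - Γ)), Matrix.mul_assoc Xᵀ (1 - Γ) (obliqueProj X Γ),
          transpose_mul_obliqueProj hdet, Matrix.mul_zero]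
      have h5 : M * M = M - X * (ivWeights X Γ * M) := by
        nth_rw 1 [hM, obliqueProj]
        rw [Matrix.sub_mul, Matrix.one_mul, Matrix.mul_assoc]
      rw [h5, hM, this, Matrix.mul_zero, sub_zero]
    rw [h4, hM, obliqueProj, Matrix.trace_sub, Matrix.trace_mul_comm, ivWeights_mul_self hdet]
    simp
  have h5 := trace_mul_self_le_trace_transpose_mul M
  nlinarith

variable {a : Fin T → ℝ}

lemma euclNorm_mulVec_inv_normal_le (hc : 0 < c) (hΓ : opNorm Γ < 1 - c) (hX : X.rank = K) :
    euclNorm (X *ᵥ ((Xᵀ * (1 - Γ) * X)⁻¹ *ᵥ (Xᵀ *ᵥ a))) ≤ euclNorm a / c := by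
  refine euclNorm_mulVec_le_of_normal_eq hc hΓ ?_
  rw [Matrix.mulVec_mulVec, Matrix.mul_nonsing_inv _ (isUnit_det_normal hc hΓ hX),
    Matrix.one_mulVec]

lemma vecMul_ivWeights (α : Fin K → ℝ) :
    α ᵥ* ivWeights X Γ =
      (1 - Γᵀ) *ᵥ (X *ᵥ ((Xᵀ * (1 - Γᵀ) * X)⁻¹ *ᵥ α)) := by
  rw [ivWeights, ← Matrix.vecMul_vecMul, ← normal_transpose, ← Matrix.transpose_nonsing_inv,
    Matrix.mulVec_transpose, Matrix.mulVec_mulVec, ← Matrix.mulVec_transpose,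
    Matrix.transpose_mul]
  simp

lemma euclNorm_vecMul_ivWeights_le (hc : 0 < c) (hΓ : opNorm Γ < 1 - c) (hX : X.rank = K) :
    euclNorm ((Xᵀ *ᵥ a) ᵥ* ivWeights X Γ) ≤ 2 * (euclNorm a / c) := by
  have hΓ' := opNorm_transpose_lt hΓ
  rw [vecMul_ivWeights]
  refine (euclNorm_one_sub_mulVec_le hc hΓ' _).trans ?_
  have := euclNorm_mulVec_inv_normal_le (a := a) hc hΓ' hX
  linarith

lemma euclNorm_one_sub_mulVec_inv_normal_le (hc : 0 < c) (hΓ : opNorm Γ < 1 - c)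
    (hX : X.rank = K) :
    euclNorm ((1 - Γ) *ᵥ (X *ᵥ ((Xᵀ * (1 - Γ) * X)⁻¹ *ᵥ (Xᵀ *ᵥ a)))) ≤ 2 * (euclNorm a / c) := by
  refine (euclNorm_one_sub_mulVec_le hc hΓ _).trans ?_
  have := euclNorm_mulVec_inv_normal_le (a := a) hc hΓ hX
  linarith

/-- For α = X'a this sizes α'(X'(I-Γ)X)⁻¹α by |a|²/c. Its sign will keep the determinant of the
rank-one update away from zero. -/
lemma inv_normal_quadratic_bounds (hc : 0 < c) (hΓ : opNorm Γ < 1 - c) (hX : X.rank = K) :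
    0 ≤ (Xᵀ *ᵥ a) ⬝ᵥ (Xᵀ * (1 - Γ) * X)⁻¹ *ᵥ (Xᵀ *ᵥ a) ∧
    (Xᵀ *ᵥ a) ⬝ᵥ (Xᵀ * (1 - Γ) * X)⁻¹ *ᵥ (Xᵀ *ᵥ a) ≤ euclNorm a ^ 2 / c := by
  set k := (Xᵀ * (1 - Γ) * X)⁻¹ *ᵥ (Xᵀ *ᵥ a) with hk
  have h1 : (Xᵀ * (1 - Γ) * X) *ᵥ k = Xᵀ *ᵥ a := by
    rw [hk, Matrix.mulVec_mulVec, Matrix.mul_nonsing_inv _ (isUnit_det_normal hc hΓ hX),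
      Matrix.one_mulVec]
  have h2 : (Xᵀ *ᵥ a) ⬝ᵥ k = a ⬝ᵥ X *ᵥ k := by
    rw [Matrix.mulVec_transpose, ← Matrix.dotProduct_mulVec]
  constructor
  · have h3 : (Xᵀ *ᵥ a) ⬝ᵥ k = (X *ᵥ k) ⬝ᵥ (1 - Γ) *ᵥ (X *ᵥ k) := by
      rw [← h1, dotProduct_comm, Matrix.mul_assoc, ← Matrix.mulVec_mulVec, ← Matrix.mulVec_mulVec,
        Matrix.dotProduct_mulVec, Matrix.vecMul_transpose]
    rw [h3]
    exact le_trans (by positivity) (one_sub_coercive hΓ _)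
  · rw [h2]
    refine ((le_abs_self _).trans (abs_dotProduct_le_euclNorm_mul _ _)).trans ?_
    have := euclNorm_mulVec_inv_normal_le (a := a) hc hΓ hX
    calc euclNorm a * euclNorm (X *ᵥ k) ≤ euclNorm a * (euclNorm a / c) := by
          have := euclNorm_nonneg a
          gcongr
      _ = _ := by ring

/-- Both sides are governed by Xk: the left side is (Xk)'a, and I - Γ' shrinks no vector by more
than the factor c. With X'a equal to the feedback vector, this bounds the quadratic part of the
error by the linear part. -/
lemma abs_dotProduct_le_euclNorm_vecMul (hc : 0 < c) (hΓ : opNorm Γ < 1 - c) (k : Fin K → ℝ) :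
    |k ⬝ᵥ Xᵀ *ᵥ a| ≤ euclNorm (k ᵥ* (Xᵀ * (1 - Γ))) * (euclNorm a / c) := by
  have h1 : k ᵥ* (Xᵀ * (1 - Γ)) = (1 - Γᵀ) *ᵥ (X *ᵥ k) := by
    rw [← Matrix.vecMul_vecMul, Matrix.vecMul_transpose, ← Matrix.mulVec_transpose]; simp
  have h2 := le_euclNorm_one_sub_mulVec (opNorm_transpose_lt hΓ) (X *ᵥ k)
  rw [Matrix.dotProduct_mulVec, Matrix.vecMul_transpose, h1]
  refine (abs_dotProduct_le_euclNorm_mul _ _).trans ?_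
  rw [mul_div_assoc', le_div_iff₀ hc]
  nlinarith [euclNorm_nonneg a]

lemma eq_zero_of_vecMul_eq_zero (hc : 0 < c) (hΓ : opNorm Γ < 1 - c) (hX : X.rank = K)
    {k : Fin K → ℝ} (h : k ᵥ* (Xᵀ * (1 - Γ)) = 0) : k = 0 := by
  have h1 : k ᵥ* (Xᵀ * (1 - Γ)) = (1 - Γᵀ) *ᵥ (X *ᵥ k) := by
    rw [← Matrix.vecMul_vecMul, Matrix.vecMul_transpose, ← Matrix.mulVec_transpose]; simp
  have h2 := le_euclNorm_one_sub_mulVec (opNorm_transpose_lt hΓ) (X *ᵥ k)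
  rw [← h1, h, euclNorm_eq_zero.2 rfl] at h2
  refine mulVec_injective_of_rank hX (euclNorm_eq_zero.1 (le_antisymm ?_ (euclNorm_nonneg _)))
  by_contra hlt
  push Not at hlt
  nlinarith

end Oblique

/-! ### Exact formulas for the estimator under a rank-one change of the regressors. -/

section RankOneUpdate

variable {T K : ℕ}

lemma regressors_eq_add_vecMulVec (X : Matrix (Fin T) (Fin K) ℝ) (α : Fin K → ℝ)
    (e : Fin (T + 1) → ℝ) :
    regressors X α e = X + vecMulVec (fun i => e i.castSucc) α := by
  ext i k; simp [regressors, vecMulVec_apply, mul_comm]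

/-- The Schur complement by which the normal matrix of `X + u α'` differs from that of `X`. -/
noncomputable def updateDet (X : Matrix (Fin T) (Fin K) ℝ) (Γ : Matrix (Fin T) (Fin T) ℝ)
    (α : Fin K → ℝ) (u : Fin T → ℝ) : ℝ :=
  (1 + u ⬝ᵥ (1 - Γ) *ᵥ (X *ᵥ ((Xᵀ * (1 - Γ) * X)⁻¹ *ᵥ α))) *
      (1 + (α ᵥ* ivWeights X Γ) ⬝ᵥ u) +
    u ⬝ᵥ ((1 - Γ) * obliqueProj X Γ) *ᵥ u * (α ⬝ᵥ (Xᵀ * (1 - Γ) * X)⁻¹ *ᵥ α)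

/-- The coefficient on the feedback direction in the updated fit of `z`. -/
noncomputable def updateFit (X : Matrix (Fin T) (Fin K) ℝ) (Γ : Matrix (Fin T) (Fin T) ℝ)
    (α : Fin K → ℝ) (u z : Fin T → ℝ) : ℝ :=
  ((1 + u ⬝ᵥ (1 - Γ) *ᵥ (X *ᵥ ((Xᵀ * (1 - Γ) * X)⁻¹ *ᵥ α))) * ((α ᵥ* ivWeights X Γ) ⬝ᵥ z) +
    α ⬝ᵥ (Xᵀ * (1 - Γ) * X)⁻¹ *ᵥ α * (u ⬝ᵥ ((1 - Γ) * obliqueProj X Γ) *ᵥ z)) /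
      updateDet X Γ α u

/-- The score of the feedback direction in the updated fit of `z`. -/
noncomputable def updateScore (X : Matrix (Fin T) (Fin K) ℝ) (Γ : Matrix (Fin T) (Fin T) ℝ)
    (α : Fin K → ℝ) (u z : Fin T → ℝ) : ℝ :=
  ((1 + (α ᵥ* ivWeights X Γ) ⬝ᵥ u) * (u ⬝ᵥ ((1 - Γ) * obliqueProj X Γ) *ᵥ z) -
    u ⬝ᵥ ((1 - Γ) * obliqueProj X Γ) *ᵥ u * ((α ᵥ* ivWeights X Γ) ⬝ᵥ z)) / updateDet X Γ α u

variable {X : Matrix (Fin T) (Fin K) ℝ} {Γ : Matrix (Fin T) (Fin T) ℝ} {α : Fin K → ℝ}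
  {u : Fin T → ℝ}

lemma add_vecMulVec_mulVec (k : Fin K → ℝ) :
    (X + vecMulVec u α) *ᵥ k = X *ᵥ k + (α ⬝ᵥ k) • u := by
  rw [Matrix.add_mulVec]
  congr 1
  ext i
  simp [vecMulVec_apply, Matrix.mulVec, dotProduct, Finset.mul_sum, mul_comm, mul_left_comm]

lemma add_vecMulVec_transpose_mulVec (z : Fin T → ℝ) :
    (X + vecMulVec u α)ᵀ *ᵥ z = Xᵀ *ᵥ z + (u ⬝ᵥ z) • α := by
  rw [Matrix.transpose_add, Matrix.add_mulVec]
  congr 1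
  ext i
  simp [vecMulVec_apply, Matrix.mulVec, dotProduct, Finset.mul_sum, mul_comm, mul_left_comm]

lemma residualForm_mulVec (z : Fin T → ℝ) :
    ((1 - Γ) * obliqueProj X Γ) *ᵥ z =
      (1 - Γ) *ᵥ z - (1 - Γ) *ᵥ (X *ᵥ (ivWeights X Γ *ᵥ z)) := by
  simp [obliqueProj, Matrix.mul_sub, Matrix.sub_mulVec, Matrix.mulVec_mulVec]

lemma normal_mulVec (X : Matrix (Fin T) (Fin K) ℝ) (Γ : Matrix (Fin T) (Fin T) ℝ) (k : Fin K → ℝ) :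
    (Xᵀ * (1 - Γ) * X) *ᵥ k = Xᵀ *ᵥ ((1 - Γ) *ᵥ (X *ᵥ k)) := by
  simp only [Matrix.mulVec_mulVec, Matrix.mul_assoc]

lemma eq_inv_mulVec_of {S : Matrix (Fin K) (Fin K) ℝ} (h : IsUnit S.det) {k l : Fin K → ℝ}
    (hk : S *ᵥ k = l) : k = S⁻¹ *ᵥ l := by
  rw [← hk, Matrix.mulVec_mulVec, Matrix.nonsing_inv_mul _ h, Matrix.one_mulVec]

lemma isUnit_det_normal_add_vecMulVec (hS : IsUnit (Xᵀ * (1 - Γ) * X).det)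
    (hD : updateDet X Γ α u ≠ 0) :
    IsUnit ((X + vecMulVec u α)ᵀ * (1 - Γ) * (X + vecMulVec u α)).det := by
  rw [← Matrix.isUnit_iff_isUnit_det, ← Matrix.mulVec_injective_iff_isUnit]
  refine (injective_iff_map_eq_zero (Matrix.mulVecLin _)).2 fun k hk => ?_
  rw [Matrix.mulVecLin_apply, normal_mulVec, add_vecMulVec_mulVec,
    add_vecMulVec_transpose_mulVec] at hk
  set x := α ⬝ᵥ k with hx
  set s := -(u ⬝ᵥ (1 - Γ) *ᵥ (X *ᵥ k + x • u)) with hs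
  set w := (Xᵀ * (1 - Γ) * X)⁻¹ *ᵥ α with hw
  -- A kernel vector is determined by the two scalars x and s, which solve a homogeneous 2×2 system
  -- with determinant `updateDet`; hence both vanish.
  have h1 : k = -x • (ivWeights X Γ *ᵥ u) + s • w := by
    have h2 : (Xᵀ * (1 - Γ) * X) *ᵥ k = -x • (Xᵀ *ᵥ ((1 - Γ) *ᵥ u)) + s • α := by
      rw [normal_mulVec, neg_smul, ← sub_eq_zero, ← hk, hs, Matrix.mulVec_add, Matrix.mulVec_add,
        Matrix.mulVec_smul, Matrix.mulVec_smul, neg_smul]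
      abel
    rw [eq_inv_mulVec_of hS h2, Matrix.mulVec_add, Matrix.mulVec_smul, Matrix.mulVec_smul, ← hw,
      ivWeights]
    simp only [Matrix.mulVec_mulVec]
  have h3 : x = -x * ((α ᵥ* ivWeights X Γ) ⬝ᵥ u) + s * (α ⬝ᵥ w) := by
    have := congrArg (fun l => α ⬝ᵥ l) h1
    simpa only [dotProduct_add, dotProduct_smul, smul_eq_mul, Matrix.dotProduct_mulVec] using this
  have h4 : s = -x * (u ⬝ᵥ ((1 - Γ) * obliqueProj X Γ) *ᵥ u) -
      s * (u ⬝ᵥ (1 - Γ) *ᵥ (X *ᵥ w)) := by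
    have h5 : X *ᵥ k + x • u = x • (u - X *ᵥ (ivWeights X Γ *ᵥ u)) + s • (X *ᵥ w) := by
      conv_lhs => rw [h1]
      rw [Matrix.mulVec_add, Matrix.mulVec_smul, Matrix.mulVec_smul, smul_sub, neg_smul]
      abel
    conv_lhs => rw [hs, h5]
    rw [Matrix.mulVec_add, Matrix.mulVec_smul, Matrix.mulVec_smul, Matrix.mulVec_sub,
      ← residualForm_mulVec, dotProduct_add, dotProduct_smul, dotProduct_smul, smul_eq_mul,
      smul_eq_mul]
    ring
  have hx0 : updateDet X Γ α u * x = 0 := by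
    rw [updateDet, ← hw]
    linear_combination (1 + u ⬝ᵥ (1 - Γ) *ᵥ (X *ᵥ w)) * h3 + (α ⬝ᵥ w) * h4
  have hs0 : updateDet X Γ α u * s = 0 := by
    rw [updateDet, ← hw]
    linear_combination (1 + (α ᵥ* ivWeights X Γ) ⬝ᵥ u) * h4 -
      (u ⬝ᵥ ((1 - Γ) * obliqueProj X Γ) *ᵥ u) * h3
  have hx1 := (mul_eq_zero.1 hx0).resolve_left hD
  have hs1 := (mul_eq_zero.1 hs0).resolve_left hD
  rw [h1, hx1, hs1]; simp

/-- With `updateScore_eq`, this says that the pair solves the 2×2 system left once the normal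
equations of X are solved; the definitions are Cramer's rule. -/
lemma updateFit_eq (hD : updateDet X Γ α u ≠ 0) (z : Fin T → ℝ) :
    (α ᵥ* ivWeights X Γ) ⬝ᵥ z - updateFit X Γ α u z * ((α ᵥ* ivWeights X Γ) ⬝ᵥ u) +
      updateScore X Γ α u z * (α ⬝ᵥ (Xᵀ * (1 - Γ) * X)⁻¹ *ᵥ α) = updateFit X Γ α u z := by
  rw [updateFit, updateScore]
  field_simp
  rw [updateDet]; ring

lemma updateScore_eq (hD : updateDet X Γ α u ≠ 0) (z : Fin T → ℝ) :
    u ⬝ᵥ ((1 - Γ) * obliqueProj X Γ) *ᵥ z -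
        updateFit X Γ α u z * (u ⬝ᵥ ((1 - Γ) * obliqueProj X Γ) *ᵥ u) -
        updateScore X Γ α u z *
          (u ⬝ᵥ (1 - Γ) *ᵥ (X *ᵥ ((Xᵀ * (1 - Γ) * X)⁻¹ *ᵥ α))) =
      updateScore X Γ α u z := by
  rw [updateFit, updateScore]
  field_simp
  rw [updateDet]; ring

lemma updated_residual_mulVec (hD : updateDet X Γ α u ≠ 0) (z : Fin T → ℝ) :
    (1 - Γ) *ᵥ (z - (X + vecMulVec u α) *ᵥ (ivWeights X Γ *ᵥ (z - updateFit X Γ α u z • u) +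
        updateScore X Γ α u z • ((Xᵀ * (1 - Γ) * X)⁻¹ *ᵥ α))) =
      ((1 - Γ) * obliqueProj X Γ) *ᵥ z -
        updateFit X Γ α u z • (((1 - Γ) * obliqueProj X Γ) *ᵥ u) -
        updateScore X Γ α u z • ((1 - Γ) *ᵥ (X *ᵥ ((Xᵀ * (1 - Γ) * X)⁻¹ *ᵥ α))) := by
  have hfit := updateFit_eq hD z
  set x := updateFit X Γ α u z
  set s := updateScore X Γ α u z
  set w := (Xᵀ * (1 - Γ) * X)⁻¹ *ᵥ α
  -- Self-consistency: x was introduced as the coefficient on u, and it is indeed α' times the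
  -- candidate solution.
  have h1 : α ⬝ᵥ (ivWeights X Γ *ᵥ (z - x • u) + s • w) = x := by
    rw [dotProduct_add, Matrix.mulVec_sub, Matrix.mulVec_smul, dotProduct_sub, dotProduct_smul,
      dotProduct_smul, Matrix.dotProduct_mulVec, Matrix.dotProduct_mulVec, smul_eq_mul,
      smul_eq_mul, hfit]
  rw [add_vecMulVec_mulVec, h1]
  simp only [residualForm_mulVec, Matrix.mulVec_add, Matrix.mulVec_sub, Matrix.mulVec_smul,
    smul_sub]
  abel

/-- The updated weights, applied to any vector. -/
lemma ivWeights_add_vecMulVec_mulVec (hS : IsUnit (Xᵀ * (1 - Γ) * X).det)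
    (hD : updateDet X Γ α u ≠ 0) (z : Fin T → ℝ) :
    ivWeights (X + vecMulVec u α) Γ *ᵥ z =
      ivWeights X Γ *ᵥ (z - updateFit X Γ α u z • u) +
        updateScore X Γ α u z • ((Xᵀ * (1 - Γ) * X)⁻¹ *ᵥ α) := by
  have hres := updated_residual_mulVec hD z
  have hscore := updateScore_eq hD z
  set d := ivWeights X Γ *ᵥ (z - updateFit X Γ α u z • u) +
        updateScore X Γ α u z • ((Xᵀ * (1 - Γ) * X)⁻¹ *ᵥ α) with hd
  have hN : ∀ z, Xᵀ *ᵥ (((1 - Γ) * obliqueProj X Γ) *ᵥ z) = 0 := fun z => by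
    rw [Matrix.mulVec_mulVec, transpose_mul_obliqueProj hS, Matrix.zero_mulVec]
  have hSw : Xᵀ *ᵥ ((1 - Γ) *ᵥ (X *ᵥ ((Xᵀ * (1 - Γ) * X)⁻¹ *ᵥ α))) = α := by
    rw [← normal_mulVec, Matrix.mulVec_mulVec, Matrix.mul_nonsing_inv _ hS, Matrix.one_mulVec]
  -- The candidate satisfies the updated normal equations: X' annihilates the residual forms and
  -- leaves -s α, and the score s of the direction u restores s α.
  have h1 : (X + vecMulVec u α)ᵀ *ᵥ ((1 - Γ) *ᵥ (z - (X + vecMulVec u α) *ᵥ d)) = 0 := by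
    rw [hres, add_vecMulVec_transpose_mulVec, dotProduct_sub, dotProduct_sub, dotProduct_smul,
      dotProduct_smul, smul_eq_mul, smul_eq_mul, hscore, Matrix.mulVec_sub, Matrix.mulVec_sub,
      Matrix.mulVec_smul, Matrix.mulVec_smul, hN, hN, hSw]
    simp
  have h2 : ((X + vecMulVec u α)ᵀ * (1 - Γ) * (X + vecMulVec u α)) *ᵥ d =
      (X + vecMulVec u α)ᵀ *ᵥ ((1 - Γ) *ᵥ z) := by
    rw [normal_mulVec]
    rw [Matrix.mulVec_sub, Matrix.mulVec_sub, sub_eq_zero] at h1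
    exact h1.symm
  rw [eq_inv_mulVec_of (isUnit_det_normal_add_vecMulVec hS hD) h2, ivWeights]
  simp only [Matrix.mulVec_mulVec, Matrix.mul_assoc]

/-- The updated contrast, in terms of the contrast before the update. -/
lemma vecMul_ivWeights_add_vecMulVec (hS : IsUnit (Xᵀ * (1 - Γ) * X).det)
    (hD : updateDet X Γ α u ≠ 0) (r : Fin K → ℝ) :
    r ᵥ* ivWeights (X + vecMulVec u α) Γ =
      r ᵥ* ivWeights X Γ -
        (((1 + u ⬝ᵥ (1 - Γ) *ᵥ (X *ᵥ ((Xᵀ * (1 - Γ) * X)⁻¹ *ᵥ α))) * ((r ᵥ* ivWeights X Γ) ⬝ᵥ u) +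
          r ⬝ᵥ (Xᵀ * (1 - Γ) * X)⁻¹ *ᵥ α * (u ⬝ᵥ ((1 - Γ) * obliqueProj X Γ) *ᵥ u)) /
            updateDet X Γ α u) • (α ᵥ* ivWeights X Γ) +
        ((r ⬝ᵥ (Xᵀ * (1 - Γ) * X)⁻¹ *ᵥ α * (1 + (α ᵥ* ivWeights X Γ) ⬝ᵥ u) -
          (r ᵥ* ivWeights X Γ) ⬝ᵥ u * (α ⬝ᵥ (Xᵀ * (1 - Γ) * X)⁻¹ *ᵥ α)) /
            updateDet X Γ α u) • (u ᵥ* ((1 - Γ) * obliqueProj X Γ)) := by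
  refine dotProduct_eq _ _ fun z => ?_
  rw [← Matrix.dotProduct_mulVec, ivWeights_add_vecMulVec_mulVec hS hD, dotProduct_add,
    dotProduct_smul, Matrix.dotProduct_mulVec, dotProduct_sub, dotProduct_smul, add_dotProduct,
    sub_dotProduct, smul_dotProduct, smul_dotProduct, ← Matrix.dotProduct_mulVec u,
    updateFit, updateScore]
  simp only [smul_eq_mul]
  field_simp
  ring

lemma dotProduct_updated_residualForm (hS : IsUnit (Xᵀ * (1 - Γ) * X).det)
    (hD : updateDet X Γ α u ≠ 0) (z : Fin T → ℝ) :
    z ⬝ᵥ ((1 - Γ) * obliqueProj (X + vecMulVec u α) Γ) *ᵥ z =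
      z ⬝ᵥ ((1 - Γ) * obliqueProj X Γ) *ᵥ z -
        updateFit X Γ α u z * (z ⬝ᵥ ((1 - Γ) * obliqueProj X Γ) *ᵥ u) -
        updateScore X Γ α u z *
          (z ⬝ᵥ (1 - Γ) *ᵥ (X *ᵥ ((Xᵀ * (1 - Γ) * X)⁻¹ *ᵥ α))) := by
  have h := updated_residual_mulVec hD z
  rw [← ivWeights_add_vecMulVec_mulVec hS hD, Matrix.mulVec_sub, ← residualForm_mulVec] at h
  rw [h, dotProduct_sub, dotProduct_sub, dotProduct_smul, dotProduct_smul, smul_eq_mul,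
    smul_eq_mul]

/-- N annihilates the range of X from both sides, so β drops out of the variance estimator. -/
lemma residualForm_add_mulVec (h : IsUnit (Xᵀ * (1 - Γ) * X).det) (β : Fin K → ℝ)
    (z : Fin T → ℝ) :
    (X *ᵥ β + z) ⬝ᵥ ((1 - Γ) * obliqueProj X Γ) *ᵥ (X *ᵥ β + z) =
      z ⬝ᵥ ((1 - Γ) * obliqueProj X Γ) *ᵥ z := by
  have h1 : ((1 - Γ) * obliqueProj X Γ) *ᵥ (X *ᵥ β) = 0 := by
    rw [Matrix.mulVec_mulVec, Matrix.mul_assoc, obliqueProj_mul_self h]; simp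
  have h2 : (X *ᵥ β) ⬝ᵥ ((1 - Γ) * obliqueProj X Γ) *ᵥ z = 0 := by
    rw [← Matrix.vecMul_transpose, ← Matrix.dotProduct_mulVec, Matrix.mulVec_mulVec,
      transpose_mul_obliqueProj h]; simp
  rw [Matrix.mulVec_add, h1, zero_add, add_dotProduct, h2, zero_add]

lemma dotProduct_betaIV_sub (h : IsUnit (Xᵀ * (1 - Γ) * X).det) (r β : Fin K → ℝ)
    (z : Fin T → ℝ) :
    r ⬝ᵥ betaIV X (X *ᵥ β + z) Γ - r ⬝ᵥ β = (r ᵥ* ivWeights X Γ) ⬝ᵥ z := by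
  rw [betaIV, Matrix.mulVec_add, Matrix.mulVec_mulVec, ivWeights_mul_self h, Matrix.one_mulVec,
    dotProduct_add, Matrix.dotProduct_mulVec]
  ring

end RankOneUpdate

/-! ### Scalar perturbation bounds for the rank-one update. -/

section Perturbation

/-- Dictionary for this part, in the notation of the opening comment: s = √T, p = α'Wu, q =
u'(I-Γ)X̃S⁻¹α, m = u'Nu, mb = v tr N, h = α'S⁻¹α, ru = r'Wu, and τ' is the limiting slope. The
product mb·h is of order one, but it is nonnegative; the other terms are at least (7/8)² - 1/8 >
1/2. -/
lemma half_le_perturbed_det {κ s p q m mb h : ℝ} (hκ : 1 ≤ κ) (hs : 8 * κ ^ 2 ≤ s)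
    (hp : |p| ≤ κ / s) (hq : |q| ≤ κ / s) (hm : |m - mb| ≤ κ * s) (hmb : 0 ≤ mb)
    (hh : 0 ≤ h) (hh' : h ≤ κ / s ^ 2) : 1 / 2 ≤ (1 + q) * (1 + p) + m * h := by
  have hs0 : 0 < s := by nlinarith
  have h1 : κ / s ≤ 1 / 8 := by
    rw [div_le_iff₀ hs0]; nlinarith
  have h2 : -(1 / 8) ≤ (m - mb) * h := by
    have h3 : |(m - mb) * h| ≤ κ * s * (κ / s ^ 2) := by
      rw [abs_mul, abs_of_nonneg hh]
      gcongr
    have h4 : κ * s * (κ / s ^ 2) ≤ 1 / 8 := by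
      rw [show κ * s * (κ / s ^ 2) = κ ^ 2 / s by field_simp, div_le_iff₀ hs0]; linarith
    linarith [neg_abs_le ((m - mb) * h)]
  have h5 : 0 ≤ mb * h := mul_nonneg hmb hh
  have hp' := abs_le.1 (hp.trans h1)
  have hq' := abs_le.1 (hq.trans h1)
  nlinarith [mul_nonneg (by linarith : 0 ≤ 1 / 8 + q) (by linarith : 0 ≤ 1 / 8 + p)]

lemma abs_div_sub_le_of_half_le {N D t e : ℝ} (hD : 1 / 2 ≤ D) (h : |N - t * D| ≤ e) :
    |N / D - t| ≤ 2 * e := by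
  have hD0 : 0 < D := by linarith
  have : N / D - t = (N - t * D) / D := by field_simp
  rw [this, abs_div, abs_of_pos hD0, div_le_iff₀ hD0]
  have := abs_nonneg (N - t * D)
  nlinarith

lemma abs_div_le_of_half_le {N D e : ℝ} (hD : 1 / 2 ≤ D) (h : |N| ≤ e) : |N / D| ≤ 2 * e := by
  have := abs_div_sub_le_of_half_le (t := 0) hD (by simpa using h)
  simpa using this

lemma abs_mul_le_mul {a b x y : ℝ} (ha : |a| ≤ x) (hb : |b| ≤ y) : |a * b| ≤ x * y := by
  rw [abs_mul]
  exact mul_le_mul ha hb (abs_nonneg _) ((abs_nonneg _).trans ha)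

/-- The two coefficients of the perturbed contrast are close to their limits. -/
lemma perturbed_coefficients {κ s x p q m mb h ru τ' : ℝ} (hκ : 1 ≤ κ) (hs : 8 * κ ^ 2 ≤ s)
    (hx : 0 ≤ x)
    (hp : |p| ≤ κ / s) (hq : |q| ≤ κ / s) (hm : |m - mb| ≤ κ * s) (hmb : 0 ≤ mb)
    (hmb' : mb ≤ κ * s ^ 2) (hh : 0 ≤ h) (hh' : h ≤ κ / s ^ 2) (hru : |ru| ≤ κ * x)
    (hτ : |τ'| ≤ κ * x / s) :
    |((1 + q) * ru + τ' * (1 + mb * h) * m) / ((1 + q) * (1 + p) + m * h) - τ' * mb| ≤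
        12 * κ ^ 3 * x ∧
      |(τ' * (1 + mb * h) * (1 + p) - ru * h) / ((1 + q) * (1 + p) + m * h) - τ'| ≤
        10 * κ ^ 4 * x / s ^ 2 := by
  have hD := half_le_perturbed_det hκ hs hp hq hm hmb hh hh'
  have hs0 : 0 < s := by nlinarith
  have h1 : κ / s ≤ 1 := by
    rw [div_le_iff₀ hs0]; nlinarith
  have hκ2 : κ ≤ κ ^ 2 := by nlinarith
  have hκ3 : κ ^ 2 ≤ κ ^ 3 := by nlinarith [sq_nonneg κ]
  have hκ4 : κ ^ 3 ≤ κ ^ 4 := by nlinarith [pow_nonneg (by linarith : 0 ≤ κ) 3]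
  have hmba : |mb| ≤ κ * s ^ 2 := by rwa [abs_of_nonneg hmb]
  have hha : |h| ≤ κ / s ^ 2 := by rwa [abs_of_nonneg hh]
  have h1p : |1 + p| ≤ 2 := (abs_add_le _ _).trans (by rw [abs_one]; linarith)
  have h1q : |1 + q| ≤ 2 := (abs_add_le _ _).trans (by rw [abs_one]; linarith)
  constructor
  · have hb : |(1 + q) * ru + τ' * (1 + mb * h) * m - τ' * mb * ((1 + q) * (1 + p) + m * h)| ≤
        6 * κ ^ 3 * x := by
      -- The terms in τ'·mb·m·h cancel exactly. What remains contains only fluctuations: m - mb, p,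
      -- q and ru.
      have e1 : (1 + q) * ru + τ' * (1 + mb * h) * m - τ' * mb * ((1 + q) * (1 + p) + m * h) =
          (1 + q) * ru + τ' * ((m - mb) + -(mb * (p * (1 + q) + q))) := by ring
      have b1 : |p * (1 + q) + q| ≤ 3 * (κ / s) := by
        refine (abs_add_le _ _).trans ?_
        have := abs_mul_le_mul hp h1q
        linarith
      have b2 : |(m - mb) + -(mb * (p * (1 + q) + q))| ≤ 4 * κ ^ 2 * s := by
        refine (abs_add_le _ _).trans ?_
        rw [abs_neg]
        have := abs_mul_le_mul hmba b1
        have e : κ * s ^ 2 * (3 * (κ / s)) = 3 * κ ^ 2 * s := by field_simp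
        nlinarith
      have b3 := abs_mul_le_mul hτ b2
      have e3 : κ * x / s * (4 * κ ^ 2 * s) = 4 * κ ^ 3 * x := by field_simp
      have b4 := abs_mul_le_mul h1q hru
      rw [e1]
      refine (abs_add_le _ _).trans ?_
      nlinarith [mul_le_mul_of_nonneg_right (hκ2.trans hκ3) hx]
    refine (abs_div_sub_le_of_half_le hD hb).trans (le_of_eq (by ring))
  · have hb : |τ' * (1 + mb * h) * (1 + p) - ru * h - τ' * ((1 + q) * (1 + p) + m * h)| ≤
        5 * κ ^ 4 * x / s ^ 2 := by
      -- Again the leading term τ'(1 + mb·h) cancels, and every remaining factor is small.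
      have e1 : τ' * (1 + mb * h) * (1 + p) - ru * h - τ' * ((1 + q) * (1 + p) + m * h) =
          τ' * (-((m - mb) * h) + (p * (mb * h) + -((1 + p) * q))) + -(ru * h) := by ring
      have b1 := abs_mul_le_mul hm hha
      have b2 := abs_mul_le_mul hp (abs_mul_le_mul hmba hha)
      have b3 := abs_mul_le_mul h1p hq
      have e2 : κ * s * (κ / s ^ 2) = κ ^ 2 / s := by field_simp
      have e3 : κ / s * (κ * s ^ 2 * (κ / s ^ 2)) = κ ^ 3 / s := by field_simp
      have b4 : |-((m - mb) * h) + (p * (mb * h) + -((1 + p) * q))| ≤ 4 * κ ^ 3 / s := by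
        refine (abs_add_le _ _).trans ?_
        have := abs_add_le (p * (mb * h)) (-((1 + p) * q))
        rw [abs_neg] at *
        have e4 : κ ^ 2 / s ≤ κ ^ 3 / s := by gcongr
        have e5 : κ / s ≤ κ ^ 3 / s := by gcongr; linarith
        have e6 : 4 * κ ^ 3 / s = κ ^ 3 / s + κ ^ 3 / s + 2 * (κ ^ 3 / s) := by ring
        linarith
      have b5 := abs_mul_le_mul hτ b4
      have b6 := abs_mul_le_mul hru hha
      rw [e1]
      refine (abs_add_le _ _).trans ?_
      rw [abs_neg]
      have e7 : κ * x / s * (4 * κ ^ 3 / s) = 4 * κ ^ 4 * x / s ^ 2 := by field_simp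
      have e8 : κ * x * (κ / s ^ 2) ≤ κ ^ 4 * x / s ^ 2 := by
        rw [show κ * x * (κ / s ^ 2) = κ ^ 2 * x / s ^ 2 by ring]
        gcongr; linarith
      have e9 : 5 * κ ^ 4 * x / s ^ 2 = 4 * κ ^ 4 * x / s ^ 2 + κ ^ 4 * x / s ^ 2 := by ring
      linarith
    refine (abs_div_sub_le_of_half_le hD hb).trans (le_of_eq (by ring))

/-- The residual quadratic form is close to its limit. -/
lemma perturbed_residual {κ s p q m mb h bz b₂z g zNz zNu vt : ℝ} (hκ : 1 ≤ κ)
    (hs : 8 * κ ^ 2 ≤ s)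
    (hp : |p| ≤ κ / s) (hq : |q| ≤ κ / s) (hm : |m - mb| ≤ κ * s) (hmb : 0 ≤ mb)
    (hmb' : mb ≤ κ * s ^ 2) (hh : 0 ≤ h) (hh' : h ≤ κ / s ^ 2) (hbz : |bz| ≤ κ / s)
    (hb₂z : |b₂z| ≤ κ / s) (hg : |g| ≤ κ * s) (hzz : |zNz - vt| ≤ κ * s)
    (hzu : |zNu| ≤ κ * s ^ 2) :
    vt - 15 * κ ^ 3 * s ≤
      zNz - ((1 + q) * bz + h * g) / ((1 + q) * (1 + p) + m * h) * zNu -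
        ((1 + p) * g - m * bz) / ((1 + q) * (1 + p) + m * h) * b₂z := by
  have hD := half_le_perturbed_det hκ hs hp hq hm hmb hh hh'
  have hs0 : 0 < s := by nlinarith
  have hs1 : 1 ≤ s := by nlinarith
  have h1 : κ / s ≤ 1 := by
    rw [div_le_iff₀ hs0]; nlinarith
  have hκ2 : κ ≤ κ ^ 2 := by nlinarith
  have hκ3 : κ ^ 2 ≤ κ ^ 3 := by nlinarith [sq_nonneg κ]
  have hha : |h| ≤ κ / s ^ 2 := by rwa [abs_of_nonneg hh]
  have h1p : |1 + p| ≤ 2 := (abs_add_le _ _).trans (by rw [abs_one]; linarith)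
  have h1q : |1 + q| ≤ 2 := (abs_add_le _ _).trans (by rw [abs_one]; linarith)
  have hma : |m| ≤ 2 * κ * s ^ 2 := by
    have : m = (m - mb) + mb := by ring
    rw [this]
    refine (abs_add_le _ _).trans ?_
    rw [abs_of_nonneg hmb]
    nlinarith [mul_nonneg (by linarith : 0 ≤ κ) (mul_nonneg hs0.le (by linarith : 0 ≤ s - 1))]
  have hfit : |((1 + q) * bz + h * g) / ((1 + q) * (1 + p) + m * h)| ≤ 2 * (3 * κ ^ 2 / s) := by
    refine abs_div_le_of_half_le hD ((abs_add_le _ _).trans ?_)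
    have b1 := abs_mul_le_mul h1q hbz
    have b2 := abs_mul_le_mul hha hg
    have e1 : κ / s ^ 2 * (κ * s) = κ ^ 2 / s := by field_simp
    have e2 : κ / s ≤ κ ^ 2 / s := by gcongr
    have e3 : 3 * κ ^ 2 / s = 2 * (κ ^ 2 / s) + κ ^ 2 / s := by ring
    linarith
  have hscore : |((1 + p) * g - m * bz) / ((1 + q) * (1 + p) + m * h)| ≤ 2 * (4 * κ ^ 2 * s) := by
    refine abs_div_le_of_half_le hD ((abs_sub _ _).trans ?_)
    have b1 := abs_mul_le_mul h1p hg
    have b2 := abs_mul_le_mul hma hbz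
    have e1 : 2 * κ * s ^ 2 * (κ / s) = 2 * κ ^ 2 * s := by field_simp
    nlinarith
  have t1 := abs_mul_le_mul hfit hzu
  have t2 := abs_mul_le_mul hscore hb₂z
  have e1 : 2 * (3 * κ ^ 2 / s) * (κ * s ^ 2) = 6 * κ ^ 3 * s := by field_simp; ring
  have e2 : 2 * (4 * κ ^ 2 * s) * (κ / s) = 8 * κ ^ 3 := by field_simp; ring
  have e3 : κ ^ 3 ≤ κ ^ 3 * s := by
    have : 0 < κ ^ 3 := by positivity
    nlinarith
  have e4 : κ * s ≤ κ ^ 3 * s := by gcongr; linarith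
  have := le_abs_self (((1 + q) * bz + h * g) / ((1 + q) * (1 + p) + m * h) * zNu)
  have := le_abs_self (((1 + p) * g - m * bz) / ((1 + q) * (1 + p) + m * h) * b₂z)
  have := neg_abs_le (zNz - vt)
  linarith

/-- The squared length of the perturbed contrast is close to its limit. -/
lemma perturbed_contrast_sq {T : ℕ} {κ s F τ' d₁ d₂ : ℝ} {l b n : Fin T → ℝ} (hκ : 1 ≤ κ)
    (hs : 8 * κ ^ 2 ≤ s) (hτ : |τ'| ≤ κ * euclNorm l / s)
    (hb : euclNorm b ≤ κ / s) (hn : euclNorm n ≤ κ * s)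
    (hln : |l ⬝ᵥ n| ≤ κ * euclNorm l) (hnF : |euclNorm n ^ 2 - F| ≤ κ * s)
    (hd₁ : |d₁| ≤ 12 * κ ^ 3 * euclNorm l) (hd₂ : |d₂| ≤ 10 * κ ^ 4 * euclNorm l / s ^ 2) :
    euclNorm l ^ 2 + τ' ^ 2 * F - 91 * κ ^ 7 / s * euclNorm l ^ 2 ≤
      euclNorm (l + τ' • n + (d₂ • n - d₁ • b)) ^ 2 := by
  set x := euclNorm l with hx
  have hx0 : 0 ≤ x := euclNorm_nonneg _
  have hs0 : 0 < s := by nlinarith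
  have hκ0 : 0 < κ := by linarith
  have hpow : ∀ {i j : ℕ}, i ≤ j → κ ^ i ≤ κ ^ j := fun h => pow_le_pow_right₀ hκ h
  have hrem : euclNorm (d₂ • n - d₁ • b) ≤ 22 * κ ^ 5 * x / s := by
    refine (euclNorm_sub_le _ _).trans ?_
    rw [euclNorm_smul, euclNorm_smul]
    have b1 := mul_le_mul hd₂ hn (euclNorm_nonneg _) ((abs_nonneg _).trans hd₂)
    have b2 := mul_le_mul hd₁ hb (euclNorm_nonneg _) ((abs_nonneg _).trans hd₁)
    have e1 : 10 * κ ^ 4 * x / s ^ 2 * (κ * s) = 10 * κ ^ 5 * x / s := by field_simp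
    have e2 : 12 * κ ^ 3 * x * (κ / s) ≤ 12 * κ ^ 5 * x / s := by
      rw [show 12 * κ ^ 3 * x * (κ / s) = 12 * κ ^ 4 * x / s by ring]
      gcongr ?_ / s
      have := hpow (show 4 ≤ 5 by norm_num)
      nlinarith
    have e3 : 22 * κ ^ 5 * x / s = 10 * κ ^ 5 * x / s + 12 * κ ^ 5 * x / s := by ring
    linarith
  have hY : euclNorm (l + τ' • n) ≤ 2 * κ ^ 2 * x := by
    refine (euclNorm_add_le _ _).trans ?_
    rw [euclNorm_smul]
    have b1 := mul_le_mul hτ hn (euclNorm_nonneg _) ((abs_nonneg _).trans hτ)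
    have e1 : κ * x / s * (κ * s) = κ ^ 2 * x := by field_simp
    have : 1 ≤ κ ^ 2 := one_le_pow₀ hκ
    nlinarith
  have hY2 : x ^ 2 + τ' ^ 2 * F - 3 * κ ^ 3 * x ^ 2 / s ≤ euclNorm (l + τ' • n) ^ 2 := by
    have e0 : euclNorm (l + τ' • n) ^ 2 = x ^ 2 + (2 * (τ' * (l ⬝ᵥ n)) + τ' ^ 2 * F) +
        τ' ^ 2 * (euclNorm n ^ 2 - F) := by
      rw [euclNorm_sq, hx, euclNorm_sq, euclNorm_sq, add_dotProduct, dotProduct_add, dotProduct_add,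
        smul_dotProduct, dotProduct_smul, smul_dotProduct, dotProduct_smul, dotProduct_comm n l]
      simp only [smul_eq_mul]; ring
    have b1 := abs_mul_le_mul hτ hln
    have b2 : τ' ^ 2 ≤ (κ * x / s) ^ 2 := by
      rw [← sq_abs]; exact pow_le_pow_left₀ (abs_nonneg _) hτ 2
    have b3 : |τ' ^ 2 * (euclNorm n ^ 2 - F)| ≤ (κ * x / s) ^ 2 * (κ * s) :=
      abs_mul_le_mul (by rwa [abs_of_nonneg (sq_nonneg _)]) hnF
    have e1 : (κ * x / s) ^ 2 * (κ * s) = κ ^ 3 * x ^ 2 / s := by field_simp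
    have e2 : κ * x / s * (κ * x) ≤ κ ^ 3 * x ^ 2 / s := by
      rw [show κ * x / s * (κ * x) = κ ^ 2 * x ^ 2 / s by ring]
      have := hpow (show 2 ≤ 3 by norm_num)
      gcongr
    have e3 : 3 * κ ^ 3 * x ^ 2 / s = 3 * (κ ^ 3 * x ^ 2 / s) := by ring
    have := neg_abs_le (τ' * (l ⬝ᵥ n))
    have := neg_abs_le (τ' ^ 2 * (euclNorm n ^ 2 - F))
    rw [e0]
    linarith
  -- A lower bound is enough, so the square of the remainder is dropped and Cauchy–Schwarz bounds
  -- the cross term.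
  have hfin : euclNorm (l + τ' • n) ^ 2 - 2 * (2 * κ ^ 2 * x * (22 * κ ^ 5 * x / s)) ≤
      euclNorm (l + τ' • n + (d₂ • n - d₁ • b)) ^ 2 := by
    set Y := l + τ' • n
    set R := d₂ • n - d₁ • b
    have e0 : euclNorm (Y + R) ^ 2 = euclNorm Y ^ 2 + 2 * (Y ⬝ᵥ R) + euclNorm R ^ 2 := by
      rw [euclNorm_sq, euclNorm_sq, euclNorm_sq, add_dotProduct Y R, dotProduct_add Y Y R,
        dotProduct_add R Y R, dotProduct_comm R Y]; ring
    have b1 := abs_dotProduct_le_euclNorm_mul Y R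
    have b2 := mul_le_mul hY hrem (euclNorm_nonneg _) ((euclNorm_nonneg _).trans hY)
    have := neg_abs_le (Y ⬝ᵥ R)
    nlinarith [sq_nonneg (euclNorm R)]
  have e1 : 2 * (2 * κ ^ 2 * x * (22 * κ ^ 5 * x / s)) = 88 * κ ^ 7 / s * x ^ 2 := by ring
  have e2 : 3 * κ ^ 3 * x ^ 2 / s ≤ 3 * κ ^ 7 / s * x ^ 2 := by
    rw [show 3 * κ ^ 7 / s * x ^ 2 = 3 * κ ^ 7 * x ^ 2 / s by ring]
    have := hpow (show 3 ≤ 7 by norm_num)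
    gcongr
  have e3 : 91 * κ ^ 7 / s * x ^ 2 = 88 * κ ^ 7 / s * x ^ 2 + 3 * κ ^ 7 / s * x ^ 2 := by ring
  linarith

/-- The error of the linear-quadratic approximation to the estimator. -/
lemma perturbed_linear_form {κ s x bz g d₁ d₂ : ℝ} (hκ : 1 ≤ κ) (hs : 8 * κ ^ 2 ≤ s) (hx : 0 ≤ x)
    (hbz : |bz| ≤ κ / s) (hg : |g| ≤ κ * s)
    (hd₁ : |d₁| ≤ 12 * κ ^ 3 * x) (hd₂ : |d₂| ≤ 10 * κ ^ 4 * x / s ^ 2) :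
    |d₂ * g - d₁ * bz| ≤ 22 * κ ^ 5 * x / s := by
  have hs0 : 0 < s := by nlinarith
  have b1 := abs_mul_le_mul hd₂ hg
  have b2 := abs_mul_le_mul hd₁ hbz
  have e1 : 10 * κ ^ 4 * x / s ^ 2 * (κ * s) = 10 * κ ^ 5 * x / s := by field_simp
  have e2 : 12 * κ ^ 3 * x * (κ / s) ≤ 12 * κ ^ 5 * x / s := by
    rw [show 12 * κ ^ 3 * x * (κ / s) = 12 * κ ^ 4 * x / s by ring]
    have : κ ^ 4 ≤ κ ^ 5 := pow_le_pow_right₀ hκ (by norm_num)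
    gcongr
  have e3 : 22 * κ ^ 5 * x / s = 10 * κ ^ 5 * x / s + 12 * κ ^ 5 * x / s := by ring
  have := abs_sub (d₂ * g) (d₁ * bz)
  linarith

end Perturbation

/-! ### Measurability of matrix operations and of the estimators. -/

section Measurability

variable {Ω : Type*} [MeasurableSpace Ω] {m k l : ℕ}

lemma measurable_matrix_iff {f : Ω → Matrix (Fin m) (Fin k) ℝ} :
    Measurable f ↔ ∀ i j, Measurable fun ω => f ω i j := by
  constructor
  · intro h i j
    exact (measurable_pi_apply j).comp ((measurable_pi_apply i).comp h)
  · intro h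
    exact measurable_pi_lambda _ fun i => measurable_pi_lambda _ fun j => h i j

lemma Measurable.matrix_entry {f : Ω → Matrix (Fin m) (Fin k) ℝ} (hf : Measurable f) (i : Fin m)
    (j : Fin k) : Measurable fun ω => f ω i j :=
  measurable_matrix_iff.1 hf i j

@[fun_prop]
lemma Measurable.matrix_mul {f : Ω → Matrix (Fin m) (Fin k) ℝ} {g : Ω → Matrix (Fin k) (Fin l) ℝ}
    (hf : Measurable f) (hg : Measurable g) : Measurable fun ω => f ω * g ω := by
  refine measurable_matrix_iff.2 fun i j => ?_
  simp only [Matrix.mul_apply]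
  exact Finset.measurable_sum _ fun a _ => (hf.matrix_entry i a).mul (hg.matrix_entry a j)

@[fun_prop]
lemma Measurable.matrix_sub {f g : Ω → Matrix (Fin m) (Fin k) ℝ}
    (hf : Measurable f) (hg : Measurable g) : Measurable fun ω => f ω - g ω :=
  measurable_matrix_iff.2 fun i j => (hf.matrix_entry i j).sub (hg.matrix_entry i j)

@[fun_prop]
lemma Measurable.matrix_transpose {f : Ω → Matrix (Fin m) (Fin k) ℝ}
    (hf : Measurable f) : Measurable fun ω => (f ω)ᵀ :=
  measurable_matrix_iff.2 fun i j => hf.matrix_entry j i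

lemma Measurable.matrix_det {f : Ω → Matrix (Fin m) (Fin m) ℝ}
    (hf : Measurable f) : Measurable fun ω => (f ω).det := by
  simp only [Matrix.det_apply]
  refine Finset.measurable_sum _ fun σ _ => ?_
  exact (Finset.measurable_prod _ fun i _ => hf.matrix_entry _ _).const_smul _

-- Cramer's rule: each entry is a determinant divided by a determinant. Singular matrices need no
-- separate treatment, since real inversion with 0⁻¹ = 0 is measurable.
@[fun_prop]
lemma Measurable.matrix_inv {f : Ω → Matrix (Fin m) (Fin m) ℝ}
    (hf : Measurable f) : Measurable fun ω => (f ω)⁻¹ := by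
  refine measurable_matrix_iff.2 fun i j => ?_
  simp only [Matrix.inv_def, Ring.inverse_eq_inv', Matrix.smul_apply, smul_eq_mul,
    Matrix.adjugate_apply]
  refine hf.matrix_det.inv.mul (Measurable.matrix_det (measurable_matrix_iff.2 fun a b => ?_))
  by_cases h : a = j
  · simp [Matrix.updateRow_apply, h]
  · simpa [Matrix.updateRow_apply, h] using hf.matrix_entry a b

@[fun_prop]
lemma Measurable.matrix_trace {f : Ω → Matrix (Fin m) (Fin m) ℝ}
    (hf : Measurable f) : Measurable fun ω => (f ω).trace :=
  Finset.measurable_sum _ fun i _ => hf.matrix_entry i i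

@[fun_prop]
lemma Measurable.matrix_mulVec {f : Ω → Matrix (Fin m) (Fin k) ℝ} {g : Ω → Fin k → ℝ}
    (hf : Measurable f) (hg : Measurable g) : Measurable fun ω => f ω *ᵥ g ω := by
  refine measurable_pi_lambda _ fun i => ?_
  simp only [Matrix.mulVec, dotProduct]
  exact Finset.measurable_sum _ fun j _ =>
    (hf.matrix_entry i j).mul ((measurable_pi_apply j).comp hg)

@[fun_prop]
lemma Measurable.matrix_vecMul {f : Ω → Matrix (Fin m) (Fin k) ℝ} {g : Ω → Fin m → ℝ}
    (hf : Measurable f) (hg : Measurable g) : Measurable fun ω => g ω ᵥ* f ω := by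
  simpa only [Matrix.mulVec_transpose] using hf.matrix_transpose.matrix_mulVec hg

@[fun_prop]
lemma Measurable.dotProduct_fin {f g : Ω → Fin m → ℝ}
    (hf : Measurable f) (hg : Measurable g) : Measurable fun ω => f ω ⬝ᵥ g ω :=
  Finset.measurable_sum _ fun j _ =>
    ((measurable_pi_apply j).comp hf).mul ((measurable_pi_apply j).comp hg)

@[fun_prop]
lemma Measurable.euclNorm {f : Ω → Fin m → ℝ} (hf : Measurable f) :
    Measurable fun ω => euclNorm (f ω) := by
  have h : (fun ω => FeedbackIV.euclNorm (f ω)) = fun ω => √(f ω ⬝ᵥ f ω) := by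
    ext ω; rw [← euclNorm_sq, Real.sqrt_sq (euclNorm_nonneg _)]
  rw [h]
  exact (hf.dotProduct_fin hf).sqrt

variable {T K : ℕ}

@[fun_prop]
lemma Measurable.ivWeights {X : Ω → Matrix (Fin T) (Fin K) ℝ} {Γ : Ω → Matrix (Fin T) (Fin T) ℝ}
    (hX : Measurable X) (hΓ : Measurable Γ) : Measurable fun ω => ivWeights (X ω) (Γ ω) := by
  unfold FeedbackIV.ivWeights; fun_prop

@[fun_prop]
lemma Measurable.obliqueProj {X : Ω → Matrix (Fin T) (Fin K) ℝ}
    {Γ : Ω → Matrix (Fin T) (Fin T) ℝ}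
    (hX : Measurable X) (hΓ : Measurable Γ) : Measurable fun ω => obliqueProj (X ω) (Γ ω) := by
  unfold FeedbackIV.obliqueProj; fun_prop

@[fun_prop]
lemma Measurable.feedbackForm {X : Ω → Matrix (Fin T) (Fin K) ℝ}
    {Γ : Ω → Matrix (Fin T) (Fin T) ℝ}
    (hX : Measurable X) (hΓ : Measurable Γ) : Measurable fun ω => feedbackForm (X ω) (Γ ω) := by
  unfold FeedbackIV.feedbackForm; fun_prop

@[fun_prop]
lemma Measurable.betaIV {X : Ω → Matrix (Fin T) (Fin K) ℝ} {y : Ω → Fin T → ℝ}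
    {Γ : Ω → Matrix (Fin T) (Fin T) ℝ}
    (hX : Measurable X) (hy : Measurable y) (hΓ : Measurable Γ) :
    Measurable fun ω => betaIV (X ω) (y ω) (Γ ω) := by
  unfold FeedbackIV.betaIV; fun_prop

@[fun_prop]
lemma Measurable.varianceBound {Xs X : Ω → Matrix (Fin T) (Fin K) ℝ} {y : Ω → Fin T → ℝ}
    {Γ : Ω → Matrix (Fin T) (Fin T) ℝ} (r : Fin K → ℝ) (hXs : Measurable Xs)
    (hX : Measurable X) (hy : Measurable y) (hΓ : Measurable Γ) :
    Measurable fun ω => varianceBound (Xs ω) (X ω) (y ω) (Γ ω) r := by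
  unfold FeedbackIV.varianceBound FeedbackIV.psi FeedbackIV.sigmaHatSq
  have habs : Measurable fun x : ℝ => |x| := continuous_abs.measurable
  refine Measurable.mul (Measurable.mul (measurable_const.add (Measurable.div ?_ ?_)) ?_) ?_
  · exact habs.comp (by fun_prop)
  all_goals fun_prop

@[fun_prop]
lemma Measurable.regressors {Xs : Ω → Matrix (Fin T) (Fin K) ℝ} (α : Fin K → ℝ)
    {e : Ω → Fin (T + 1) → ℝ} (hXs : Measurable Xs) (he : Measurable e) :
    Measurable fun ω => regressors (Xs ω) α (e ω) :=
  measurable_matrix_iff.2 fun i j =>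
    (hXs.matrix_entry i j).add (((measurable_pi_apply _).comp he).const_mul _)

@[fun_prop]
lemma Measurable.outcomes {Xs : Ω → Matrix (Fin T) (Fin K) ℝ} (α β : Fin K → ℝ)
    {e : Ω → Fin (T + 1) → ℝ} (hXs : Measurable Xs) (he : Measurable e) :
    Measurable fun ω => outcomes (Xs ω) α β (e ω) := by
  refine measurable_pi_lambda _ fun i => Measurable.add ?_ ((measurable_pi_apply _).comp he)
  exact (measurable_pi_apply i).comp ((hXs.regressors α he).matrix_mulVec measurable_const)

end Measurability

/-! ### Lagged and current errors as windows of one Gaussian vector. -/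

section Selection

variable {T : ℕ}

/-- The matrix that selects the coordinates `f 0, …, f (T - 1)`. -/
def selectionMatrix (f : Fin T → Fin (T + 1)) : Matrix (Fin T) (Fin (T + 1)) ℝ :=
  (1 : Matrix (Fin (T + 1)) (Fin (T + 1)) ℝ).submatrix f id

lemma selectionMatrix_mulVec (f : Fin T → Fin (T + 1)) (e : Fin (T + 1) → ℝ) :
    selectionMatrix f *ᵥ e = fun i => e (f i) := by
  ext i
  simp [selectionMatrix, Matrix.mulVec, dotProduct, Matrix.one_apply]

lemma selectionMatrix_mul_transpose (f : Fin T → Fin (T + 1)) (hf : Function.Injective f) :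
    selectionMatrix f * (selectionMatrix f)ᵀ = 1 := by
  ext i j
  simp [selectionMatrix, Matrix.mul_apply, Matrix.one_apply, hf.eq_iff, eq_comm]

/-- The windows 0,…,T-1 and 1,…,T overlap with a shift of one. This is how the lag matrix, and with
it the trace condition on Γ, enters the mean of u'Nz. -/
lemma selectionMatrix_castSucc_mul_succ_transpose :
    selectionMatrix (@Fin.castSucc T) * (selectionMatrix (@Fin.succ T))ᵀ = lagMatrix T := by
  ext i j
  have h : (i : ℕ) = j + 1 ↔ i.castSucc = j.succ := by simp [Fin.ext_iff]
  simp [selectionMatrix, Matrix.mul_apply, Matrix.one_apply, lagMatrix, h, eq_comm]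

lemma dotProduct_select (f : Fin T → Fin (T + 1)) (a : Fin T → ℝ) (e : Fin (T + 1) → ℝ) :
    (a ⬝ᵥ fun i => e (f i)) = (a ᵥ* selectionMatrix f) ⬝ᵥ e := by
  rw [← selectionMatrix_mulVec, Matrix.dotProduct_mulVec]

lemma vecMul_selectionMatrix_dotProduct_self (f : Fin T → Fin (T + 1))
    (hf : Function.Injective f) (a : Fin T → ℝ) :
    (a ᵥ* selectionMatrix f) ⬝ᵥ (a ᵥ* selectionMatrix f) = a ⬝ᵥ a := by
  rw [← Matrix.mulVec_transpose, Matrix.dotProduct_mulVec, Matrix.vecMul_transpose,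
    Matrix.mulVec_mulVec, selectionMatrix_mul_transpose f hf, Matrix.one_mulVec]

/-- Makes a bilinear form in two dependent windows into a quadratic form in the independent errors e
0,…,e T, to which the Gaussian results apply. -/
lemma quadratic_select (f g : Fin T → Fin (T + 1)) (N : Matrix (Fin T) (Fin T) ℝ)
    (e : Fin (T + 1) → ℝ) :
    (fun i => e (f i)) ⬝ᵥ N *ᵥ (fun i => e (g i)) =
      e ⬝ᵥ ((selectionMatrix f)ᵀ * N * selectionMatrix g) *ᵥ e := by
  rw [← selectionMatrix_mulVec, ← selectionMatrix_mulVec, Matrix.mul_assoc,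
    ← Matrix.mulVec_mulVec, ← Matrix.mulVec_mulVec, Matrix.dotProduct_mulVec e,
    Matrix.vecMul_transpose]

lemma trace_select (f g : Fin T → Fin (T + 1)) (N : Matrix (Fin T) (Fin T) ℝ) :
    ((selectionMatrix f)ᵀ * N * selectionMatrix g).trace =
      ((selectionMatrix f * (selectionMatrix g)ᵀ)ᵀ * N).trace := by
  rw [Matrix.trace_mul_comm, ← Matrix.mul_assoc, Matrix.transpose_mul,
    Matrix.transpose_transpose]

lemma trace_transpose_mul_select (f g : Fin T → Fin (T + 1)) (hf : Function.Injective f)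
    (hg : Function.Injective g) (N : Matrix (Fin T) (Fin T) ℝ) :
    (((selectionMatrix f)ᵀ * N * selectionMatrix g)ᵀ *
      ((selectionMatrix f)ᵀ * N * selectionMatrix g)).trace = (Nᵀ * N).trace := by
  have h1 : ((selectionMatrix f)ᵀ * N * selectionMatrix g)ᵀ *
      ((selectionMatrix f)ᵀ * N * selectionMatrix g) =
      (selectionMatrix g)ᵀ * (Nᵀ * ((selectionMatrix f * (selectionMatrix f)ᵀ) * N) *
        selectionMatrix g) := by
    simp only [Matrix.transpose_mul, Matrix.transpose_transpose, Matrix.mul_assoc]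
  rw [h1, selectionMatrix_mul_transpose f hf, Matrix.one_mul, Matrix.trace_mul_comm,
    Matrix.mul_assoc, selectionMatrix_mul_transpose g hg, Matrix.mul_one]

/-- The dependence between u and z appears here: the Frobenius norm of the lifted form is that of N,
but the trace of its square is that of (D'N)². -/
lemma trace_mul_self_select (N : Matrix (Fin T) (Fin T) ℝ) :
    (((selectionMatrix (@Fin.castSucc T))ᵀ * N * selectionMatrix (@Fin.succ T)) *
      ((selectionMatrix (@Fin.castSucc T))ᵀ * N * selectionMatrix (@Fin.succ T))).trace =
      (((lagMatrix T)ᵀ * N) * ((lagMatrix T)ᵀ * N)).trace := by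
  have hD : selectionMatrix (@Fin.succ T) * (selectionMatrix (@Fin.castSucc T))ᵀ =
      (lagMatrix T)ᵀ := by
    rw [← selectionMatrix_castSucc_mul_succ_transpose, Matrix.transpose_mul,
      Matrix.transpose_transpose]
  have h1 : ((selectionMatrix (@Fin.castSucc T))ᵀ * N * selectionMatrix (@Fin.succ T)) *
      ((selectionMatrix (@Fin.castSucc T))ᵀ * N * selectionMatrix (@Fin.succ T)) =
      (selectionMatrix (@Fin.castSucc T))ᵀ * (N * ((selectionMatrix (@Fin.succ T) *
        (selectionMatrix (@Fin.castSucc T))ᵀ) * N) * selectionMatrix (@Fin.succ T)) := by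
    simp only [Matrix.mul_assoc]
  rw [h1, Matrix.trace_mul_comm, Matrix.mul_assoc, hD, Matrix.trace_mul_comm,
    ← Matrix.mul_assoc, ← Matrix.mul_assoc]

/-- D' shifts a vector by one period and discards a coordinate, hence does not increase its norm;
apply this to each column of N. -/
lemma trace_transpose_mul_lag_le (N : Matrix (Fin T) (Fin T) ℝ) :
    (((lagMatrix T)ᵀ * N)ᵀ * ((lagMatrix T)ᵀ * N)).trace ≤ (Nᵀ * N).trace := by
  rw [trace_transpose_mul_self_eq, trace_transpose_mul_self_eq]
  refine Finset.sum_le_sum fun i _ => ?_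
  rw [← Matrix.mulVec_mulVec]
  set y := N *ᵥ Pi.single i 1
  have hD : (lagMatrix T)ᵀ *ᵥ y =
      selectionMatrix (@Fin.succ T) *ᵥ (y ᵥ* selectionMatrix (@Fin.castSucc T)) := by
    rw [← selectionMatrix_castSucc_mul_succ_transpose, Matrix.transpose_mul,
      Matrix.transpose_transpose, ← Matrix.mulVec_mulVec, Matrix.mulVec_transpose]
  rw [euclNorm_sq, euclNorm_sq, hD, ← vecMul_selectionMatrix_dotProduct_self Fin.castSucc
    (Fin.castSucc_injective T) y, selectionMatrix_mulVec]
  generalize y ᵥ* selectionMatrix (@Fin.castSucc T) = w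
  simp only [dotProduct]
  rw [Fin.sum_univ_succ (fun i => w i * w i)]
  linarith [mul_self_nonneg (w 0)]

lemma pi_gaussianReal_linear_select_tail (v : ℝ≥0) (f : Fin T → Fin (T + 1))
    (hf : Function.Injective f) (a : Fin T → ℝ) (κ R : ℝ) (hκ : 0 < κ) (hR : 0 < R)
    (h : v * euclNorm a ^ 2 ≤ κ ^ 2) :
    (Measure.pi fun _ : Fin (T + 1) => gaussianReal 0 v) {e | R * κ < |a ⬝ᵥ fun i => e (f i)|} ≤
      ENNReal.ofReal (1 / R ^ 2) := by
  simp_rw [dotProduct_select]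
  refine pi_gaussianReal_linear_tail v _ κ R hκ hR ?_
  rwa [vecMul_selectionMatrix_dotProduct_self f hf, ← euclNorm_sq]

lemma pi_gaussianReal_quadratic_select_tail (v : ℝ≥0) (hv : v ≠ 0) (f g : Fin T → Fin (T + 1))
    (hf : Function.Injective f) (hg : Function.Injective g) (N : Matrix (Fin T) (Fin T) ℝ)
    (κ R : ℝ) (hκ : 0 < κ) (hR : 0 < R) (h : 96 * v ^ 2 * (Nᵀ * N).trace ≤ κ ^ 2) :
    (Measure.pi fun _ : Fin (T + 1) => gaussianReal 0 v)
        {e | R * κ < |(fun i => e (f i)) ⬝ᵥ N *ᵥ (fun i => e (g i)) -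
          v * ((selectionMatrix f * (selectionMatrix g)ᵀ)ᵀ * N).trace|} ≤
      ENNReal.ofReal (1 / R ^ 2) := by
  simp_rw [quadratic_select, ← trace_select]
  refine pi_gaussianReal_quadratic_tail v hv _ κ R hκ hR ?_
  rwa [trace_transpose_mul_select f g hf hg]

end Selection

/-! ### Limits of the coefficients, and an event of high probability. -/

section Limits

variable {T K : ℕ}

/-- The limiting weight of the quadratic part of the estimation error. -/
noncomputable def limitSlope (X : Matrix (Fin T) (Fin K) ℝ) (Γ : Matrix (Fin T) (Fin T) ℝ)
    (α r : Fin K → ℝ) (v : ℝ) : ℝ :=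
  (r ⬝ᵥ (Xᵀ * (1 - Γ) * X)⁻¹ *ᵥ α) /
    (1 + v * ((1 - Γ) * obliqueProj X Γ).trace * (α ⬝ᵥ (Xᵀ * (1 - Γ) * X)⁻¹ *ᵥ α))

/-- The limiting weights of the linear part of the estimation error. -/
noncomputable def limitContrast (X : Matrix (Fin T) (Fin K) ℝ) (Γ : Matrix (Fin T) (Fin T) ℝ)
    (α r : Fin K → ℝ) (v : ℝ) : Fin T → ℝ :=
  r ᵥ* ivWeights X Γ -
    (limitSlope X Γ α r v * (v * ((1 - Γ) * obliqueProj X Γ).trace)) • (α ᵥ* ivWeights X Γ)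

/-- The conditional variance of the linear-quadratic approximation to the estimation error. -/
noncomputable def limitVariance (X : Matrix (Fin T) (Fin K) ℝ) (Γ : Matrix (Fin T) (Fin T) ℝ)
    (α r : Fin K → ℝ) (v : ℝ) : ℝ :=
  v * euclNorm (limitContrast X Γ α r v) ^ 2 +
    limitSlope X Γ α r v ^ 2 * v ^ 2 * ((feedbackForm X Γ * feedbackForm X Γ).trace +
      (((1 - Γ) * obliqueProj X Γ)ᵀ * ((1 - Γ) * obliqueProj X Γ)).trace)

lemma feedbackForm_eq (X : Matrix (Fin T) (Fin K) ℝ) (Γ : Matrix (Fin T) (Fin T) ℝ) :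
    feedbackForm X Γ = (lagMatrix T)ᵀ * ((1 - Γ) * obliqueProj X Γ) := by
  rw [feedbackForm, Matrix.mul_assoc]

/-- The sum is twice the sum of squared eigenvalues of the symmetrized form u'Nz. -/
lemma feedback_variance_nonneg (X : Matrix (Fin T) (Fin K) ℝ) (Γ : Matrix (Fin T) (Fin T) ℝ) :
    0 ≤ (feedbackForm X Γ * feedbackForm X Γ).trace +
      (((1 - Γ) * obliqueProj X Γ)ᵀ * ((1 - Γ) * obliqueProj X Γ)).trace := by
  obtain ⟨U, μ, -, -, -, -, h⟩ := exists_rotation_quadraticForm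
    ((selectionMatrix (@Fin.castSucc T))ᵀ * ((1 - Γ) * obliqueProj X Γ) *
      selectionMatrix (@Fin.succ T))
  rw [trace_mul_self_select, trace_transpose_mul_select _ _ (Fin.castSucc_injective T)
    (Fin.succ_injective T), ← feedbackForm_eq] at h
  have : 0 ≤ ∑ j, μ j ^ 2 := Finset.sum_nonneg fun j _ => sq_nonneg _
  linarith

lemma psi_nonneg (X : Matrix (Fin T) (Fin K) ℝ) (Γ : Matrix (Fin T) (Fin T) ℝ) : 0 ≤ psi X Γ :=
  div_nonneg (abs_nonneg _) (trace_transpose_mul_self_nonneg _)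

lemma trace_feedbackForm_sq_le (X : Matrix (Fin T) (Fin K) ℝ) (Γ : Matrix (Fin T) (Fin T) ℝ) :
    (feedbackForm X Γ * feedbackForm X Γ).trace ≤ psi X Γ *
      (((1 - Γ) * obliqueProj X Γ)ᵀ * ((1 - Γ) * obliqueProj X Γ)).trace := by
  have h1 := trace_transpose_mul_lag_le ((1 - Γ) * obliqueProj X Γ)
  rw [← feedbackForm_eq] at h1
  have h2 := trace_mul_self_le_trace_transpose_mul (feedbackForm X Γ)
  have h0 := trace_transpose_mul_self_nonneg (feedbackForm X Γ)
  rcases le_or_gt (feedbackForm X Γ * feedbackForm X Γ).trace 0 with h | h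
  · exact h.trans (mul_nonneg (psi_nonneg X Γ) (h0.trans h1))
  -- Here the denominator of ψ is positive, so the quotient is genuine; in the other case the sign
  -- alone suffices.
  · have h3 : 0 < ((feedbackForm X Γ)ᵀ * feedbackForm X Γ).trace := h.trans_le h2
    calc (feedbackForm X Γ * feedbackForm X Γ).trace
        = psi X Γ * ((feedbackForm X Γ)ᵀ * feedbackForm X Γ).trace := by
          rw [psi, abs_of_pos h]; field_simp
      _ ≤ _ := mul_le_mul_of_nonneg_left h1 (psi_nonneg X Γ)

/-- A realization of the design, of the transformation and of the error variance that satisfies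
the regularity conditions, with the feedback vector written as `X'a`. -/
structure RegularDesign (c C M : ℝ) (X : Matrix (Fin T) (Fin K) ℝ)
    (Γ : Matrix (Fin T) (Fin T) ℝ) (α r : Fin K → ℝ) (a : Fin T → ℝ) (v : ℝ≥0) : Prop where
  c_pos : 0 < c
  C_ge : 1 ≤ C
  M_ge : 1 ≤ M
  opNorm_lt : opNorm Γ < 1 - c
  rank_eq : X.rank = K
  dim_lt : (K : ℝ) < (1 - c) * T
  feedback_eq : α = Xᵀ *ᵥ a
  norm_le : euclNorm a ≤ M / √T
  lt_var : c < v
  var_lt : (v : ℝ) < C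
  trace_eq : (feedbackForm X Γ).trace = 0
  contrast_ne : r ≠ 0

namespace RegularDesign

variable {c C M : ℝ} {X : Matrix (Fin T) (Fin K) ℝ} {Γ : Matrix (Fin T) (Fin T) ℝ}
  {α r : Fin K → ℝ} {a : Fin T → ℝ} {v : ℝ≥0}

lemma c_lt_one (D : RegularDesign c C M X Γ α r a v) : c < 1 := by
  have := opNorm_nonneg Γ
  have := D.opNorm_lt
  linarith

lemma T_pos (D : RegularDesign c C M X Γ α r a v) : (0 : ℝ) < T := by
  have h1 := D.dim_lt
  have h2 := D.c_lt_one
  have : (0 : ℝ) ≤ K := by positivity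
  by_contra h
  have h3 : (T : ℝ) = 0 := le_antisymm (not_lt.1 h) (by positivity)
  rw [h3] at h1
  linarith

lemma isUnit_det (D : RegularDesign c C M X Γ α r a v) : IsUnit (Xᵀ * (1 - Γ) * X).det :=
  isUnit_det_normal D.c_pos D.opNorm_lt D.rank_eq

lemma var_ne (D : RegularDesign c C M X Γ α r a v) : v ≠ 0 := by
  have : (0 : ℝ) < v := D.c_pos.trans D.lt_var
  exact_mod_cast this.ne'

lemma le_trace (D : RegularDesign c C M X Γ α r a v) :
    c ^ 2 * T ≤ ((1 - Γ) * obliqueProj X Γ).trace :=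
  le_trace_residualForm D.c_pos D.opNorm_lt D.rank_eq D.dim_lt

lemma limit_mean_nonneg (D : RegularDesign c C M X Γ α r a v) :
    0 ≤ v * ((1 - Γ) * obliqueProj X Γ).trace :=
  mul_nonneg v.2 ((by positivity : (0 : ℝ) ≤ c ^ 2 * T).trans D.le_trace)

lemma opNorm_le (D : RegularDesign c C M X Γ α r a v) :
    opNorm ((1 - Γ) * obliqueProj X Γ) ≤ 6 / c :=
  opNorm_residualForm_le D.c_pos D.opNorm_lt D.rank_eq

lemma feedback_size_nonneg (D : RegularDesign c C M X Γ α r a v) :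
    0 ≤ α ⬝ᵥ (Xᵀ * (1 - Γ) * X)⁻¹ *ᵥ α := by
  rw [D.feedback_eq]
  exact (inv_normal_quadratic_bounds D.c_pos D.opNorm_lt D.rank_eq).1

lemma feedback_size_le (D : RegularDesign c C M X Γ α r a v) :
    α ⬝ᵥ (Xᵀ * (1 - Γ) * X)⁻¹ *ᵥ α ≤ M ^ 2 / c / √T ^ 2 := by
  have hc := D.c_pos
  rw [D.feedback_eq]
  refine (inv_normal_quadratic_bounds D.c_pos D.opNorm_lt D.rank_eq).2.trans ?_
  rw [div_right_comm, ← div_pow]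
  have := pow_le_pow_left₀ (euclNorm_nonneg a) D.norm_le 2
  gcongr

lemma limit_scale_pos (D : RegularDesign c C M X Γ α r a v) :
    0 < 1 + v * ((1 - Γ) * obliqueProj X Γ).trace * (α ⬝ᵥ (Xᵀ * (1 - Γ) * X)⁻¹ *ᵥ α) := by
  have := mul_nonneg D.limit_mean_nonneg D.feedback_size_nonneg
  linarith

/-- The weights are w' = (r - τ·v tr N·α)'S⁻¹ with τ the limiting slope. Then w'α = r'S⁻¹α - τ·v tr
N·α'S⁻¹α, which is τ again by its definition. One vector thus generates both the linear and the
quadratic part of the error. -/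
lemma exists_limitContrast_eq (D : RegularDesign c C M X Γ α r a v) :
    ∃ w : Fin K → ℝ, limitContrast X Γ α r v = w ᵥ* (Xᵀ * (1 - Γ)) ∧
      w ⬝ᵥ α = limitSlope X Γ α r v ∧ w ≠ 0 := by
  set k := limitSlope X Γ α r v * (v * ((1 - Γ) * obliqueProj X Γ).trace) with hk
  refine ⟨(r - k • α) ᵥ* (Xᵀ * (1 - Γ) * X)⁻¹, ?_, ?_, ?_⟩
  · rw [limitContrast, ← hk, ivWeights, Matrix.vecMul_vecMul, Matrix.sub_vecMul,
      Matrix.smul_vecMul]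
  · rw [← Matrix.dotProduct_mulVec, sub_dotProduct, smul_dotProduct, hk, limitSlope, smul_eq_mul]
    have := D.limit_scale_pos.ne'
    field_simp
    ring
  -- If w vanished, so would the slope w'α, leaving r = 0.
  · intro h
    have h1 : (r - k • α) = 0 := by
      have := congrArg (fun l => l ᵥ* (Xᵀ * (1 - Γ) * X)) h
      simpa [Matrix.vecMul_vecMul, Matrix.nonsing_inv_mul _ D.isUnit_det] using this
    have h2 : limitSlope X Γ α r v = 0 := by
      have h3 : ((r - k • α) ᵥ* (Xᵀ * (1 - Γ) * X)⁻¹) ⬝ᵥ α = limitSlope X Γ α r v := by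
        rw [← Matrix.dotProduct_mulVec, sub_dotProduct, smul_dotProduct, hk, limitSlope,
          smul_eq_mul]
        have := D.limit_scale_pos.ne'
        field_simp
        ring
      rw [← h3, h]; simp
    rw [hk, h2] at h1
    simp at h1
    exact D.contrast_ne h1

lemma limitContrast_pos (D : RegularDesign c C M X Γ α r a v) :
    0 < euclNorm (limitContrast X Γ α r v) := by
  obtain ⟨w, h1, -, h3⟩ := D.exists_limitContrast_eq
  refine (euclNorm_nonneg _).lt_of_ne fun h => h3 ?_
  refine eq_zero_of_vecMul_eq_zero D.c_pos D.opNorm_lt D.rank_eq ?_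
  rw [← h1]; exact euclNorm_eq_zero.1 h.symm

/-- The slope is w'X'a and the contrast is w'X'(I-Γ) for the same w, with |a| ≤ M/√T. The quadratic
part therefore cannot dominate the linear one, whatever the contrast r. -/
lemma abs_limitSlope_le (D : RegularDesign c C M X Γ α r a v) :
    |limitSlope X Γ α r v| ≤ M / c * euclNorm (limitContrast X Γ α r v) / √T := by
  obtain ⟨w, h1, h2, -⟩ := D.exists_limitContrast_eq
  have hc := D.c_pos
  have h := abs_dotProduct_le_euclNorm_vecMul (X := X) (a := a) D.c_pos D.opNorm_lt w
  rw [← D.feedback_eq, h2, ← h1] at h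
  refine h.trans ?_
  have := D.norm_le
  have := euclNorm_nonneg (limitContrast X Γ α r v)
  calc _ ≤ euclNorm (limitContrast X Γ α r v) * (M / √T / c) := by gcongr
    _ = _ := by ring

lemma euclNorm_feedbackWeights_le (D : RegularDesign c C M X Γ α r a v) :
    euclNorm (α ᵥ* ivWeights X Γ) ≤ 2 * M / c / √T := by
  have hc := D.c_pos
  rw [D.feedback_eq]
  refine (euclNorm_vecMul_ivWeights_le D.c_pos D.opNorm_lt D.rank_eq).trans ?_
  have := D.norm_le
  calc _ ≤ 2 * (M / √T / c) := by gcongr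
    _ = _ := by ring

lemma euclNorm_feedbackScores_le (D : RegularDesign c C M X Γ α r a v) :
    euclNorm ((1 - Γ) *ᵥ (X *ᵥ ((Xᵀ * (1 - Γ) * X)⁻¹ *ᵥ α))) ≤ 2 * M / c / √T := by
  have hc := D.c_pos
  rw [D.feedback_eq]
  refine (euclNorm_one_sub_mulVec_inv_normal_le D.c_pos D.opNorm_lt D.rank_eq).trans ?_
  have := D.norm_le
  calc _ ≤ 2 * (M / √T / c) := by gcongr
    _ = _ := by ring

lemma limit_mean_le (D : RegularDesign c C M X Γ α r a v) :
    v * ((1 - Γ) * obliqueProj X Γ).trace ≤ C * (6 / c) * √T ^ 2 := by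
  have hc := D.c_pos
  have hC := D.C_ge
  have h1 := (le_abs_self _).trans (abs_trace_le ((1 - Γ) * obliqueProj X Γ))
  have h2 : opNorm ((1 - Γ) * obliqueProj X Γ) * T ≤ 6 / c * T := by
    have := D.opNorm_le
    gcongr
  have h3 := D.var_lt.le
  rw [Real.sq_sqrt D.T_pos.le, mul_assoc]
  calc (v : ℝ) * ((1 - Γ) * obliqueProj X Γ).trace ≤ v * (6 / c * T) :=
        mul_le_mul_of_nonneg_left (h1.trans h2) v.2
    _ ≤ _ := by gcongr

lemma euclNorm_contrast_le (D : RegularDesign c C M X Γ α r a v) :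
    euclNorm (r ᵥ* ivWeights X Γ) ≤
      (1 + 12 * C * M ^ 2 / c ^ 3) * euclNorm (limitContrast X Γ α r v) := by
  have hc := D.c_pos
  have hC := D.C_ge
  have hM := D.M_ge
  have hs : 0 < √(T : ℝ) := Real.sqrt_pos.2 D.T_pos
  set x := euclNorm (limitContrast X Γ α r v) with hx
  have hx0 : 0 ≤ x := euclNorm_nonneg _
  have h1 : r ᵥ* ivWeights X Γ = limitContrast X Γ α r v +
      (limitSlope X Γ α r v * (v * ((1 - Γ) * obliqueProj X Γ).trace)) •
        (α ᵥ* ivWeights X Γ) := by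
    rw [limitContrast]; abel
  rw [h1]
  refine (euclNorm_add_le _ _).trans ?_
  rw [euclNorm_smul, abs_mul, abs_of_nonneg D.limit_mean_nonneg]
  have h2 : |limitSlope X Γ α r v| * (v * ((1 - Γ) * obliqueProj X Γ).trace) *
      euclNorm (α ᵥ* ivWeights X Γ) ≤
      M / c * x / √T * (C * (6 / c) * √T ^ 2) * (2 * M / c / √T) := by
    refine mul_le_mul (mul_le_mul D.abs_limitSlope_le D.limit_mean_le D.limit_mean_nonneg
      (by positivity)) D.euclNorm_feedbackWeights_le (euclNorm_nonneg _) (by positivity)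
  have h3 : M / c * x / √T * (C * (6 / c) * √T ^ 2) * (2 * M / c / √T) =
      12 * C * M ^ 2 / c ^ 3 * x := by field_simp; ring
  linarith

lemma var_mul_sq_le (D : RegularDesign c C M X Γ α r a v) {x y : ℝ} (hx : 0 ≤ x) (h : x ≤ y) :
    v * x ^ 2 ≤ (C * y) ^ 2 := by
  have h1 := D.var_lt.le
  have h2 := D.C_ge
  have h3 : (v : ℝ) ≤ C ^ 2 := by nlinarith
  rw [mul_pow]
  exact mul_le_mul h3 (pow_le_pow_left₀ hx h 2) (by positivity) (by positivity)

lemma trace_le (D : RegularDesign c C M X Γ α r a v) :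
    (((1 - Γ) * obliqueProj X Γ)ᵀ * ((1 - Γ) * obliqueProj X Γ)).trace ≤ (6 / c) ^ 2 * √T ^ 2 := by
  rw [Real.sq_sqrt D.T_pos.le]
  refine (trace_transpose_mul_self_le _).trans ?_
  have := pow_le_pow_left₀ (opNorm_nonneg _) D.opNorm_le 2
  gcongr

lemma quadratic_size_le (D : RegularDesign c C M X Γ α r a v) {N : Matrix (Fin T) (Fin T) ℝ}
    {y : ℝ} (h : opNorm N ≤ y) :
    96 * (v : ℝ) ^ 2 * (Nᵀ * N).trace ≤ (10 * C * y * √T) ^ 2 := by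
  have h1 := trace_transpose_mul_self_le N
  have h2 := pow_le_pow_left₀ (opNorm_nonneg _) h 2
  have h3 := pow_le_pow_left₀ v.2 D.var_lt.le 2
  have h4 : (Nᵀ * N).trace ≤ y ^ 2 * T := h1.trans (by gcongr)
  have h5 := trace_transpose_mul_self_nonneg N
  rw [mul_pow, mul_pow, mul_pow, Real.sq_sqrt D.T_pos.le]
  -- The factor 10 in the bound covers the variance constant, since 96 ≤ 10².
  have h6 : (v : ℝ) ^ 2 * (Nᵀ * N).trace ≤ C ^ 2 * (y ^ 2 * T) :=
    mul_le_mul h3 h4 h5 (by positivity)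
  have h7 : 0 ≤ C ^ 2 * (y ^ 2 * T) := by positivity
  change (v : ℝ) ^ 2 * (Nᵀ * N).trace ≤ C ^ 2 * (y ^ 2 * T) at h6
  nlinarith

end RegularDesign

/-- The bounds on the errors, with lag `u` and lead `z`, under which the estimator is close to
its linear-quadratic approximation. -/
structure TypicalErrors (X : Matrix (Fin T) (Fin K) ℝ) (Γ : Matrix (Fin T) (Fin T) ℝ)
    (α r : Fin K → ℝ) (v : ℝ≥0) (κ : ℝ) (u z : Fin T → ℝ) : Prop where
  weights_lag : |(α ᵥ* ivWeights X Γ) ⬝ᵥ u| ≤ κ / √T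
  scores_lag : |u ⬝ᵥ (1 - Γ) *ᵥ (X *ᵥ ((Xᵀ * (1 - Γ) * X)⁻¹ *ᵥ α))| ≤ κ / √T
  weights_lead : |(α ᵥ* ivWeights X Γ) ⬝ᵥ z| ≤ κ / √T
  scores_lead : |z ⬝ᵥ (1 - Γ) *ᵥ (X *ᵥ ((Xᵀ * (1 - Γ) * X)⁻¹ *ᵥ α))| ≤ κ / √T
  contrast_lag : |(r ᵥ* ivWeights X Γ) ⬝ᵥ u| ≤ κ * euclNorm (limitContrast X Γ α r v)
  limitContrast_lag : |limitContrast X Γ α r v ⬝ᵥ (u ᵥ* ((1 - Γ) * obliqueProj X Γ))| ≤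
    κ * euclNorm (limitContrast X Γ α r v)
  form_lag : |u ⬝ᵥ ((1 - Γ) * obliqueProj X Γ) *ᵥ u - v * ((1 - Γ) * obliqueProj X Γ).trace| ≤
    κ * √T
  form_lag_lead : |u ⬝ᵥ ((1 - Γ) * obliqueProj X Γ) *ᵥ z| ≤ κ * √T
  form_lead : |z ⬝ᵥ ((1 - Γ) * obliqueProj X Γ) *ᵥ z - v * ((1 - Γ) * obliqueProj X Γ).trace| ≤
    κ * √T
  norm_sq_lag : |euclNorm (u ᵥ* ((1 - Γ) * obliqueProj X Γ)) ^ 2 -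
    v * (((1 - Γ) * obliqueProj X Γ)ᵀ * ((1 - Γ) * obliqueProj X Γ)).trace| ≤ κ * √T
  norm_lag : euclNorm (u ᵥ* ((1 - Γ) * obliqueProj X Γ)) ≤ κ * √T
  form_lead_lag : |z ⬝ᵥ ((1 - Γ) * obliqueProj X Γ) *ᵥ u| ≤ κ * √T ^ 2

lemma measure_not_and_le {Ω : Type*} [MeasurableSpace Ω] {ν : Measure Ω} {p q : Ω → Prop}
    {δ : ℝ≥0∞} (k : ℕ) (hp : ν {e | ¬ p e} ≤ k * δ) (hq : ν {e | ¬ q e} ≤ δ) :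
    ν {e | ¬ (p e ∧ q e)} ≤ (k + 1 : ℕ) * δ := by
  have : {e | ¬ (p e ∧ q e)} = {e | ¬ p e} ∪ {e | ¬ q e} := by
    ext e; simp only [Set.mem_ofPred_eq, Set.mem_union]; tauto
  rw [this]
  refine (measure_union_le _ _).trans ?_
  push_cast
  rw [add_mul, one_mul]
  exact add_le_add hp hq

/-- A bound on all constants in the approximation. -/
noncomputable def typicalBound (c C M R : ℝ) : ℝ :=
  1 + R * (C * (2 * M / c)) + R * (10 * C * (6 / c)) + C * (6 / c) + M ^ 2 / c +
    R * (C * (1 + 12 * C * M ^ 2 / c ^ 3)) + M / c +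
    (C * (6 / c) ^ 2 + R * (10 * C * (6 / c) ^ 2)) + R * (C * (6 / c)) +
    6 / c * (C + R * (10 * C)) + 1 / c ^ 2 + 1 / c

lemma typicalBound_le {c C M R : ℝ} (hc : 0 < c) (hC : 1 ≤ C) (hM : 1 ≤ M) (hR : 1 ≤ R) :
    1 ≤ typicalBound c C M R ∧ R * (C * (2 * M / c)) ≤ typicalBound c C M R ∧
    R * (10 * C * (6 / c)) ≤ typicalBound c C M R ∧ C * (6 / c) ≤ typicalBound c C M R ∧
    M ^ 2 / c ≤ typicalBound c C M R ∧
    R * (C * (1 + 12 * C * M ^ 2 / c ^ 3)) ≤ typicalBound c C M R ∧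
    M / c ≤ typicalBound c C M R ∧
    C * (6 / c) ^ 2 + R * (10 * C * (6 / c) ^ 2) ≤ typicalBound c C M R ∧
    R * (C * (6 / c)) ≤ typicalBound c C M R ∧
    6 / c * (C + R * (10 * C)) ≤ typicalBound c C M R ∧ 1 / c ^ 2 ≤ typicalBound c C M R ∧
    1 / c ≤ typicalBound c C M R := by
  have e1 : 0 ≤ R * (C * (2 * M / c)) := by positivity
  have e2 : 0 ≤ R * (10 * C * (6 / c)) := by positivity
  have e3 : 0 ≤ C * (6 / c) := by positivity
  have e4 : 0 ≤ M ^ 2 / c := by positivity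
  have e5 : 0 ≤ R * (C * (1 + 12 * C * M ^ 2 / c ^ 3)) := by positivity
  have e6 : 0 ≤ M / c := by positivity
  have e7 : 0 ≤ C * (6 / c) ^ 2 + R * (10 * C * (6 / c) ^ 2) := by positivity
  have e8 : 0 ≤ R * (C * (6 / c)) := by positivity
  have e9 : 0 ≤ 6 / c * (C + R * (10 * C)) := by positivity
  have e10 : 0 ≤ 1 / c ^ 2 := by positivity
  have e11 : 0 ≤ 1 / c := by positivity
  unfold typicalBound
  refine ⟨?_, ?_, ?_, ?_, ?_, ?_, ?_, ?_, ?_, ?_, ?_, ?_⟩ <;> linarith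

namespace RegularDesign

variable {c C M : ℝ} {X : Matrix (Fin T) (Fin K) ℝ} {Γ : Matrix (Fin T) (Fin T) ℝ}
  {α r : Fin K → ℝ} {a : Fin T → ℝ} {v : ℝ≥0}

lemma measure_linear_select_le (D : RegularDesign c C M X Γ α r a v)
    (f : Fin T → Fin (T + 1)) (hf : Function.Injective f) (w : Fin T → ℝ) {y κ R : ℝ}
    (hR : 0 < R) (hy : 0 < y) (hw : euclNorm w ≤ y) (hκ : R * (C * y) ≤ κ) :
    (Measure.pi fun _ : Fin (T + 1) => gaussianReal 0 v)
      {e | ¬ |w ⬝ᵥ fun i => e (f i)| ≤ κ} ≤ ENNReal.ofReal (1 / R ^ 2) := by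
  have hC := D.C_ge
  refine (measure_mono fun e he => ?_).trans (pi_gaussianReal_linear_select_tail v f hf w (C * y) R
    (by positivity) hR (D.var_mul_sq_le (euclNorm_nonneg _) hw))
  exact hκ.trans_lt (not_le.1 he)

lemma measure_quadratic_select_le (D : RegularDesign c C M X Γ α r a v)
    (f g : Fin T → Fin (T + 1)) (hf : Function.Injective f) (hg : Function.Injective g)
    (N : Matrix (Fin T) (Fin T) ℝ) {y κ R t : ℝ}
    (hR : 0 < R) (hy : 0 < y) (hN : opNorm N ≤ y) (hκ : R * (10 * C * y) ≤ κ)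
    (ht : ((selectionMatrix f * (selectionMatrix g)ᵀ)ᵀ * N).trace = t) :
    (Measure.pi fun _ : Fin (T + 1) => gaussianReal 0 v)
      {e | ¬ |(fun i => e (f i)) ⬝ᵥ N *ᵥ (fun i => e (g i)) - v * t| ≤ κ * √T} ≤
      ENNReal.ofReal (1 / R ^ 2) := by
  have hC := D.C_ge
  have hs : 0 < √(T : ℝ) := Real.sqrt_pos.2 D.T_pos
  refine (measure_mono fun e he => ?_).trans (pi_gaussianReal_quadratic_select_tail v D.var_ne
    f g hf hg N (10 * C * y * √T) R (by positivity) hR (D.quadratic_size_le hN))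
  rw [Set.mem_ofPred_eq, ht]
  refine lt_of_le_of_lt ?_ (not_le.1 he)
  rw [← mul_assoc]
  exact mul_le_mul_of_nonneg_right hκ hs.le

lemma sqrt_le_sq (D : RegularDesign c C M X Γ α r a v) : √(T : ℝ) ≤ √T ^ 2 := by
  have h' : 0 < T := by exact_mod_cast D.T_pos
  have hT1 : (1 : ℝ) ≤ T := by exact_mod_cast h'
  have := Real.one_le_sqrt.2 hT1
  nlinarith

lemma norm_le_of_sq (D : RegularDesign c C M X Γ α r a v) {κ R : ℝ} {n : Fin T → ℝ} (hκ : 1 ≤ κ)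
    (hR : 0 ≤ R) (hκR : C * (6 / c) ^ 2 + R * (10 * C * (6 / c) ^ 2) ≤ κ)
    (h : |euclNorm n ^ 2 - v * (((1 - Γ) * obliqueProj X Γ)ᵀ *
      ((1 - Γ) * obliqueProj X Γ)).trace| ≤ R * (10 * C * (6 / c) ^ 2) * √T) :
    euclNorm n ≤ κ * √T := by
  have hC := D.C_ge
  have hs1 := D.sqrt_le_sq
  have e1 := (abs_le.1 h).2
  have e2 : v * (((1 - Γ) * obliqueProj X Γ)ᵀ * ((1 - Γ) * obliqueProj X Γ)).trace ≤
      C * ((6 / c) ^ 2 * √T ^ 2) :=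
    mul_le_mul D.var_lt.le D.trace_le (trace_transpose_mul_self_nonneg _) (by linarith)
  have e3 : R * (10 * C * (6 / c) ^ 2) * √T ≤ R * (10 * C * (6 / c) ^ 2) * √T ^ 2 := by gcongr
  have e4 : euclNorm n ^ 2 ≤ (κ * √T) ^ 2 := by
    calc euclNorm n ^ 2 ≤ (C * (6 / c) ^ 2 + R * (10 * C * (6 / c) ^ 2)) * √T ^ 2 := by linarith
      _ ≤ κ * √T ^ 2 := by gcongr
      _ ≤ κ ^ 2 * √T ^ 2 := by
          have : κ ≤ κ ^ 2 := by nlinarith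
          gcongr
      _ = _ := by ring
  exact (pow_le_pow_iff_left₀ (euclNorm_nonneg _) (by positivity) two_ne_zero).1 e4

lemma sq_le_of_form (D : RegularDesign c C M X Γ α r a v) {R : ℝ} {y : Fin T → ℝ} (hR : 0 ≤ R)
    (h : |y ⬝ᵥ (1 : Matrix (Fin T) (Fin T) ℝ) *ᵥ y - v * (1 : Matrix (Fin T) (Fin T) ℝ).trace| ≤
      R * (10 * C) * √T) : euclNorm y ^ 2 ≤ (C + R * (10 * C)) * √T ^ 2 := by
  have hC := D.C_ge
  have hs1 := D.sqrt_le_sq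
  rw [Matrix.one_mulVec, ← euclNorm_sq, Matrix.trace_one, Fintype.card_fin] at h
  have e1 := (abs_le.1 h).2
  have e2 : (v : ℝ) * T ≤ C * √T ^ 2 := by
    rw [Real.sq_sqrt D.T_pos.le]
    have := D.var_lt.le
    gcongr
  have e3 : R * (10 * C) * √T ≤ R * (10 * C) * √T ^ 2 := by gcongr
  linarith

lemma abs_form_le (D : RegularDesign c C M X Γ α r a v) {b : ℝ} {u z : Fin T → ℝ}
    (hu : euclNorm u ^ 2 ≤ b) (hz : euclNorm z ^ 2 ≤ b) :
    |z ⬝ᵥ ((1 - Γ) * obliqueProj X Γ) *ᵥ u| ≤ 6 / c * b := by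
  have hc := D.c_pos
  have hu0 := euclNorm_nonneg u
  have hz0 := euclNorm_nonneg z
  have e3 : euclNorm (((1 - Γ) * obliqueProj X Γ) *ᵥ u) ≤ 6 / c * euclNorm u :=
    (euclNorm_mulVec_le _ u).trans (mul_le_mul_of_nonneg_right D.opNorm_le hu0)
  refine (abs_dotProduct_le_euclNorm_mul z _).trans ?_
  calc _ ≤ euclNorm z * (6 / c * euclNorm u) := by gcongr
    _ = 6 / c * (euclNorm z * euclNorm u) := by ring
    _ ≤ 6 / c * b := by
        have : euclNorm z * euclNorm u ≤ b := by
          nlinarith [sq_nonneg (euclNorm z - euclNorm u)]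
        gcongr

/-- Twelve applications of Chebyshev's inequality and a union bound. The trace condition centres
u'Nz at zero. The reversed form z'Nu need not be centred, so it is only bounded by order T, through
the norms of u and z. -/
lemma measure_not_typicalErrors_le (D : RegularDesign c C M X Γ α r a v) {R : ℝ} (hR : 1 ≤ R) :
    (Measure.pi fun _ : Fin (T + 1) => gaussianReal 0 v)
      {e | ¬ TypicalErrors X Γ α r v (typicalBound c C M R) (fun i => e i.castSucc)
        (fun i => e i.succ)} ≤ 12 * ENNReal.ofReal (1 / R ^ 2) := by
  have hc := D.c_pos
  have hC := D.C_ge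
  have hM := D.M_ge
  have hR0 : 0 < R := by linarith
  have hs : 0 < √(T : ℝ) := Real.sqrt_pos.2 D.T_pos
  obtain ⟨k0, k1, k2, -, -, k5, -, k7, k8, k9, -⟩ := typicalBound_le hc hC hM hR
  set κ := typicalBound c C M R
  set x := euclNorm (limitContrast X Γ α r v) with hx
  have hx0 : 0 < x := D.limitContrast_pos
  set N := (1 - Γ) * obliqueProj X Γ with hN
  have hiu := Fin.castSucc_injective T
  have hiz := Fin.succ_injective T
  have hy1 : 0 < 2 * M / c / √(T : ℝ) := by positivity
  have hb1 : R * (C * (2 * M / c / √T)) ≤ κ / √T := by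
    rw [show R * (C * (2 * M / c / √T)) = R * (C * (2 * M / c)) / √T by ring]
    gcongr
  have hself : ∀ f : Fin T → Fin (T + 1), Function.Injective f → ∀ A : Matrix (Fin T) (Fin T) ℝ,
      ((selectionMatrix f * (selectionMatrix f)ᵀ)ᵀ * A).trace = A.trace := fun f hf A => by
    rw [selectionMatrix_mul_transpose f hf, Matrix.transpose_one, Matrix.one_mul]
  have hlag : ((selectionMatrix (@Fin.castSucc T) * (selectionMatrix (@Fin.succ T))ᵀ)ᵀ *
      N).trace = 0 := by
    rw [selectionMatrix_castSucc_mul_succ_transpose, hN, ← feedbackForm_eq]; exact D.trace_eq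
  have t1 := D.measure_linear_select_le _ hiu _ hR0 hy1 D.euclNorm_feedbackWeights_le hb1
  have t2 := D.measure_linear_select_le _ hiu _ hR0 hy1 D.euclNorm_feedbackScores_le hb1
  have t3 := D.measure_linear_select_le _ hiz _ hR0 hy1 D.euclNorm_feedbackWeights_le hb1
  have t4 := D.measure_linear_select_le _ hiz _ hR0 hy1 D.euclNorm_feedbackScores_le hb1
  have t5 := D.measure_linear_select_le _ hiu _ hR0 (κ := κ * x) (by positivity)
    D.euclNorm_contrast_le (by
      rw [show R * (C * ((1 + 12 * C * M ^ 2 / c ^ 3) * euclNorm (limitContrast X Γ α r v))) =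
        R * (C * (1 + 12 * C * M ^ 2 / c ^ 3)) * x by rw [hx]; ring]
      gcongr)
  have t6 := D.measure_linear_select_le _ hiu (N *ᵥ limitContrast X Γ α r v) hR0 (κ := κ * x)
    (y := 6 / c * x) (by positivity)
    ((euclNorm_mulVec_le _ _).trans (mul_le_mul_of_nonneg_right D.opNorm_le hx0.le)) (by
      rw [show R * (C * (6 / c * x)) = R * (C * (6 / c)) * x by ring]
      gcongr)
  have t7 := D.measure_quadratic_select_le _ _ hiu hiu N hR0 (by positivity) D.opNorm_le k2
    (hself _ hiu N)
  have t8 := D.measure_quadratic_select_le _ _ hiu hiz N hR0 (by positivity) D.opNorm_le k2 hlag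
  have t9 := D.measure_quadratic_select_le _ _ hiz hiz N hR0 (by positivity) D.opNorm_le k2
    (hself _ hiz N)
  have hNN : opNorm (N * Nᵀ) ≤ (6 / c) ^ 2 := by
    refine (opNorm_mul_le _ _).trans ?_
    rw [opNorm_transpose, ← sq]
    exact pow_le_pow_left₀ (opNorm_nonneg _) D.opNorm_le 2
  have t10 := D.measure_quadratic_select_le (κ := R * (10 * C * (6 / c) ^ 2)) _ _ hiu hiu (N * Nᵀ)
    hR0 (by positivity) hNN le_rfl (hself _ hiu _)
  have hone : opNorm (1 : Matrix (Fin T) (Fin T) ℝ) ≤ 1 :=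
    opNorm_le_of_forall zero_le_one fun y => by rw [Matrix.one_mulVec, one_mul]
  have t11 := D.measure_quadratic_select_le (κ := R * (10 * C)) _ _ hiu hiu 1 hR0 one_pos hone
    (by rw [mul_one]) (hself _ hiu _)
  have t12 := D.measure_quadratic_select_le (κ := R * (10 * C)) _ _ hiz hiz 1 hR0 one_pos hone
    (by rw [mul_one]) (hself _ hiz _)
  have t := measure_not_and_le 11 (measure_not_and_le 10 (measure_not_and_le 9
    (measure_not_and_le 8 (measure_not_and_le 7 (measure_not_and_le 6 (measure_not_and_le 5
    (measure_not_and_le 4 (measure_not_and_le 3 (measure_not_and_le 2 (measure_not_and_le 1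
    (by rw [Nat.cast_one, one_mul]; exact t1) t2) t3) t4) t5) t6) t7) t8) t9) t10) t11) t12
  refine le_trans (measure_mono fun e he => ?_) (t.trans (le_of_eq (by norm_num)))
  intro hall
  apply he
  obtain ⟨⟨⟨⟨⟨⟨⟨⟨⟨⟨⟨h1, h2⟩, h3⟩, h4⟩, h5⟩, h6⟩, h7⟩, h8⟩, h9⟩, h10⟩, h11⟩, h12⟩ := hall
  set u : Fin T → ℝ := fun i => e i.castSucc
  set z : Fin T → ℝ := fun i => e i.succ
  -- The squared norm is itself a quadratic form in u, so the tenth tail bound controls it and then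
  -- the norm.
  have hnsq : euclNorm (u ᵥ* N) ^ 2 = u ⬝ᵥ (N * Nᵀ) *ᵥ u := by
    rw [euclNorm_sq, ← Matrix.mulVec_mulVec, Matrix.mulVec_transpose, Matrix.dotProduct_mulVec u]
  have htr : (N * Nᵀ).trace = (Nᵀ * N).trace := Matrix.trace_mul_comm _ _
  rw [← hnsq, htr] at h10
  have h10' : |euclNorm (u ᵥ* N) ^ 2 - v * (Nᵀ * N).trace| ≤ κ * √T := by
    refine h10.trans ?_
    have : 0 ≤ C * (6 / c) ^ 2 := by positivity
    gcongr
    linarith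
  refine ⟨h1, ?_, h3, ?_, h5, ?_, h7, ?_, h9, h10', ?_, ?_⟩
  · rw [dotProduct_comm]; exact h2
  · rw [dotProduct_comm]; exact h4
  · rw [← hN, dotProduct_comm, ← Matrix.dotProduct_mulVec, dotProduct_comm]; exact h6
  · rwa [mul_zero, sub_zero] at h8
  · rw [← hN]
    exact D.norm_le_of_sq k0 hR0.le k7 h10
  · rw [← hN]
    refine (D.abs_form_le (D.sq_le_of_form hR0.le h11) (D.sq_le_of_form hR0.le h12)).trans ?_
    rw [← mul_assoc]
    exact mul_le_mul_of_nonneg_right k9 (sq_nonneg _)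

end RegularDesign

end Limits

/-! ### The estimator and its variance bound on the event of typical errors. -/

section Approximation

variable {T K : ℕ} {c C M R : ℝ} {X : Matrix (Fin T) (Fin K) ℝ} {Γ : Matrix (Fin T) (Fin T) ℝ}
  {α r : Fin K → ℝ} {a : Fin T → ℝ} {v : ℝ≥0}

/-- The linear-quadratic approximation to the estimation error. -/
noncomputable def linearQuadratic (X : Matrix (Fin T) (Fin K) ℝ) (Γ : Matrix (Fin T) (Fin T) ℝ)
    (α r : Fin K → ℝ) (v : ℝ) (e : Fin (T + 1) → ℝ) : ℝ :=
  (limitContrast X Γ α r v ⬝ᵥ fun i => e i.succ) + limitSlope X Γ α r v *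
    ((fun i => e i.castSucc) ⬝ᵥ ((1 - Γ) * obliqueProj X Γ) *ᵥ (fun i => e i.succ))

lemma outcomes_eq (X : Matrix (Fin T) (Fin K) ℝ) (α β : Fin K → ℝ) (e : Fin (T + 1) → ℝ) :
    outcomes X α β e = regressors X α e *ᵥ β + fun i => e i.succ := rfl

lemma limitVariance_ge :
    v * euclNorm (limitContrast X Γ α r v) ^ 2 ≤ limitVariance X Γ α r v := by
  have h := feedback_variance_nonneg X Γ
  have : 0 ≤ limitSlope X Γ α r v ^ 2 * (v : ℝ) ^ 2 * ((feedbackForm X Γ * feedbackForm X Γ).trace +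
      (((1 - Γ) * obliqueProj X Γ)ᵀ * ((1 - Γ) * obliqueProj X Γ)).trace) := by positivity
  rw [limitVariance]
  linarith

/-- The reason for the factor 1 + ψ: it dominates the autocovariance term tr B², which a
homoskedastic variance formula omits. -/
lemma limitVariance_le :
    limitVariance X Γ α r v ≤ (1 + psi X Γ) * (v * (euclNorm (limitContrast X Γ α r v) ^ 2 +
      limitSlope X Γ α r v ^ 2 * (v *
        (((1 - Γ) * obliqueProj X Γ)ᵀ * ((1 - Γ) * obliqueProj X Γ)).trace))) := by
  have h1 := trace_feedbackForm_sq_le X Γ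
  have h2 := psi_nonneg X Γ
  set F := (((1 - Γ) * obliqueProj X Γ)ᵀ * ((1 - Γ) * obliqueProj X Γ)).trace
  have h3 : limitSlope X Γ α r v ^ 2 * (v : ℝ) ^ 2 * ((feedbackForm X Γ * feedbackForm X Γ).trace + F)
      ≤ limitSlope X Γ α r v ^ 2 * (v : ℝ) ^ 2 * ((1 + psi X Γ) * F) := by
    gcongr
    linarith
  have h4 : 0 ≤ psi X Γ * (v * euclNorm (limitContrast X Γ α r v) ^ 2) := by positivity
  rw [limitVariance]
  calc _ ≤ v * euclNorm (limitContrast X Γ α r v) ^ 2 +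
      psi X Γ * (v * euclNorm (limitContrast X Γ α r v) ^ 2) +
        limitSlope X Γ α r v ^ 2 * (v : ℝ) ^ 2 * ((1 + psi X Γ) * F) := by linarith
    _ = _ := by ring

namespace RegularDesign

variable {u z : Fin T → ℝ}

lemma half_le_updateDet (D : RegularDesign c C M X Γ α r a v) (hR : 1 ≤ R)
    (hs : 8 * typicalBound c C M R ^ 2 ≤ √T)
    (Y : TypicalErrors X Γ α r v (typicalBound c C M R) u z) :
    1 / 2 ≤ updateDet X Γ α u := by
  obtain ⟨k0, -, -, -, k4, -⟩ := typicalBound_le D.c_pos D.C_ge D.M_ge hR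
  exact half_le_perturbed_det k0 hs Y.weights_lag Y.scores_lag Y.form_lag D.limit_mean_nonneg
    D.feedback_size_nonneg (D.feedback_size_le.trans (by gcongr))

lemma exists_updated_contrast_eq (D : RegularDesign c C M X Γ α r a v) (hR : 1 ≤ R)
    (hs : 8 * typicalBound c C M R ^ 2 ≤ √T)
    (Y : TypicalErrors X Γ α r v (typicalBound c C M R) u z) :
    ∃ d₁ d₂ : ℝ, |d₁| ≤ 12 * typicalBound c C M R ^ 3 * euclNorm (limitContrast X Γ α r v) ∧
      |d₂| ≤ 10 * typicalBound c C M R ^ 4 * euclNorm (limitContrast X Γ α r v) / √T ^ 2 ∧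
      r ᵥ* ivWeights (X + vecMulVec u α) Γ = limitContrast X Γ α r v +
        limitSlope X Γ α r v • (u ᵥ* ((1 - Γ) * obliqueProj X Γ)) +
        (d₂ • (u ᵥ* ((1 - Γ) * obliqueProj X Γ)) - d₁ • (α ᵥ* ivWeights X Γ)) := by
  obtain ⟨k0, -, -, k3, k4, -, k6, -⟩ := typicalBound_le D.c_pos D.C_ge D.M_ge hR
  have hD := D.half_le_updateDet hR hs Y
  have hD0 : updateDet X Γ α u ≠ 0 := by linarith
  have hslope : |limitSlope X Γ α r v| ≤
      typicalBound c C M R * euclNorm (limitContrast X Γ α r v) / √T := by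
    refine D.abs_limitSlope_le.trans ?_
    have := euclNorm_nonneg (limitContrast X Γ α r v)
    gcongr
  have hmean : v * ((1 - Γ) * obliqueProj X Γ).trace ≤ typicalBound c C M R * √T ^ 2 :=
    D.limit_mean_le.trans (by gcongr)
  have h := perturbed_coefficients k0 hs (euclNorm_nonneg _) Y.weights_lag Y.scores_lag Y.form_lag
    D.limit_mean_nonneg hmean D.feedback_size_nonneg (D.feedback_size_le.trans (by gcongr))
    Y.contrast_lag hslope
  -- The scalar bound is written with τ'(1 + mb·h), which is r'S⁻¹α by the definition of the slope.
  have hτ : limitSlope X Γ α r v * (1 + v * ((1 - Γ) * obliqueProj X Γ).trace *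
      (α ⬝ᵥ (Xᵀ * (1 - Γ) * X)⁻¹ *ᵥ α)) = r ⬝ᵥ (Xᵀ * (1 - Γ) * X)⁻¹ *ᵥ α := by
    rw [limitSlope, div_mul_cancel₀ _ D.limit_scale_pos.ne']
  rw [hτ] at h
  refine ⟨_, _, h.1, h.2, ?_⟩
  rw [vecMul_ivWeights_add_vecMulVec D.isUnit_det hD0, limitContrast, updateDet]
  module

lemma abs_estimator_sub_linearQuadratic_le (D : RegularDesign c C M X Γ α r a v) (hR : 1 ≤ R)
    (hs : 8 * typicalBound c C M R ^ 2 ≤ √T) (β : Fin K → ℝ) {e : Fin (T + 1) → ℝ}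
    (Y : TypicalErrors X Γ α r v (typicalBound c C M R) (fun i => e i.castSucc)
      fun i => e i.succ) :
    |r ⬝ᵥ betaIV (regressors X α e) (outcomes X α β e) Γ - r ⬝ᵥ β -
        linearQuadratic X Γ α r v e| ≤
      22 * typicalBound c C M R ^ 5 * euclNorm (limitContrast X Γ α r v) / √T := by
  obtain ⟨k0, -⟩ := typicalBound_le D.c_pos D.C_ge D.M_ge hR
  have hD := D.half_le_updateDet hR hs Y
  have hD0 : updateDet X Γ α (fun i => e i.castSucc) ≠ 0 := by linarith
  obtain ⟨d₁, d₂, h₁, h₂, h⟩ := D.exists_updated_contrast_eq hR hs Y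
  have hdet := isUnit_det_normal_add_vecMulVec D.isUnit_det hD0
  rw [outcomes_eq, regressors_eq_add_vecMulVec, dotProduct_betaIV_sub hdet, h]
  have hfin := perturbed_linear_form k0 hs (euclNorm_nonneg _) Y.weights_lead Y.form_lag_lead h₁ h₂
  refine le_trans (le_of_eq ?_) hfin
  congr 1
  rw [linearQuadratic, add_dotProduct, add_dotProduct, sub_dotProduct, smul_dotProduct,
    smul_dotProduct, smul_dotProduct, ← Matrix.dotProduct_mulVec]
  simp only [smul_eq_mul]
  ring

lemma limitVariance_pos (D : RegularDesign c C M X Γ α r a v) : 0 < limitVariance X Γ α r v := by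
  have h1 := D.limitContrast_pos
  have h2 : (0 : ℝ) < v := D.c_pos.trans D.lt_var
  exact lt_of_lt_of_le (by positivity) limitVariance_ge

/-- Only a lower bound is needed for conservative inference. The absolute error of order √T becomes
relative because v tr N is at least of order T; this raises the power of the constant from 3 to 5.
-/
lemma le_sigmaHatSq (D : RegularDesign c C M X Γ α r a v) (hR : 1 ≤ R)
    (hs : 8 * typicalBound c C M R ^ 2 ≤ √T) (β : Fin K → ℝ) {e : Fin (T + 1) → ℝ}
    (Y : TypicalErrors X Γ α r v (typicalBound c C M R) (fun i => e i.castSucc)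
      fun i => e i.succ) :
    (1 - 15 * typicalBound c C M R ^ 5 / √T) * v ≤
      sigmaHatSq X (regressors X α e) (outcomes X α β e) Γ := by
  obtain ⟨k0, -, -, k3, k4, -, -, -, -, -, k10, k11⟩ := typicalBound_le D.c_pos D.C_ge D.M_ge hR
  have hc := D.c_pos
  have hD := D.half_le_updateDet hR hs Y
  have hD0 : updateDet X Γ α (fun i => e i.castSucc) ≠ 0 := by linarith
  have hdet := isUnit_det_normal_add_vecMulVec D.isUnit_det hD0
  have hs0 : 0 < √(T : ℝ) := Real.sqrt_pos.2 D.T_pos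
  have hmean : v * ((1 - Γ) * obliqueProj X Γ).trace ≤ typicalBound c C M R * √T ^ 2 :=
    D.limit_mean_le.trans (by gcongr)
  have h := perturbed_residual k0 hs Y.weights_lag Y.scores_lag Y.form_lag
    D.limit_mean_nonneg hmean D.feedback_size_nonneg (D.feedback_size_le.trans (by gcongr))
    Y.weights_lead Y.scores_lead Y.form_lag_lead Y.form_lead Y.form_lead_lag
  set κ := typicalBound c C M R
  have htr : 0 < ((1 - Γ) * obliqueProj X Γ).trace :=
    lt_of_lt_of_le (by have := D.T_pos; positivity) D.le_trace
  rw [sigmaHatSq, outcomes_eq, regressors_eq_add_vecMulVec, residualForm_add_mulVec hdet,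
    dotProduct_updated_residualForm D.isUnit_det hD0, le_div_iff₀ htr]
  refine le_trans ?_ h
  have hκtr : √(T : ℝ) ^ 2 ≤ κ * ((1 - Γ) * obliqueProj X Γ).trace := by
    rw [Real.sq_sqrt D.T_pos.le]
    calc (T : ℝ) = 1 / c ^ 2 * (c ^ 2 * T) := by field_simp
      _ ≤ _ := mul_le_mul k10 D.le_trace (by positivity) (by linarith)
  have hκv : 1 ≤ κ * v := by
    calc (1 : ℝ) = 1 / c * c := by field_simp
      _ ≤ _ := mul_le_mul k11 D.lt_var.le hc.le (by linarith)
  have h1 : √(T : ℝ) ^ 2 ≤ κ ^ 2 * v * ((1 - Γ) * obliqueProj X Γ).trace := by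
    calc √(T : ℝ) ^ 2 = 1 * √(T : ℝ) ^ 2 := by ring
      _ ≤ κ * v * (κ * ((1 - Γ) * obliqueProj X Γ).trace) :=
        mul_le_mul hκv hκtr (by positivity) (by linarith)
      _ = _ := by ring
  have h2 : 15 * κ ^ 3 * √(T : ℝ) ≤
      15 * κ ^ 5 / √T * v * ((1 - Γ) * obliqueProj X Γ).trace := by
    rw [show 15 * κ ^ 5 / √T * v * ((1 - Γ) * obliqueProj X Γ).trace =
      15 * κ ^ 3 * (κ ^ 2 * v * ((1 - Γ) * obliqueProj X Γ).trace) / √T by ring, le_div_iff₀ hs0]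
    calc 15 * κ ^ 3 * √(T : ℝ) * √T = 15 * κ ^ 3 * √(T : ℝ) ^ 2 := by ring
      _ ≤ _ := by gcongr
  linarith

lemma le_varianceBound (D : RegularDesign c C M X Γ α r a v) (hR : 1 ≤ R)
    (hs : 91 * typicalBound c C M R ^ 7 ≤ √T) (β : Fin K → ℝ) {e : Fin (T + 1) → ℝ}
    (Y : TypicalErrors X Γ α r v (typicalBound c C M R) (fun i => e i.castSucc)
      fun i => e i.succ) :
    (1 - 106 * typicalBound c C M R ^ 7 / √T) * limitVariance X Γ α r v ≤
      varianceBound X (regressors X α e) (outcomes X α β e) Γ r := by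
  obtain ⟨k0, k1, -, -, -, -, k6, -⟩ := typicalBound_le D.c_pos D.C_ge D.M_ge hR
  have hc := D.c_pos
  have hM := D.M_ge
  have hC := D.C_ge
  have hs0 : 0 < √(T : ℝ) := Real.sqrt_pos.2 D.T_pos
  have hs' : 8 * typicalBound c C M R ^ 2 ≤ √T := by
    have : typicalBound c C M R ^ 2 ≤ typicalBound c C M R ^ 7 :=
      pow_le_pow_right₀ k0 (by norm_num)
    have : 0 ≤ typicalBound c C M R ^ 2 := by positivity
    linarith
  have hσ := D.le_sigmaHatSq hR hs' β Y
  obtain ⟨d₁, d₂, h₁, h₂, h⟩ := D.exists_updated_contrast_eq hR hs' Y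
  have hslope : |limitSlope X Γ α r v| ≤
      typicalBound c C M R * euclNorm (limitContrast X Γ α r v) / √T := by
    refine D.abs_limitSlope_le.trans ?_
    have := euclNorm_nonneg (limitContrast X Γ α r v)
    gcongr
  have hb : euclNorm (α ᵥ* ivWeights X Γ) ≤ typicalBound c C M R / √T := by
    refine D.euclNorm_feedbackWeights_le.trans ?_
    have h1 : 2 * M / c ≤ R * (C * (2 * M / c)) := by
      have h2 : 0 ≤ 2 * M / c := by positivity
      have h3 : 2 * M / c ≤ C * (2 * M / c) := le_mul_of_one_le_left h2 hC
      exact h3.trans (le_mul_of_one_le_left (h2.trans h3) hR)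
    gcongr
    exact h1.trans k1
  have hsq := perturbed_contrast_sq k0 hs' hslope hb Y.norm_lag Y.limitContrast_lag Y.norm_sq_lag
    h₁ h₂
  rw [← h, ← regressors_eq_add_vecMulVec] at hsq
  have hup := limitVariance_le (X := X) (Γ := Γ) (α := α) (r := r) (v := v)
  set κ := typicalBound c C M R
  set x := euclNorm (limitContrast X Γ α r v)
  set F := (((1 - Γ) * obliqueProj X Γ)ᵀ * ((1 - Γ) * obliqueProj X Γ)).trace with hF
  have hF0 : 0 ≤ F := trace_transpose_mul_self_nonneg _
  set G := x ^ 2 + limitSlope X Γ α r v ^ 2 * (v * F) with hG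
  have hG0 : 0 ≤ G := by positivity
  have hxG : x ^ 2 ≤ G := by
    have : 0 ≤ limitSlope X Γ α r v ^ 2 * (v * F) := by positivity
    linarith
  set w := κ ^ 7 / √(T : ℝ) with hw
  have hw0 : 0 ≤ w := by positivity
  have hw1 : 91 * w ≤ 1 := by
    rw [hw, mul_div_assoc', div_le_one hs0]; exact hs
  have hsq' : (1 - 91 * w) * G ≤ euclNorm (r ᵥ* ivWeights (regressors X α e) Γ) ^ 2 := by
    have e1 : 91 * κ ^ 7 / √(T : ℝ) * x ^ 2 ≤ 91 * w * G := by
      rw [hw, mul_div_assoc]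
      gcongr
    linarith
  have hσ' : (1 - 15 * w) * v ≤ sigmaHatSq X (regressors X α e) (outcomes X α β e) Γ := by
    refine le_trans ?_ hσ
    have e1 : 15 * κ ^ 5 / √(T : ℝ) ≤ 15 * w := by
      rw [hw, mul_div_assoc]
      have : κ ^ 5 ≤ κ ^ 7 := pow_le_pow_right₀ k0 (by norm_num)
      gcongr
    gcongr
  have hψ := psi_nonneg X Γ
  rw [varianceBound]
  -- The relative errors 15w of the variance estimate and 91w of the squared length add up to 106w.
  have hprod : (1 - 106 * w) * (v * G) ≤
      sigmaHatSq X (regressors X α e) (outcomes X α β e) Γ *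
        euclNorm (r ᵥ* ivWeights (regressors X α e) Γ) ^ 2 := by
    have hvG : 0 ≤ (v : ℝ) * G := by positivity
    have e1 : (1 - 106 * w) * (v * G) ≤ ((1 - 15 * w) * v) * ((1 - 91 * w) * G) := by
      have e2 : ((1 - 15 * w) * v) * ((1 - 91 * w) * G) - (1 - 106 * w) * (v * G) =
        15 * 91 * w ^ 2 * (v * G) := by ring
      have e3 : 0 ≤ 15 * 91 * w ^ 2 * (v * G) := by positivity
      linarith
    have e4 : 0 ≤ (1 - 15 * w) * (v : ℝ) := mul_nonneg (by linarith) v.2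
    have e5 : 0 ≤ (1 - 91 * w) * G := mul_nonneg (by linarith) hG0
    exact e1.trans (mul_le_mul hσ' hsq' e5 (e4.trans hσ'))
  have hbase : 0 ≤ sigmaHatSq X (regressors X α e) (outcomes X α β e) Γ *
        euclNorm (r ᵥ* ivWeights (regressors X α e) Γ) ^ 2 := by
    have e4 : 0 ≤ (1 - 15 * w) * (v : ℝ) := mul_nonneg (by linarith) v.2
    exact mul_nonneg (e4.trans hσ') (sq_nonneg _)
  have hfin : (1 - 106 * κ ^ 7 / √T) * limitVariance X Γ α r v ≤
      (1 + psi X Γ) * (sigmaHatSq X (regressors X α e) (outcomes X α β e) Γ *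
        euclNorm (r ᵥ* ivWeights (regressors X α e) Γ) ^ 2) := by
    rw [mul_div_assoc, ← hw]
    -- If the factor is negative the claim is trivial, because the variance bound is nonnegative.
    rcases le_or_gt 0 (1 - 106 * w) with h0 | h0
    · calc (1 - 106 * w) * limitVariance X Γ α r v ≤
          (1 - 106 * w) * ((1 + psi X Γ) * (v * G)) := mul_le_mul_of_nonneg_left hup h0
        _ = (1 + psi X Γ) * ((1 - 106 * w) * (v * G)) := by ring
        _ ≤ _ := mul_le_mul_of_nonneg_left hprod (by linarith)
    · have e6 : (1 - 106 * w) * limitVariance X Γ α r v ≤ 0 :=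
        mul_nonpos_of_nonpos_of_nonneg h0.le D.limitVariance_pos.le
      exact e6.trans (mul_nonneg (by linarith) hbase)
  rw [mul_assoc]
  exact hfin

end RegularDesign

end Approximation

/-! ### Limit statements uniform over regular designs. -/

section UniformLimit

variable {T K : ℕ} {c C M R : ℝ} {X : Matrix (Fin T) (Fin K) ℝ} {Γ : Matrix (Fin T) (Fin T) ℝ}
  {α r : Fin K → ℝ} {a : Fin T → ℝ} {v : ℝ≥0}

lemma euclNorm_comp_castSucc_sq_le (e : Fin (T + 1) → ℝ) :
    euclNorm (fun i : Fin T => e i.castSucc) ^ 2 ≤ e ⬝ᵥ e := by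
  rw [euclNorm_sq]
  simp only [dotProduct]
  rw [Fin.sum_univ_castSucc (fun i => e i * e i)]
  linarith [mul_self_nonneg (e (Fin.last T))]

lemma euclNorm_comp_succ_sq_le (e : Fin (T + 1) → ℝ) :
    euclNorm (fun i : Fin T => e i.succ) ^ 2 ≤ e ⬝ᵥ e := by
  rw [euclNorm_sq]
  simp only [dotProduct]
  rw [Fin.sum_univ_succ (fun i => e i * e i)]
  linarith [mul_self_nonneg (e 0)]

namespace RegularDesign

lemma euclNorm_limitContrast_le_sqrt (D : RegularDesign c C M X Γ α r a v) :
    euclNorm (limitContrast X Γ α r v) ≤ 1 / c * √(limitVariance X Γ α r v) := by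
  have hc := D.c_pos
  have h0 := D.limitContrast_pos
  have h1 : (c * euclNorm (limitContrast X Γ α r v)) ^ 2 ≤ limitVariance X Γ α r v := by
    refine le_trans ?_ limitVariance_ge
    rw [mul_pow]
    have h2 : c ^ 2 ≤ v := by nlinarith [D.c_lt_one, D.lt_var]
    gcongr
  have h2 := Real.le_sqrt_of_sq_le h1
  rw [div_mul_eq_mul_div, one_mul, le_div_iff₀ hc]
  linarith

lemma norm_charFun_linearQuadratic_sub_le (D : RegularDesign c C M X Γ α r a v) (t : ℝ)
    (ht : 24 * (1 + |t|) ^ 3 * (M * C / c ^ 3) ≤ √T) :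
    ‖(∫ e, Complex.exp (t * (linearQuadratic X Γ α r v e / √(limitVariance X Γ α r v) : ℝ) *
        Complex.I) ∂(Measure.pi fun _ : Fin (T + 1) => gaussianReal 0 v)) -
      Complex.exp (-t ^ 2 / 2)‖ ≤ 24 * (1 + |t|) ^ 3 * (M * C / c ^ 3) / √T := by
  have hc := D.c_pos
  have hM := D.M_ge
  have hC := D.C_ge
  have hs : 0 < √(T : ℝ) := Real.sqrt_pos.2 D.T_pos
  have hV := D.limitVariance_pos
  set σ := √(limitVariance X Γ α r v) with hσ
  have hσ0 : 0 < σ := Real.sqrt_pos.2 hV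
  have hσ2 : σ ^ 2 = limitVariance X Γ α r v := Real.sq_sqrt hV.le
  set N := (1 - Γ) * obliqueProj X Γ with hN
  set τ := limitSlope X Γ α r v with hτ
  set l := limitContrast X Γ α r v with hl
  set Q₀ := (selectionMatrix (@Fin.castSucc T))ᵀ * N * selectionMatrix (@Fin.succ T) with hQ₀
  have hform : ∀ e : Fin (T + 1) → ℝ,
      e ⬝ᵥ Q₀ *ᵥ e = (fun i => e i.castSucc) ⬝ᵥ N *ᵥ (fun i => e i.succ) := fun e =>
    (quadratic_select (@Fin.castSucc T) (@Fin.succ T) N e).symm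
  -- After standardization the quadratic part has size O(T^(-1/2)), which is the smallness required
  -- for the Gaussian limit.
  have htau : |τ| / σ ≤ M / c ^ 2 / √T := by
    rw [div_le_iff₀ hσ0]
    have := D.euclNorm_limitContrast_le_sqrt
    calc |τ| ≤ M / c * euclNorm l / √T := D.abs_limitSlope_le
      _ ≤ M / c * (1 / c * σ) / √T := by gcongr
      _ = _ := by field_simp
  have h := norm_charFun_linear_add_quadratic_sub_le v D.var_ne
    (σ⁻¹ • (l ᵥ* selectionMatrix (@Fin.succ T))) ((τ / σ) • Q₀)
    (by
      rw [Matrix.trace_smul, hQ₀, trace_select, selectionMatrix_castSucc_mul_succ_transpose, hN,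
        ← feedbackForm_eq, D.trace_eq, smul_zero])
    (6 * M / c ^ 3 / √T) t
    (by
      intro e
      rw [Matrix.smul_mulVec, dotProduct_smul, smul_eq_mul, abs_mul, hform, abs_div,
        abs_of_pos hσ0]
      have h1 := D.abs_form_le (euclNorm_comp_succ_sq_le e) (euclNorm_comp_castSucc_sq_le e)
      calc _ ≤ M / c ^ 2 / √T * (6 / c * (e ⬝ᵥ e)) := by gcongr
        _ = _ := by ring)
    (by
      rw [smul_dotProduct, dotProduct_smul, vecMul_selectionMatrix_dotProduct_self _
        (Fin.succ_injective T), Matrix.transpose_smul, Matrix.smul_mul, Matrix.mul_smul,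
        Matrix.smul_mul, Matrix.mul_smul, Matrix.trace_smul, Matrix.trace_smul,
        Matrix.trace_smul, Matrix.trace_smul, hQ₀, trace_mul_self_select,
        trace_transpose_mul_select _ _ (Fin.castSucc_injective T) (Fin.succ_injective T), hN,
        ← feedbackForm_eq, ← euclNorm_sq]
      have h1 : limitVariance X Γ α r v = v * euclNorm l ^ 2 + τ ^ 2 * v ^ 2 *
        ((feedbackForm X Γ * feedbackForm X Γ).trace +
        (((1 - Γ) * obliqueProj X Γ)ᵀ * ((1 - Γ) * obliqueProj X Γ)).trace) := rfl
      rw [← hσ2] at h1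
      simp only [smul_eq_mul]
      field_simp
      linarith)
  have hv := D.var_lt.le
  have ht0 := abs_nonneg t
  set p := |t| with hp
  have hcube : p ^ 3 ≤ (1 + p) ^ 3 := by gcongr; linarith
  have hlin : p ≤ (1 + p) ^ 3 := by nlinarith [mul_nonneg ht0 ht0, mul_nonneg (mul_nonneg ht0 ht0) ht0]
  have hbound : ∀ y : ℝ, 0 ≤ y → y ≤ (1 + p) ^ 3 → y * (6 * M / c ^ 3 / √T) * v ≤
      6 * (1 + p) ^ 3 * (M * C / c ^ 3) / √T := by
    intro y h1 h2
    calc _ ≤ (1 + p) ^ 3 * (6 * M / c ^ 3 / √T) * C := by gcongr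
      _ = _ := by ring
  have hle : 6 * (1 + p) ^ 3 * (M * C / c ^ 3) / √T ≤ 1 / 4 := by
    rw [div_le_iff₀ hs]; linarith
  have h1 := hbound p ht0 hlin
  have h2 := hbound (p ^ 3) (by positivity) hcube
  have h3 := h (by linarith) (by linarith)
  have heq : ∀ e : Fin (T + 1) → ℝ,
      (σ⁻¹ • (l ᵥ* selectionMatrix (@Fin.succ T))) ⬝ᵥ e + e ⬝ᵥ ((τ / σ) • Q₀) *ᵥ e =
        linearQuadratic X Γ α r v e / σ := by
    intro e
    rw [Matrix.smul_mulVec, dotProduct_smul, hform, smul_dotProduct,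
      ← dotProduct_select (@Fin.succ T), linearQuadratic]
    simp only [smul_eq_mul]
    field_simp
    rfl
  simp_rw [heq] at h3
  refine h3.trans ?_
  calc 4 * p ^ 3 * (6 * M / c ^ 3 / √T) * v = 4 * (p ^ 3 * (6 * M / c ^ 3 / √T) * v) := by ring
    _ ≤ 4 * (6 * (1 + p) ^ 3 * (M * C / c ^ 3) / √T) := by linarith
    _ = _ := by ring

end RegularDesign

/-- Characteristic functions of two variables that are close on a set of large probability. -/
lemma norm_integral_exp_sub_integral_exp_le {Ω : Type*} [MeasurableSpace Ω] {ν : Measure Ω}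
    [IsProbabilityMeasure ν] {f g : Ω → ℝ} (hf : Measurable f) (hg : Measurable g) {A : Set Ω}
    {δ p t : ℝ} (hδ : 0 ≤ δ) (hp : 0 ≤ p) (hA : ν A ≤ ENNReal.ofReal p)
    (h : ∀ e ∉ A, |f e - g e| ≤ δ) :
    ‖(∫ e, Complex.exp (t * f e * Complex.I) ∂ν) - ∫ e, Complex.exp (t * g e * Complex.I) ∂ν‖ ≤
      |t| * δ + 2 * p := by
  have hint : ∀ {k : Ω → ℝ}, Measurable k →
      Integrable (fun e => Complex.exp (t * k e * Complex.I)) ν := by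
    intro k hk
    refine Integrable.of_bound (by fun_prop) 1 (ae_of_all _ fun e => ?_)
    rw [← Complex.ofReal_mul, Complex.norm_exp_ofReal_mul_I]
  rw [← integral_sub (hint hf) (hint hg)]
  -- The exceptional set is arbitrary, so it is replaced by a measurable superset of equal measure;
  -- off it the integrands differ by at most |t|δ, on it by at most 2.
  set A' := toMeasurable ν A
  have hA' : MeasurableSet A' := measurableSet_toMeasurable _ _
  have hb : ∀ e, ‖Complex.exp (t * f e * Complex.I) - Complex.exp (t * g e * Complex.I)‖ ≤
      |t| * δ + A'.indicator (fun _ => 2) e := by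
    intro e
    by_cases he : e ∈ A'
    · rw [Set.indicator_of_mem he]
      refine (norm_sub_le _ _).trans ?_
      rw [← Complex.ofReal_mul, ← Complex.ofReal_mul, Complex.norm_exp_ofReal_mul_I,
        Complex.norm_exp_ofReal_mul_I]
      have : 0 ≤ |t| * δ := by positivity
      linarith
    · rw [Set.indicator_of_notMem he, add_zero]
      have h1 := h e fun h' => he (subset_toMeasurable _ _ h')
      have h2 : Complex.exp (t * f e * Complex.I) - Complex.exp (t * g e * Complex.I) =
          Complex.exp ((t * g e : ℝ) * Complex.I) *
            (Complex.exp (Complex.I * (t * (f e - g e) : ℝ)) - 1) := by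
        rw [mul_sub, ← Complex.exp_add, mul_one]
        push_cast
        congr 2
        ring
      rw [h2, norm_mul, Complex.norm_exp_ofReal_mul_I, one_mul]
      refine (Real.norm_exp_I_mul_ofReal_sub_one_le).trans ?_
      rw [Real.norm_eq_abs, abs_mul]
      gcongr
  have hi : Integrable (A'.indicator fun _ => (2 : ℝ)) ν :=
    (integrable_const 2).indicator hA'
  refine (norm_integral_le_of_norm_le ((integrable_const (|t| * δ)).add hi)
    (ae_of_all _ hb)).trans ?_
  simp only [Pi.add_apply]
  rw [integral_add (integrable_const _) hi, integral_const, integral_indicator_const _ hA']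
  simp only [probReal_univ, one_mul, smul_eq_mul]
  have : ν.real A' ≤ p := by
    rw [Measure.real, measure_toMeasurable]
    exact ENNReal.toReal_le_of_le_ofReal hp hA
  linarith

/-- Uniformly over regular designs, the estimated variance is asymptotically not below the
limiting one. -/
lemma exists_forall_measure_varianceBound_lt_le {c C M η : ℝ} (hc : 0 < c) (hC : 1 ≤ C)
    (hM : 1 ≤ M) (hη : 0 < η) :
    ∃ T₀ : ℕ, ∀ (T K : ℕ) (X : Matrix (Fin T) (Fin K) ℝ) (Γ : Matrix (Fin T) (Fin T) ℝ)
      (α r β : Fin K → ℝ) (a : Fin T → ℝ) (v : ℝ≥0), T₀ ≤ T → RegularDesign c C M X Γ α r a v →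
      (Measure.pi fun _ : Fin (T + 1) => gaussianReal 0 v)
        {e | varianceBound X (regressors X α e) (outcomes X α β e) Γ r <
          (1 - η) * limitVariance X Γ α r v} ≤ ENNReal.ofReal η := by
  -- R is fixed first, to make the atypical event improbable; this fixes κ, and only then is T taken
  -- large in terms of κ.
  obtain ⟨R, hR1, hR⟩ : ∃ R : ℝ, 1 ≤ R ∧ 12 * (1 / R ^ 2) ≤ η := by
    refine ⟨12 / η + 1, by have := div_pos (by norm_num : (0 : ℝ) < 12) hη; linarith, ?_⟩
    have h1 : 1 ≤ 12 / η + 1 := by have := div_pos (by norm_num : (0 : ℝ) < 12) hη; linarith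
    rw [mul_one_div, div_le_iff₀ (by positivity)]
    have h2 : 12 = η * (12 / η) := by field_simp
    nlinarith
  obtain ⟨k0, -⟩ := typicalBound_le hc hC hM hR1
  set κ := typicalBound c C M R with hκ
  obtain ⟨n, hn⟩ := exists_nat_ge ((91 * κ ^ 7) ^ 2 + (106 * κ ^ 7 / η) ^ 2)
  refine ⟨n, fun T K X Γ α r β a v hT D => ?_⟩
  have hTn : (91 * κ ^ 7) ^ 2 + (106 * κ ^ 7 / η) ^ 2 ≤ (T : ℝ) := hn.trans (by exact_mod_cast hT)
  have hs : 0 < √(T : ℝ) := Real.sqrt_pos.2 D.T_pos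
  have h1 : 91 * κ ^ 7 ≤ √T := Real.le_sqrt_of_sq_le (by nlinarith [sq_nonneg (106 * κ ^ 7 / η)])
  have h2 : 106 * κ ^ 7 / η ≤ √T := Real.le_sqrt_of_sq_le (by nlinarith [sq_nonneg (91 * κ ^ 7)])
  have h3 : 106 * κ ^ 7 / √T ≤ η := by
    rw [div_le_iff₀ hη] at h2
    rw [div_le_iff₀ hs]; linarith
  refine (measure_mono ?_).trans ((D.measure_not_typicalErrors_le hR1).trans ?_)
  · intro e he Y
    refine absurd he (not_lt.2 ((D.le_varianceBound hR1 h1 β Y).trans' ?_))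
    have := D.limitVariance_pos
    gcongr
  · rw [show (12 : ℝ≥0∞) = ENNReal.ofReal 12 by norm_num, ← ENNReal.ofReal_mul (by norm_num)]
    exact ENNReal.ofReal_le_ofReal hR

/-- Uniformly over regular designs, the standardized estimator is asymptotically standard
Gaussian. -/
lemma exists_forall_norm_charFun_estimator_sub_le {c C M η B : ℝ} (hc : 0 < c) (hC : 1 ≤ C)
    (hM : 1 ≤ M) (hη : 0 < η) (hB : 0 < B) :
    ∃ T₀ : ℕ, ∀ (T K : ℕ) (X : Matrix (Fin T) (Fin K) ℝ) (Γ : Matrix (Fin T) (Fin T) ℝ)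
      (α r β : Fin K → ℝ) (a : Fin T → ℝ) (v : ℝ≥0), T₀ ≤ T → RegularDesign c C M X Γ α r a v →
      ∀ t : ℝ, |t| ≤ B →
      ‖(∫ e, Complex.exp (t * ((r ⬝ᵥ betaIV (regressors X α e) (outcomes X α β e) Γ - r ⬝ᵥ β) /
          √(limitVariance X Γ α r v) : ℝ) * Complex.I)
          ∂(Measure.pi fun _ : Fin (T + 1) => gaussianReal 0 v)) -
        Complex.exp (-t ^ 2 / 2)‖ ≤ η := by
  obtain ⟨R, hR1, hR⟩ : ∃ R : ℝ, 1 ≤ R ∧ 2 * (12 * (1 / R ^ 2)) ≤ η / 3 := by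
    have h0 := div_pos (by norm_num : (0 : ℝ) < 72) hη
    refine ⟨72 / η + 1, by linarith, ?_⟩
    have h1 : 1 ≤ 72 / η + 1 := by linarith
    rw [mul_one_div, mul_div_assoc', div_le_iff₀ (by positivity)]
    have h2 : 72 = η * (72 / η) := by field_simp
    nlinarith
  obtain ⟨k0, -, -, -, -, -, -, -, -, -, -, k11⟩ := typicalBound_le hc hC hM hR1
  set κ := typicalBound c C M R with hκ
  set b₁ := 24 * (1 + B) ^ 3 * (M * C / c ^ 3) with hb₁
  have hb₁0 : 0 ≤ b₁ := by positivity
  obtain ⟨n, hn⟩ := exists_nat_ge ((8 * κ ^ 2) ^ 2 + (66 * B * κ ^ 6 / η) ^ 2 + b₁ ^ 2 +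
    (3 * b₁ / η) ^ 2)
  refine ⟨n, fun T K X Γ α r β a v hT D t ht => ?_⟩
  have hTn := hn.trans (Nat.cast_le (α := ℝ).2 hT)
  have q1 := sq_nonneg (8 * κ ^ 2)
  have q2 := sq_nonneg (66 * B * κ ^ 6 / η)
  have q3 := sq_nonneg b₁
  have q4 := sq_nonneg (3 * b₁ / η)
  have hs : 0 < √(T : ℝ) := Real.sqrt_pos.2 D.T_pos
  have h1 : 8 * κ ^ 2 ≤ √T := Real.le_sqrt_of_sq_le (by linarith)
  have h2 : 66 * B * κ ^ 6 / η ≤ √T := Real.le_sqrt_of_sq_le (by linarith)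
  have h3 : b₁ ≤ √T := Real.le_sqrt_of_sq_le (by linarith)
  have h4 : 3 * b₁ / η ≤ √T := Real.le_sqrt_of_sq_le (by linarith)
  have hσ0 : 0 < √(limitVariance X Γ α r v) := Real.sqrt_pos.2 D.limitVariance_pos
  have hbt : 24 * (1 + |t|) ^ 3 * (M * C / c ^ 3) ≤ b₁ := by rw [hb₁]; gcongr
  have hchar := D.norm_charFun_linearQuadratic_sub_le t (hbt.trans h3)
  have hchar' : 24 * (1 + |t|) ^ 3 * (M * C / c ^ 3) / √T ≤ η / 3 := by
    rw [div_le_iff₀ hη] at h4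
    rw [div_le_iff₀ hs]; linarith
  have happrox := norm_integral_exp_sub_integral_exp_le (t := t)
    (ν := Measure.pi fun _ : Fin (T + 1) => gaussianReal 0 v)
    (f := fun e => (r ⬝ᵥ betaIV (regressors X α e) (outcomes X α β e) Γ - r ⬝ᵥ β) /
          √(limitVariance X Γ α r v))
    (g := fun e => linearQuadratic X Γ α r v e / √(limitVariance X Γ α r v))
    (A := {e | ¬ TypicalErrors X Γ α r v (typicalBound c C M R) (fun i => e i.castSucc)
      (fun i => e i.succ)}) (δ := 22 * κ ^ 6 / √T) (p := 12 * (1 / R ^ 2))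
    (by fun_prop) (by unfold linearQuadratic; fun_prop) (by positivity) (by positivity)
    (by
      refine (D.measure_not_typicalErrors_le hR1).trans (le_of_eq ?_)
      rw [show (12 : ℝ≥0∞) = ENNReal.ofReal 12 by norm_num, ← ENNReal.ofReal_mul (by norm_num)])
    (by
      intro e he
      have Y := not_not.1 he
      have h5 := D.abs_estimator_sub_linearQuadratic_le hR1 h1 β Y
      rw [← sub_div, abs_div, abs_of_pos hσ0, div_le_iff₀ hσ0]
      refine h5.trans ?_
      have h6 : euclNorm (limitContrast X Γ α r v) ≤ κ * √(limitVariance X Γ α r v) :=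
        D.euclNorm_limitContrast_le_sqrt.trans (by gcongr)
      calc _ ≤ 22 * κ ^ 5 * (κ * √(limitVariance X Γ α r v)) / √T := by gcongr
        _ = _ := by ring)
  have h5 : |t| * (22 * κ ^ 6 / √T) ≤ η / 3 := by
    rw [mul_div_assoc', div_le_iff₀ hs]
    rw [div_le_iff₀ hη] at h2
    have : |t| * (22 * κ ^ 6) ≤ B * (22 * κ ^ 6) := by gcongr
    linarith
  refine (norm_sub_le_norm_sub_add_norm_sub _ _ _).trans
    ((add_le_add happrox (hchar.trans hchar')).trans ?_)
  linarith

/-- A feedback vector of bounded size is in the row space of the design with small weights. -/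
lemma exists_feedback_eq {M : ℝ} {X : Matrix (Fin T) (Fin K) ℝ} {α : Fin K → ℝ}
    (hX : X.rank = K) (hT : 0 < T) (hM : 1 ≤ M)
    (h : |α ⬝ᵥ (((T : ℝ)⁻¹ • (Xᵀ * X))⁻¹ *ᵥ α)| ≤ M) :
    ∃ a : Fin T → ℝ, α = Xᵀ *ᵥ a ∧ euclNorm a ≤ M / √T := by
  -- The ordinary Gram matrix is the case Γ = 0, with 1/2 as an admissible coercivity constant.
  have hdet : IsUnit (Xᵀ * X).det := by
    have := isUnit_det_normal (c := 1 / 2) (X := X) (Γ := 0) (by norm_num)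
      (by rw [opNorm, map_zero, norm_zero]; norm_num) hX
    simpa using this
  have hT' : (0 : ℝ) < T := by exact_mod_cast hT
  -- The minimum-norm solution, with |a|² = α'(X'X)⁻¹α ≤ M/T ≤ M²/T as M ≥ 1.
  refine ⟨X *ᵥ ((Xᵀ * X)⁻¹ *ᵥ α), ?_, ?_⟩
  · rw [Matrix.mulVec_mulVec, Matrix.mulVec_mulVec, Matrix.mul_nonsing_inv _ hdet,
      Matrix.one_mulVec]
  · have h1 : euclNorm (X *ᵥ ((Xᵀ * X)⁻¹ *ᵥ α)) ^ 2 = α ⬝ᵥ ((Xᵀ * X)⁻¹ *ᵥ α) := by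
      rw [euclNorm_sq, Matrix.dotProduct_mulVec, Matrix.vecMul_mulVec, ← Matrix.dotProduct_mulVec,
        Matrix.mulVec_mulVec, Matrix.mul_nonsing_inv _ hdet, Matrix.one_mulVec, dotProduct_comm]
    have h2 : ((T : ℝ)⁻¹ • (Xᵀ * X))⁻¹ = (T : ℝ) • (Xᵀ * X)⁻¹ := by
      refine Matrix.inv_eq_left_inv ?_
      rw [Matrix.smul_mul, Matrix.mul_smul, Matrix.nonsing_inv_mul _ hdet, smul_smul,
        mul_inv_cancel₀ hT'.ne', one_smul]
    rw [h2, Matrix.smul_mulVec, dotProduct_smul, smul_eq_mul, ← h1] at h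
    have h3 := (le_abs_self _).trans h
    have hs : 0 < √(T : ℝ) := Real.sqrt_pos.2 hT'
    rw [le_div_iff₀ hs]
    refine (pow_le_pow_iff_left₀ (mul_nonneg (euclNorm_nonneg _) hs.le) (by positivity)
      two_ne_zero).1 ?_
    rw [mul_pow, Real.sq_sqrt hT'.le]
    nlinarith

end UniformLimit

/-! ### From conditional laws to unconditional probabilities. -/

section ConditionalLaw

variable {Ω 𝓧 E : Type*} [MeasurableSpace Ω] [MeasurableSpace 𝓧] [MeasurableSpace E]
  [StandardBorelSpace E] [Nonempty E] {P : Measure Ω} [IsProbabilityMeasure P] {X : Ω → 𝓧}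

/-- Transfer of a bound on conditional probabilities to the unconditional one. -/
lemma measure_le_of_condDistrib {Y : Ω → E} (hX : Measurable X) (hY : Measurable Y)
    {S : Set (𝓧 × E)} (hS : MeasurableSet S) {A : Set Ω} {δ : ℝ≥0∞}
    (h : ∀ᵐ ω ∂P, ω ∉ A → condDistrib Y X P (X ω) {e | (X ω, e) ∈ S} ≤ δ) :
    P {ω | (X ω, Y ω) ∈ S} ≤ δ + P A := by
  have h1 : P {ω | (X ω, Y ω) ∈ S} = ∫⁻ ω, condDistrib Y X P (X ω) {e | (X ω, e) ∈ S} ∂P := by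
    have h0 : P.map X ⊗ₘ condDistrib Y X P = P.map fun ω => (X ω, Y ω) :=
      compProd_map_condDistrib hY.aemeasurable
    have h2 := congrArg (fun μ => μ S) h0
    rw [Measure.map_apply (hX.prodMk hY) hS, Measure.compProd_apply hS,
      lintegral_map (Kernel.measurable_kernel_prodMk_left hS) hX] at h2
    exact h2.symm
  rw [h1, ← measure_toMeasurable A]
  set A' := toMeasurable P A
  calc ∫⁻ ω, condDistrib Y X P (X ω) {e | (X ω, e) ∈ S} ∂P
      ≤ ∫⁻ ω, (δ + A'.indicator 1 ω) ∂P := by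
        refine lintegral_mono_ae (h.mono fun ω hω => ?_)
        by_cases hA : ω ∈ A'
        · rw [Set.indicator_of_mem hA]
          exact (prob_le_one).trans le_add_self
        · exact (hω fun h' => hA (subset_toMeasurable _ _ h')).trans le_self_add
    _ = δ + P A' := by
        rw [lintegral_add_left measurable_const, lintegral_const, measure_univ, mul_one,
          lintegral_indicator_one (measurableSet_toMeasurable _ _)]

/-- Transfer of a bound on conditional expectations to the unconditional one. -/
lemma norm_integral_sub_le_of_condDistrib {Y : Ω → E} (hX : Measurable X) (hY : Measurable Y)
    {f : 𝓧 × E → ℂ} (hf : Measurable f) (hf1 : ∀ q, ‖f q‖ ≤ 1) {z : ℂ} (hz : ‖z‖ ≤ 1)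
    {A : Set Ω} {δ p : ℝ} (hδ : 0 ≤ δ) (hp : 0 ≤ p) (hA : P A ≤ ENNReal.ofReal p)
    (h : ∀ᵐ ω ∂P, ω ∉ A → ‖(∫ e, f (X ω, e) ∂condDistrib Y X P (X ω)) - z‖ ≤ δ) :
    ‖(∫ ω, f (X ω, Y ω) ∂P) - z‖ ≤ δ + 2 * p := by
  have hfs : StronglyMeasurable f := hf.stronglyMeasurable
  have hgm : StronglyMeasurable fun x => ∫ e, f (x, e) ∂condDistrib Y X P x :=
    hfs.integral_kernel_prod_right'
  have hg1 : ∀ x, ‖∫ e, f (x, e) ∂condDistrib Y X P x‖ ≤ 1 := fun x => by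
    refine (norm_integral_le_of_norm_le (integrable_const (1 : ℝ))
      (ae_of_all _ fun e => hf1 (x, e))).trans ?_
    simp
  have h1 : ∫ ω, f (X ω, Y ω) ∂P = ∫ ω, (∫ e, f (X ω, e) ∂condDistrib Y X P (X ω)) ∂P := by
    have h2 : ∫ q, f q ∂(P.map fun ω => (X ω, Y ω)) = ∫ ω, f (X ω, Y ω) ∂P :=
      integral_map (hX.prodMk hY).aemeasurable hfs.aestronglyMeasurable
    have hint : Integrable f (P.map X ⊗ₘ condDistrib Y X P) := by
      have : IsProbabilityMeasure (P.map X) := Measure.isProbabilityMeasure_map hX.aemeasurable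
      exact Integrable.of_bound hfs.aestronglyMeasurable 1 (ae_of_all _ hf1)
    rw [← h2, ← compProd_map_condDistrib hY.aemeasurable, Measure.integral_compProd hint,
      integral_map hX.aemeasurable hgm.aestronglyMeasurable]
  have hint : Integrable (fun ω => ∫ e, f (X ω, e) ∂condDistrib Y X P (X ω)) P :=
    Integrable.of_bound (hgm.comp_measurable hX).aestronglyMeasurable 1
      (ae_of_all _ fun ω => hg1 (X ω))
  have hz' : z = ∫ _ω : Ω, z ∂P := by simp
  rw [h1, hz', ← integral_sub hint (integrable_const z)]
  set A' := toMeasurable P A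
  have hA' : MeasurableSet A' := measurableSet_toMeasurable _ _
  have hi : Integrable (A'.indicator fun _ => (2 : ℝ)) P := (integrable_const 2).indicator hA'
  refine (norm_integral_le_of_norm_le ((integrable_const δ).add hi) (h.mono fun ω hω => ?_)).trans ?_
  · change _ ≤ δ + A'.indicator (fun _ => 2) ω
    by_cases hωA : ω ∈ A'
    · rw [Set.indicator_of_mem hωA]
      have := norm_sub_le (∫ e, f (X ω, e) ∂condDistrib Y X P (X ω)) z
      have := hg1 (X ω)
      linarith
    · rw [Set.indicator_of_notMem hωA, add_zero]
      exact hω fun h' => hωA (subset_toMeasurable _ _ h')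
  · simp only [Pi.add_apply]
    rw [integral_add (integrable_const _) hi, integral_const, integral_indicator_const _ hA']
    simp only [probReal_univ, one_mul, smul_eq_mul]
    have : P.real A' ≤ p := by
      rw [Measure.real, measure_toMeasurable]
      exact ENNReal.toReal_le_of_le_ofReal hp hA
    linarith

/-- Conditionally i.i.d. and Gaussian errors of mean zero are a Gaussian vector conditionally. -/
lemma exists_condDistrib_eq_pi_gaussianReal {m : ℕ} {ε : Fin (m + 1) → Ω → ℝ} {c C : ℝ}
    (hX : Measurable X) (hε : ∀ t, Measurable (ε t)) (hiid : CondIID P X ε)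
    (hmean : P[ε 0 | sigmaAlg X] =ᵐ[P] 0)
    (hvar : ∀ᵐ ω ∂P, c < (P[fun ω' => ε 0 ω' ^ 2 | sigmaAlg X]) ω ∧
      (P[fun ω' => ε 0 ω' ^ 2 | sigmaAlg X]) ω < C)
    (hint : Integrable (fun ω => ε 0 ω ^ 4) P) (i : Fin (m + 1))
    (hgauss : CondGaussian P X (ε i)) :
    ∃ w : 𝓧 → ℝ≥0, Measurable w ∧ ∀ᵐ ω ∂P,
      condDistrib (fun ω t => ε t ω) X P (X ω) = Measure.pi (fun _ => gaussianReal 0 (w (X ω))) ∧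
      c < w (X ω) ∧ w (X ω) < C := by
  have hint2 : Integrable (fun ω => ε 0 ω ^ 2) P := by
    refine (hint.add (integrable_const 1)).mono' ((hε 0).pow_const 2).aestronglyMeasurable
      (ae_of_all _ fun ω => ?_)
    simp only [Pi.add_apply, norm_pow, Real.norm_eq_abs, sq_abs]
    nlinarith [sq_nonneg (ε 0 ω ^ 2 - 1)]
  have hint1 : Integrable (ε 0) P := by
    refine (hint2.add (integrable_const 1)).mono' (hε 0).aestronglyMeasurable
      (ae_of_all _ fun ω => ?_)
    simp only [Pi.add_apply, Real.norm_eq_abs]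
    rw [← sq_abs]
    nlinarith [sq_nonneg (|ε 0 ω| - 1)]
  have hsq : StronglyMeasurable fun z : ℝ => z ^ 2 := (by fun_prop : Measurable _).stronglyMeasurable
  have hw : Measurable fun x => ∫ z, z ^ 2 ∂condDistrib (ε 0) X P x :=
    (hsq.comp_measurable measurable_snd).integral_kernel_prod_right'.measurable
  refine ⟨fun x => (∫ z, z ^ 2 ∂condDistrib (ε 0) X P x).toNNReal, hw.real_toNNReal, ?_⟩
  have hcomp : condDistrib ((fun e : Fin (m + 1) → ℝ => e i) ∘ (fun ω t => ε t ω)) X P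
      =ᵐ[P.map X] (condDistrib (fun ω t => ε t ω) X P).map (fun e : Fin (m + 1) → ℝ => e i) :=
    condDistrib_comp X (measurable_pi_lambda _ hε).aemeasurable (measurable_pi_apply i)
  have h1 := ae_of_ae_map hX.aemeasurable hcomp
  have h2 := ae_of_ae_map hX.aemeasurable hiid
  have h3 := ae_of_ae_map hX.aemeasurable hgauss
  have h4 := condExp_ae_eq_integral_condDistrib' hX hint1
  have h5 := condExp_ae_eq_integral_condDistrib hX (hε 0).aemeasurable hsq hint2
  filter_upwards [h1, h2, h3, h4, h5, hmean, hvar] with ω h1 h2 h3 h4 h5 hmean hvar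
  rw [h5] at hvar
  rw [h4] at hmean
  set μ := condDistrib (ε 0) X P (X ω) with hμ
  -- Every marginal of the product law is μ, so Gaussianity of a single error passes to the common
  -- law.
  have h6 : condDistrib (ε i) X P (X ω) = μ := by
    have : (fun e : Fin (m + 1) → ℝ => e i) ∘ (fun ω t => ε t ω) = ε i := rfl
    rw [this, Kernel.map_apply _ (measurable_pi_apply i), h2] at h1
    rw [h1]
    exact (measurePreserving_eval (fun _ : Fin (m + 1) => μ) i).map_eq
  rw [h6] at h3
  have h7 : Var[id; μ] = ∫ z, z ^ 2 ∂μ := by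
    rw [variance_of_integral_eq_zero aemeasurable_id hmean]; rfl
  have h8 : μ = gaussianReal 0 (∫ z, z ^ 2 ∂μ).toNNReal := by
    have := IsGaussian.eq_gaussianReal μ h3
    rw [h7] at this
    rwa [show ∫ z, id z ∂μ = (0 : ℝ) from hmean] at this
  refine ⟨?_, ?_⟩
  · rw [h2]; congr 1; funext; exact h8
  · have hpos : 0 ≤ ∫ z, z ^ 2 ∂μ := integral_nonneg fun z => sq_nonneg z
    rw [Real.coe_toNNReal _ hpos]
    exact hvar

end ConditionalLaw

/-! ### Conditioning on the strictly exogenous regressors. -/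

section Transfer

variable {Ω : Type*} {T K : ℕ}

/-- Doob–Dynkin factorization: given the regressors, the transformation is a constant matrix, as the
results for fixed designs require. -/
lemma exists_measurable_transformation {Xs : Ω → Matrix (Fin T) (Fin K) ℝ}
    {Γ : Ω → Matrix (Fin T) (Fin T) ℝ} (hΓ : Measurable[sigmaAlg Xs] Γ) :
    ∃ G : Matrix (Fin T) (Fin K) ℝ → Matrix (Fin T) (Fin T) ℝ, Measurable G ∧ Γ = G ∘ Xs := by
  have : StandardBorelSpace (Matrix (Fin T) (Fin T) ℝ) :=
    inferInstanceAs (StandardBorelSpace (Fin T → Fin T → ℝ))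
  exact Measurable.exists_eq_measurable_comp hΓ

variable [MeasurableSpace Ω]

@[fun_prop]
lemma Measurable.limitVariance {X : Ω → Matrix (Fin T) (Fin K) ℝ}
    {Γ : Ω → Matrix (Fin T) (Fin T) ℝ} (α r : Fin K → ℝ) {v : Ω → ℝ} (hX : Measurable X)
    (hΓ : Measurable Γ) (hv : Measurable v) :
    Measurable fun ω => limitVariance (X ω) (Γ ω) α r (v ω) := by
  have hs : Measurable fun ω => limitSlope (X ω) (Γ ω) α r (v ω) := by
    unfold limitSlope
    refine Measurable.div ?_ (measurable_const.add ?_) <;> fun_prop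
  have hl : Measurable fun ω => limitContrast (X ω) (Γ ω) α r (v ω) := by
    unfold limitContrast
    fun_prop
  unfold _root_.limitVariance
  fun_prop

variable {P : Measure Ω} [IsProbabilityMeasure P] {Xs : Ω → Matrix (Fin T) (Fin K) ℝ}
  {ε : Fin (T + 1) → Ω → ℝ} {w : Matrix (Fin T) (Fin K) ℝ → ℝ≥0}
  {G : Matrix (Fin T) (Fin K) ℝ → Matrix (Fin T) (Fin T) ℝ}

lemma measure_varianceBound_lt_le (hXs : Measurable Xs) (hε : ∀ t, Measurable (ε t))
    (hw : Measurable w) (hG : Measurable G) (α β r : Fin K → ℝ) {A : Set Ω} {η : ℝ} {δ : ℝ≥0∞}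
    (hlaw : ∀ᵐ ω ∂P, condDistrib (fun ω t => ε t ω) Xs P (Xs ω) =
      Measure.pi fun _ => gaussianReal 0 (w (Xs ω)))
    (h : ∀ᵐ ω ∂P, ω ∉ A → (Measure.pi fun _ : Fin (T + 1) => gaussianReal 0 (w (Xs ω)))
      {e | varianceBound (Xs ω) (regressors (Xs ω) α e) (outcomes (Xs ω) α β e) (G (Xs ω)) r <
        (1 - η) * limitVariance (Xs ω) (G (Xs ω)) α r (w (Xs ω))} ≤ δ) :
    P {ω | varianceBound (Xs ω) (regressors (Xs ω) α fun t => ε t ω)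
        (outcomes (Xs ω) α β fun t => ε t ω) (G (Xs ω)) r <
      (1 - η) * limitVariance (Xs ω) (G (Xs ω)) α r (w (Xs ω))} ≤ δ + P A := by
  have hS : MeasurableSet {q : Matrix (Fin T) (Fin K) ℝ × (Fin (T + 1) → ℝ) |
      varianceBound q.1 (regressors q.1 α q.2) (outcomes q.1 α β q.2) (G q.1) r <
        (1 - η) * limitVariance q.1 (G q.1) α r (w q.1)} :=
    measurableSet_lt (by fun_prop) (by fun_prop)
  refine measure_le_of_condDistrib hXs (measurable_pi_lambda _ hε) hS ?_
  filter_upwards [hlaw, h] with ω h1 h2 h3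
  rw [h1]
  exact h2 h3

lemma norm_charFun_estimator_sub_le (hXs : Measurable Xs) (hε : ∀ t, Measurable (ε t))
    (hw : Measurable w) (hG : Measurable G) (α β r : Fin K → ℝ) {A : Set Ω} {δ p : ℝ} (hδ : 0 ≤ δ)
    (hp : 0 ≤ p) (hA : P A ≤ ENNReal.ofReal p) (t : ℝ)
    (hlaw : ∀ᵐ ω ∂P, condDistrib (fun ω t => ε t ω) Xs P (Xs ω) =
      Measure.pi fun _ => gaussianReal 0 (w (Xs ω)))
    (h : ∀ᵐ ω ∂P, ω ∉ A →
      ‖(∫ e, Complex.exp (t * ((r ⬝ᵥ betaIV (regressors (Xs ω) α e) (outcomes (Xs ω) α β e)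
          (G (Xs ω)) - r ⬝ᵥ β) / √(limitVariance (Xs ω) (G (Xs ω)) α r (w (Xs ω))) : ℝ) *
          Complex.I) ∂(Measure.pi fun _ : Fin (T + 1) => gaussianReal 0 (w (Xs ω)))) -
        Complex.exp (-t ^ 2 / 2)‖ ≤ δ) :
    ‖(∫ ω, Complex.exp (t * ((r ⬝ᵥ betaIV (regressors (Xs ω) α fun t => ε t ω)
        (outcomes (Xs ω) α β fun t => ε t ω) (G (Xs ω)) - r ⬝ᵥ β) /
          √(limitVariance (Xs ω) (G (Xs ω)) α r (w (Xs ω))) : ℝ) * Complex.I) ∂P) -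
      Complex.exp (-t ^ 2 / 2)‖ ≤ δ + 2 * p := by
  have hk : Measurable fun q : Matrix (Fin T) (Fin K) ℝ × (Fin (T + 1) → ℝ) =>
      (r ⬝ᵥ betaIV (regressors q.1 α q.2) (outcomes q.1 α β q.2) (G q.1) - r ⬝ᵥ β) /
        √(limitVariance q.1 (G q.1) α r (w q.1)) := by fun_prop
  refine norm_integral_sub_le_of_condDistrib hXs (measurable_pi_lambda _ hε)
    (f := fun q => Complex.exp (t * ((r ⬝ᵥ betaIV (regressors q.1 α q.2) (outcomes q.1 α β q.2)
      (G q.1) - r ⬝ᵥ β) / √(limitVariance q.1 (G q.1) α r (w q.1)) : ℝ) * Complex.I))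
    (by fun_prop) (fun q => ?_) ?_ hδ hp hA ?_
  · rw [← Complex.ofReal_mul, Complex.norm_exp_ofReal_mul_I]
  · rw [show (-(t : ℂ) ^ 2 / 2) = ((-t ^ 2 / 2 : ℝ) : ℂ) by push_cast; ring,
      Complex.norm_exp_ofReal, Real.exp_le_one_iff]
    nlinarith [sq_nonneg t]
  · filter_upwards [hlaw, h] with ω h1 h2 h3
    rw [h1]
    exact h2 h3

end Transfer

/-! ### Diagonal choice of the shrinkage, weak convergence and coverage. -/

section Diagonal

/-- Take the largest k ≤ n for which p k n holds; it exceeds any fixed j once p j n holds and n ≥ j.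
-/
lemma exists_tendsto_atTop_of_forall_eventually {p : ℕ → ℕ → Prop}
    (h : ∀ k, ∀ᶠ n in atTop, p k n) :
    ∃ k : ℕ → ℕ, Tendsto k atTop atTop ∧ ∀ᶠ n in atTop, p (k n) n := by
  classical
  refine ⟨fun n => Nat.findGreatest (fun k => p k n) n, tendsto_atTop.2 fun j => ?_, ?_⟩
  · filter_upwards [h j, eventually_ge_atTop j] with n h1 h2
    exact Nat.le_findGreatest h2 h1
  · filter_upwards [h 0] with n hn
    exact Nat.findGreatest_spec (P := fun k => p k n) (Nat.zero_le n) hn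

variable {Ω : ℕ → Type*} [∀ n, MeasurableSpace (Ω n)] {P : ∀ n, Measure (Ω n)} {U V S : ∀ n, Ω n → ℝ}

/-- A standardized statistic stays asymptotically Gaussian under a scale factor tending to one. -/
lemma tendsto_charFun_mul {W : ∀ n, Ω n → ℝ} {s : ℕ → ℝ} (hs : Tendsto s atTop (𝓝 1))
    (h : ∀ η : ℝ, 0 < η → ∀ B : ℝ, 0 < B → ∀ᶠ n in atTop, ∀ t : ℝ, |t| ≤ B →
      ‖(∫ ω, Complex.exp (t * (W n ω : ℝ) * Complex.I) ∂(P n)) - Complex.exp (-t ^ 2 / 2)‖ ≤ η)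
    (t : ℝ) :
    Tendsto (fun n => ∫ ω, Complex.exp (t * (s n * W n ω : ℝ) * Complex.I) ∂(P n)) atTop
      (𝓝 (Complex.exp (-t ^ 2 / 2))) := by
  have h1 : Tendsto (fun n => t * s n) atTop (𝓝 t) := by simpa using hs.const_mul t
  have h2 : Tendsto (fun n => Complex.exp (-((t * s n : ℝ) : ℂ) ^ 2 / 2)) atTop
      (𝓝 (Complex.exp (-t ^ 2 / 2))) := by
    have : Continuous fun x : ℝ => Complex.exp (-(x : ℂ) ^ 2 / 2) := by fun_prop
    exact (this.tendsto t).comp h1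
  have h3 : Tendsto (fun n => (∫ ω, Complex.exp (t * (s n * W n ω : ℝ) * Complex.I) ∂(P n)) -
      Complex.exp (-((t * s n : ℝ) : ℂ) ^ 2 / 2)) atTop (𝓝 0) := by
    rw [tendsto_zero_iff_norm_tendsto_zero, Metric.tendsto_nhds]
    intro η hη
    -- The scale factor moves the argument of the characteristic function, which is why the
    -- hypothesis is uniform on bounded intervals.
    have h4 : ∀ᶠ n in atTop, |t * s n| ≤ |t| + 1 := by
      have := (continuous_abs.tendsto t).comp h1
      exact this.eventually_le_const (by linarith : |t| < |t| + 1)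
    filter_upwards [h (η / 2) (by linarith) (|t| + 1) (by positivity), h4] with n h5 h6
    have h7 := h5 _ h6
    have h8 : ∀ ω, ((t * s n : ℝ) : ℂ) * (W n ω : ℂ) = t * (s n * W n ω : ℝ) := by
      intro ω; push_cast; ring
    simp_rw [h8] at h7
    rw [Real.dist_eq, sub_zero, abs_of_nonneg (norm_nonneg _)]
    linarith
  simpa using h3.add h2

variable [∀ n, IsProbabilityMeasure (P n)]

lemma tendstoInDistribution_gaussianReal_of_charFun {W : ∀ n, Ω n → ℝ}
    (hW : ∀ n, Measurable (W n))
    (h : ∀ t : ℝ, Tendsto (fun n => ∫ ω, Complex.exp (t * (W n ω : ℝ) * Complex.I) ∂(P n)) atTop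
      (𝓝 (Complex.exp (-t ^ 2 / 2)))) :
    TendstoInDistribution W atTop (id : ℝ → ℝ) P (gaussianReal 0 1) where
  forall_aemeasurable n := (hW n).aemeasurable
  tendsto := by
    refine ProbabilityMeasure.tendsto_iff_tendsto_charFun.2 fun t => ?_
    simp only [ProbabilityMeasure.coe_mk, Measure.map_id]
    rw [charFun_gaussianReal]
    refine (h t).congr' (Eventually.of_forall fun n => ?_) |>.trans (le_of_eq ?_)
    · rw [charFun_apply_real, integral_map (hW n).aemeasurable (by fun_prop)]
    · congr 2; push_cast; ring

lemma tendsto_measure_compl_zero {A B : ∀ n, Set (Ω n)} (h : ∀ n, A n ∪ B n = Set.univ)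
    (hB : Tendsto (fun n => P n (B n)) atTop (𝓝 0)) :
    Tendsto (fun n => P n (A n)) atTop (𝓝 1) := by
  have h1 : ∀ n, 1 - P n (B n) ≤ P n (A n) := fun n => by
    rw [tsub_le_iff_right, ← measure_univ (μ := P n), ← h n]
    exact measure_union_le _ _
  have h2 : Tendsto (fun n => 1 - P n (B n)) atTop (𝓝 1) := by
    simpa using ENNReal.Tendsto.sub tendsto_const_nhds hB (Or.inl ENNReal.one_ne_top)
  exact tendsto_of_tendsto_of_tendsto_of_le_of_le h2 tendsto_const_nhds h1 fun n => prob_le_one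

/-- Coverage of intervals whose squared length is asymptotically not too small. -/
lemma le_liminf_measure_abs_le {Sig : ∀ n, Ω n → ℝ} (hSig : ∀ n ω, 0 < Sig n ω)
    (hU : TendstoInDistribution (fun n ω => U n ω / √(Sig n ω)) atTop (id : ℝ → ℝ) P
      (gaussianReal 0 1))
    (hV : Tendsto (fun n => P n {ω | V n ω < Sig n ω}) atTop (𝓝 0)) (z : ℝ) :
    gaussianReal 0 1 (Set.Icc (-z) z) ≤
      liminf (fun n => P n {ω | |U n ω| ≤ z * √(V n ω)}) atTop := by
  rcases lt_or_ge z 0 with hz0 | hz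
  · rw [Set.Icc_eq_empty (by linarith), measure_empty]; exact zero_le
  have h1 : Tendsto (fun n => ((P n).map fun ω => U n ω / √(Sig n ω)) (Set.Icc (-z) z)) atTop
      (𝓝 (gaussianReal 0 1 (Set.Icc (-z) z))) := by
    have h2 := ProbabilityMeasure.tendsto_measure_of_null_frontier_of_tendsto' hU.tendsto
      (E := Set.Icc (-z) z) (by
        simp only [ProbabilityMeasure.coe_mk, Measure.map_id]
        have : NullSingletonClass (gaussianReal 0 1) := nullSingletonClass_gaussianReal one_ne_zero
        rw [frontier_Icc (by linarith)]
        exact (Set.toFinite {-z, z}).measure_zero _)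
    simpa only [ProbabilityMeasure.coe_mk, Measure.map_id] using h2
  -- Subtracting the vanishing probability that V falls below its target turns coverage under the
  -- target variance into a lower bound for coverage under V.
  have h2 : Tendsto (fun n => ((P n).map fun ω => U n ω / √(Sig n ω)) (Set.Icc (-z) z) -
      P n {ω | V n ω < Sig n ω}) atTop (𝓝 (gaussianReal 0 1 (Set.Icc (-z) z))) := by
    simpa using ENNReal.Tendsto.sub h1 hV (Or.inr ENNReal.zero_ne_top)
  rw [← h2.liminf_eq]
  refine liminf_le_liminf (Eventually.of_forall fun n => ?_)
  rw [tsub_le_iff_right, Measure.map_apply_of_aemeasurable (hU.forall_aemeasurable n)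
    measurableSet_Icc]
  refine (measure_mono fun ω hω => ?_).trans (measure_union_le _ _)
  by_cases hlt : V n ω < Sig n ω
  · exact Or.inr hlt
  · refine Or.inl ?_
    have hs : 0 < √(Sig n ω) := Real.sqrt_pos.2 (hSig n ω)
    have h3 : |U n ω / √(Sig n ω)| ≤ z := abs_le.2 hω
    rw [abs_div, abs_of_pos hs, div_le_iff₀ hs] at h3
    exact h3.trans (mul_le_mul_of_nonneg_left (Real.sqrt_le_sqrt (not_lt.1 hlt)) hz)

/-- Validity of conservative inference: a random variable that is asymptotically standard Gaussian
when standardized by `S`, and an estimated variance `V` asymptotically not below `S`. -/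
lemma conservative_inference {𝓧 : ℕ → Type*} [∀ n, MeasurableSpace (𝓧 n)]
    {Xs : ∀ n, Ω n → 𝓧 n} (hXs : ∀ n, Measurable (Xs n))
    (hU : ∀ n, Measurable (U n)) (hS : ∀ n, Measurable[sigmaAlg (Xs n)] (S n))
    (hpos : ∀ n, ∀ᵐ ω ∂(P n), 0 < S n ω)
    (hV : ∀ η : ℝ, 0 < η → ∀ᶠ n in atTop,
      P n {ω | V n ω < (1 - η) * S n ω} ≤ ENNReal.ofReal η)
    (hchar : ∀ η : ℝ, 0 < η → ∀ B : ℝ, 0 < B → ∀ᶠ n in atTop, ∀ t : ℝ, |t| ≤ B →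
      ‖(∫ ω, Complex.exp (t * (U n ω / √(S n ω) : ℝ) * Complex.I) ∂(P n)) -
        Complex.exp (-t ^ 2 / 2)‖ ≤ η) :
    (∃ Sig : ∀ n, Ω n → ℝ, (∀ n, Measurable[sigmaAlg (Xs n)] (Sig n)) ∧ (∀ n ω, 0 < Sig n ω) ∧
      TendstoInDistribution (fun n ω => U n ω / √(Sig n ω)) atTop (id : ℝ → ℝ) P
        (gaussianReal 0 1) ∧
      Tendsto (fun n => P n {ω | Sig n ω ≤ V n ω}) atTop (𝓝 1)) ∧
    ∀ z : ℝ, 0 < z → gaussianReal 0 1 (Set.Icc (-z) z) ≤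
      liminf (fun n => P n {ω | |U n ω| ≤ z * √(V n ω)}) atTop := by
  obtain ⟨k, hk, hkV⟩ := exists_tendsto_atTop_of_forall_eventually
    (p := fun k n => P n {ω | V n ω < (1 - 1 / ((k : ℝ) + 2)) * S n ω} ≤
      ENNReal.ofReal (1 / ((k : ℝ) + 2)))
    fun k => hV _ (by positivity)
  have hη : Tendsto (fun n => 1 / ((k n : ℝ) + 2)) atTop (𝓝 0) := by
    simp only [one_div]
    exact tendsto_inv_atTop_zero.comp
      (tendsto_atTop_add_const_right _ _ (tendsto_natCast_atTop_atTop.comp hk))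
  set θ : ℕ → ℝ := fun n => 1 - 1 / ((k n : ℝ) + 2) with hθ
  have hθ0 : ∀ n, 0 < θ n := fun n => by
    have : 1 / ((k n : ℝ) + 2) < 1 := by
      rw [div_lt_one (by positivity)]
      have : (0 : ℝ) ≤ k n := by positivity
      linarith
    simp only [hθ]; linarith
  have hθ1 : Tendsto θ atTop (𝓝 1) := by
    have := hη.const_sub 1
    rwa [sub_zero] at this
  -- The factor θ n tends to one, so it absorbs the relative shortfall of V without affecting the
  -- limit law. The value 1 on the null set where S is not positive secures positivity everywhere.
  set Sig : ∀ n, Ω n → ℝ := fun n ω => if 0 < S n ω then θ n * S n ω else 1 with hSig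
  have hSigpos : ∀ n ω, 0 < Sig n ω := fun n ω => by
    simp only [hSig]
    split_ifs with h
    · exact mul_pos (hθ0 n) h
    · exact one_pos
  have hSigmeas : ∀ n, Measurable[sigmaAlg (Xs n)] (Sig n) := fun n => by
    refine Measurable.ite (measurableSet_lt measurable_const (hS n)) ?_ measurable_const
    exact (hS n).const_mul _
  have hdist : TendstoInDistribution (fun n ω => U n ω / √(Sig n ω)) atTop (id : ℝ → ℝ) P
      (gaussianReal 0 1) := by
    refine tendstoInDistribution_gaussianReal_of_charFun
      (fun n => (hU n).div ((hSigmeas n).mono (hXs n).comap_le le_rfl).sqrt) fun t => ?_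
    have hs : Tendsto (fun n => (√(θ n))⁻¹) atTop (𝓝 1) := by
      simpa using hθ1.sqrt.inv₀ (by simp)
    refine (tendsto_charFun_mul hs hchar t).congr fun n => integral_congr_ae ?_
    filter_upwards [hpos n] with ω hω
    have : U n ω / √(Sig n ω) = (√(θ n))⁻¹ * (U n ω / √(S n ω)) := by
      simp only [hSig]
      rw [if_pos hω, Real.sqrt_mul (hθ0 n).le, div_mul_eq_div_div, inv_mul_eq_div, div_right_comm]
    rw [this]
  have hVSig : Tendsto (fun n => P n {ω | V n ω < Sig n ω}) atTop (𝓝 0) := by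
    have h0 : Tendsto (fun n => ENNReal.ofReal (1 / ((k n : ℝ) + 2))) atTop (𝓝 0) := by
      simpa using ENNReal.tendsto_ofReal hη
    refine tendsto_of_tendsto_of_tendsto_of_le_of_le' tendsto_const_nhds h0
      (Eventually.of_forall fun n => zero_le) ?_
    filter_upwards [hkV] with n hn
    refine (measure_mono_ae ?_).trans hn
    filter_upwards [hpos n] with ω hω hlt
    change V n ω < θ n * S n ω
    have : Sig n ω = θ n * S n ω := if_pos hω
    rw [← this]
    exact hlt
  refine ⟨⟨Sig, hSigmeas, hSigpos, hdist, tendsto_measure_compl_zero (fun n => ?_) hVSig⟩,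
    fun z _ => le_liminf_measure_abs_le hSigpos hdist hVSig z⟩
  ext ω
  simpa using le_or_gt (Sig n ω) (V n ω)

end Diagonal

/-! ### From the assumptions on the array to regular designs. -/

section RegressionArray

variable {Ω : ℕ → Type*} [∀ n, MeasurableSpace (Ω n)] {P : ∀ n, Measure (Ω n)}

/-- A bound in probability by a constant that is at least one. -/
lemma FeedbackIV.IsBoundedInProb.exists_one_le {Y : ∀ n, Ω n → ℝ} (h : IsBoundedInProb P Y) {δ : ℝ}
    (hδ : 0 < δ) :
    ∃ M : ℝ, 1 ≤ M ∧ ∀ᶠ n in atTop, P n {ω | M < |Y n ω|} ≤ ENNReal.ofReal δ := by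
  obtain ⟨M, hM⟩ := h δ hδ
  refine ⟨max M 1, le_max_right _ _, hM.mono fun n hn => (measure_mono fun ω hω => ?_).trans hn⟩
  exact (le_max_left M 1).trans_lt hω

lemma exists_regularDesign {T K : ℕ} {c C M : ℝ} {X : Matrix (Fin T) (Fin K) ℝ}
    {Γ : Matrix (Fin T) (Fin T) ℝ} {α r : Fin K → ℝ} {v : ℝ≥0} (hc : 0 < c)
    (hr : r ≠ 0) (hK : (K : ℝ) < (1 - c) * T) (hX : X.rank = K) (hv : c < v ∧ v < C)
    (hΓ : opNorm Γ < 1 - c) (htr : (feedbackForm X Γ).trace = 0) (hM : 1 ≤ M)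
    (hα : |α ⬝ᵥ (((T : ℝ)⁻¹ • (Xᵀ * X))⁻¹ *ᵥ α)| ≤ M) :
    ∃ a, RegularDesign c (max C 1) M X Γ α r a v := by
  have hT : 0 < T := by
    refine Nat.pos_of_ne_zero fun h => ?_
    have : (0 : ℝ) ≤ K := by positivity
    simp only [h, Nat.cast_zero, mul_zero] at hK
    linarith
  obtain ⟨a, ha, hle⟩ := exists_feedback_eq hX hT hM hα
  exact ⟨a, hc, le_max_right _ _, hM, hΓ, hX, hK, ha, hle, hv.1,
    hv.2.trans_le (le_max_left _ _), htr, hr⟩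

end RegressionArray

end

theorem theorem6
    -- sample sizes, numbers of regressors, and a probability space for each sample
    (T K : ℕ → ℕ) (hT : Tendsto T atTop atTop)
    {Ω : ℕ → Type*} [∀ n, MeasurableSpace (Ω n)]
    (P : ∀ n, Measure (Ω n)) [∀ n, IsProbabilityMeasure (P n)]
    -- strictly exogenous part of the regressors, errors, non-random vectors, constants
    (Xs : ∀ n, Ω n → Matrix (Fin (T n)) (Fin (K n)) ℝ) (hXs : ∀ n, Measurable (Xs n))
    (ε : ∀ n, Fin (T n + 1) → Ω n → ℝ) (hε : ∀ n t, Measurable (ε n t))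
    (α β r : ∀ n, Fin (K n) → ℝ) (hr : ∀ n, r n ≠ 0)
    (c C : ℝ) (hc : 0 < c)
    -- (i) the strictly exogenous part has full rank
    (hrank : ∀ n, ∀ᵐ ω ∂(P n), (Xs n ω).rank = K n)
    -- (ii) conditionally i.i.d. errors with mean zero, variance in (c, C), bounded fourth moment
    (hiid : ∀ n, CondIID (P n) (Xs n) (ε n))
    (hmean : ∀ n t, (P n)[ε n t | sigmaAlg (Xs n)] =ᵐ[P n] 0)
    (hvar : ∀ n t, ∀ᵐ ω ∂(P n),
      c < ((P n)[fun ω' => ε n t ω' ^ 2 | sigmaAlg (Xs n)]) ω ∧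
        ((P n)[fun ω' => ε n t ω' ^ 2 | sigmaAlg (Xs n)]) ω < C)
    (hint4 : ∀ n t, Integrable (fun ω => ε n t ω ^ 4) (P n))
    (hfourth : ∀ n t, ∀ᵐ ω ∂(P n),
      ((P n)[fun ω' => ε n t ω' ^ 4 | sigmaAlg (Xs n)]) ω < C)
    -- (iii) sizes of the feedback vector and of the contrast
    (hα : IsBoundedInProb P fun n ω =>
      α n ⬝ᵥ (((T n : ℝ)⁻¹ • ((Xs n ω)ᵀ * Xs n ω))⁻¹ *ᵥ α n))
    (hrb : IsBoundedInProb P fun n ω =>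
      r n ⬝ᵥ (((T n : ℝ)⁻¹ • ((Xs n ω)ᵀ * Xs n ω))⁻¹ *ᵥ r n))
    -- (iv) number of regressors
    (hK : ∀ n, (K n : ℝ) < (1 - c) * T n)
    -- conditionally Gaussian errors
    (hgauss : ∀ n, CondGaussian (P n) (Xs n) (ε n 1))
    -- the transformation
    (Γ : ∀ n, Ω n → Matrix (Fin (T n)) (Fin (T n)) ℝ)
    (hΓmeas : ∀ n, Measurable[sigmaAlg (Xs n)] (Γ n))
    (hΓnorm : ∀ n, ∀ᵐ ω ∂(P n), opNorm (Γ n ω) < 1 - c)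
    (hΓeq : ∀ n, ∀ᵐ ω ∂(P n),
      ((lagMatrix (T n))ᵀ * (1 - Γ n ω) * obliqueProj (Xs n ω) (Γ n ω)).trace = 0)
    -- observed data
    (X : ∀ n, Ω n → Matrix (Fin (T n)) (Fin (K n)) ℝ)
    (hX : ∀ n ω, X n ω = regressors (Xs n ω) (α n) (fun t => ε n t ω))
    (y : ∀ n, Ω n → Fin (T n) → ℝ)
    (hy : ∀ n ω, y n ω = outcomes (Xs n ω) (α n) (β n) (fun t => ε n t ω)) :
    (∃ Sig : ∀ n, Ω n → ℝ,
      (∀ n, Measurable[sigmaAlg (Xs n)] (Sig n)) ∧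
      (∀ n ω, 0 < Sig n ω) ∧
      TendstoInDistribution
        (fun n ω => (r n ⬝ᵥ betaIV (X n ω) (y n ω) (Γ n ω) - r n ⬝ᵥ β n) / √(Sig n ω))
        atTop (id : ℝ → ℝ) P (gaussianReal 0 1) ∧
      Tendsto
        (fun n => P n {ω | Sig n ω ≤
          varianceBound (Xs n ω) (X n ω) (y n ω) (Γ n ω) (r n)})
        atTop (𝓝 1)) ∧
    -- conservative valid inference
    ∀ z : ℝ, 0 < z →
      gaussianReal 0 1 (Set.Icc (-z) z) ≤
        liminf (fun n => P n {ω | |r n ⬝ᵥ betaIV (X n ω) (y n ω) (Γ n ω) - r n ⬝ᵥ β n| ≤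
          z * √(varianceBound (Xs n ω) (X n ω) (y n ω) (Γ n ω) (r n))}) atTop := by
  obtain rfl : X = fun n ω => regressors (Xs n ω) (α n) fun t => ε n t ω :=
    funext fun n => funext (hX n)
  obtain rfl : y = fun n ω => outcomes (Xs n ω) (α n) (β n) fun t => ε n t ω :=
    funext fun n => funext (hy n)
  choose w hw hlaw using fun n => exists_condDistrib_eq_pi_gaussianReal (hXs n) (hε n) (hiid n)
    (hmean n 0) (hvar n 0) (hint4 n 0) 1 (hgauss n)
  choose G hG hΓG using fun n => exists_measurable_transformation (hΓmeas n)
  obtain rfl : Γ = fun n ω => G n (Xs n ω) := funext hΓG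
  -- The bound M stays inside the almost sure statement because it is chosen later, in terms of the
  -- tolerance.
  have hreg : ∀ n, ∀ᵐ ω ∂(P n), ∀ M : ℝ, 1 ≤ M →
      |α n ⬝ᵥ (((T n : ℝ)⁻¹ • ((Xs n ω)ᵀ * Xs n ω))⁻¹ *ᵥ α n)| ≤ M →
      ∃ a, RegularDesign c (max C 1) M (Xs n ω) (G n (Xs n ω)) (α n) (r n) a
        (w n (Xs n ω)) := by
    intro n
    filter_upwards [hrank n, hlaw n, hΓnorm n, hΓeq n] with ω h1 h2 h3 h4 M hM hM'
    exact exists_regularDesign hc (hr n) (hK n) h1 h2.2 h3 h4 hM hM'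
  have hlaw' := fun n => (hlaw n).mono fun ω h => h.1
  have hpos : ∀ n, ∀ᵐ ω ∂(P n),
      0 < limitVariance (Xs n ω) (G n (Xs n ω)) (α n) (r n) (w n (Xs n ω)) := by
    intro n
    filter_upwards [hreg n] with ω hω
    -- Positivity needs no uniformity: each realization is regular for its own M, the maximum of 1
    -- and the size of its feedback vector.
    obtain ⟨a, D⟩ := hω _ (le_max_left _ _) (le_max_right _ _)
    exact D.limitVariance_pos
  refine conservative_inference
    (S := fun n ω => limitVariance (Xs n ω) (G n (Xs n ω)) (α n) (r n) (w n (Xs n ω)))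
    hXs (fun n => ?_) (fun n => ?_) hpos (fun η hη => ?_) fun η hη B hB => ?_
  · have := hXs n
    have := hG n
    have : Measurable fun ω t => ε n t ω := measurable_pi_lambda _ (hε n)
    fun_prop
  · have h : Measurable fun x => limitVariance x (G n x) (α n) (r n) (w n x) := by
      have := hG n
      have := hw n
      fun_prop
    exact h.comp (comap_measurable (Xs n))
  -- Half of η pays for designs with large feedback, half for atypical errors given a regular
  -- design.
  · obtain ⟨M, hM1, hM⟩ := hα.exists_one_le (half_pos hη)
    obtain ⟨T₀, h₀⟩ := exists_forall_measure_varianceBound_lt_le hc (le_max_right C 1) hM1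
      (half_pos hη)
    filter_upwards [hM, hT.eventually_ge_atTop T₀] with n hn hTn
    refine (measure_mono_ae ((hpos n).mono fun ω hω hlt => ?_)).trans ((measure_varianceBound_lt_le (η := η / 2)
      (δ := ENNReal.ofReal (η / 2)) (hXs n) (hε n) (hw n) (hG n) (α n) (β n) (r n) (hlaw' n)
      ((hreg n).mono fun ω hω hM' => ?_)).trans ((add_le_add le_rfl hn).trans ?_))
    · exact lt_of_lt_of_le hlt (mul_le_mul_of_nonneg_right (by linarith) hω.le)
    · obtain ⟨a, D⟩ := hω M hM1 (not_lt.1 hM')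
      exact h₀ _ _ _ _ _ _ (β n) a _ hTn D
    · rw [← ENNReal.ofReal_add (by linarith) (by linarith), add_halves]
  -- An exceptional set of probability p costs 2p in the characteristic function, hence η/4 here and
  -- η/2 for the regular designs.
  · obtain ⟨M, hM1, hM⟩ := hα.exists_one_le (δ := η / 4) (by linarith)
    obtain ⟨T₀, h₀⟩ := exists_forall_norm_charFun_estimator_sub_le hc (le_max_right C 1) hM1
      (half_pos hη) hB
    filter_upwards [hM, hT.eventually_ge_atTop T₀] with n hn hTn t ht
    refine (norm_charFun_estimator_sub_le (δ := η / 2) (hXs n) (hε n) (hw n) (hG n) (α n) (β n)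
      (r n) (by linarith) (by linarith) hn t (hlaw' n)
      ((hreg n).mono fun ω hω hM' => ?_)).trans (by linarith)
    obtain ⟨a, D⟩ := hω M hM1 (not_lt.1 hM')
    exact h₀ _ _ _ _ _ _ (β n) a _ hTn D t ht
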